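/- **Setting.** Let $\mathbf{32}$ be the real Clifford representation with generators $\Gamma_0,\dots,\Gamma_5,\Gamma_{5'},\Gamma_6,\dots,\Gamma_9$, $\Gamma_a\Gamma_b+\Gamma_b\Gamma_a=2\eta_{ab}$, $\eta=\mathrm{diag}(-1,1,\dots,1)$, $\Gamma_0\cdots\Gamma_5\Gamma_{5'}\Gamma_6\cdots\Gamma_9=1$, with a nondegenerate skew pairing $(\overline{\phi}\psi)$ for which the $\Gamma_a$ are skew self-adjoint. Put $P=\tfrac12(1+\Gamma_{5'6789})$, $\overline P=1-P$. The indices $0,\dots,5$ are called tangential (there we write $\gamma_a=\Gamma_a$), the others transversal; $P$ also denotes the projection of $\mathbb{R}^{1,10}$ to $\mathbb{R}^{1,5}$. Repeated indices are summed, indices are shifted with $\eta$, brackets denote skew-symmetrization of weight one, and $\Gamma_{a_1\cdots a_n}$ is the skew-symmetrized product. Let $X$ be a super-spacetime of dimension $(1,10)\,|\,\mathbf{32}$: a supermanifold with super coframe fields $(E,\Psi)$ and spin connections $\Omega$ on the members $V_k$ of an open cover, related on overlaps by $\mathrm{Spin}(1,10)$-gauge transformations and satisfying $\mathrm{d}E^a+\Omega^a{}_bE^b=(\overline\Psi\,\Gamma^a\Psi)$.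 Let $\phi:\Sigma\to X$ be an M5-brane super-immersion of a supermanifold $\Sigma$ of dimension $(1,5)\,|\,2\cdot\mathbf 8$, with super-Darboux coframe $(E,\Psi)$: there is a super-shear map $\mathrm{Sh}$ on the sets $U_k=\phi^{-1}(V_k)$ such that for all coframes $(E',\Psi')$ in the transversal $\mathrm{Spin}(5)$-gauge orbit of $(E,\Psi)$, $\phi^*P(E',\Psi')$ is a super coframe on $\Sigma$ and $\phi^*\overline P(E',\Psi')=\mathrm{Sh}\cdot\phi^*P(E',\Psi')$. Write $(e,\psi)=\phi^*P(E,\Psi)$, $\omega^a{}_b=\phi^*\Omega^a{}_b$ for tangential $a,b$, and let $\tau_ae^a$ denote the $e$-component of $\phi^*(\overline P\Psi)$. Let $G_4^s=\tfrac1{4!}(G_4)_{a_1\cdots a_4}E^{a_1}\cdots E^{a_4}+\tfrac12(\overline\Psi\,\Gamma_{a_1a_2}\Psi)E^{a_1}E^{a_2}$ be a super 4-form on $X$ and $H_3^s=\tfrac1{3!}(H_3)_{a_1a_2a_3}e^{a_1}e^{a_2}e^{a_3}$ a super 3-form on $\Sigma$, where the components $(G_4)_{a_1\cdots a_4}$,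 $(H_3)_{a_1a_2a_3}$ are skew-symmetric even superfunctions. **Claim.** There is exactly one skew-symmetric tensor $\tilde H_3$ of even superfunctions on the $U_k$ that is self-dual, $(\tilde H_3)^{abc}=\tfrac1{3!}\epsilon^{abcdef}(\tilde H_3)_{def}$ in the orientation $\epsilon^{012345}=+1$, such that $$\phi^*(\overline P\Psi)=\slashed{\tilde H}_3\psi+\tau_ae^a,\qquad \slashed{\tilde H}_3=\tfrac1{3!}(\tilde H_3)_{abc}\gamma^{abc}.$$ With $(\tilde H_3^2)_a^b=(\tilde H_3)_{ac_1c_2}(\tilde H_3)^{c_1c_2b}$ and $\nabla$ the covariant derivative with respect to $\omega$, on every open subset $W$ of $\Sigma$ the Bianchi identity $\mathrm{d}H_3^s=\phi^*G_4^s$ is equivalent to the conjunction of the following conditions on all the sets $W\cap U_k$: (i) $\tfrac1{3!}\nabla_{[a_1}(H_3)_{a_2a_3a_4]}+\tfrac12(H_3)_{[a_1a_2|b|}(\overline{\tau_{a_3}}\gamma^b\tau_{a_4]})=\tfrac1{4!}(\phi^*G_4)_{[a_1\cdots a_4]}$; (ii) $\tfrac1{3!}\psi^\alpha\nabla_\alpha(H_3)_{a_1a_2a_3}=(H_3)_{[a_1a_2|b|}\big(\overline{\tau_{a_3]}}\gamma^b(1+\slashed{\tilde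 H}_3)\psi\big)+\big(\overline{\tau_{[a_1}}\gamma_{a_2a_3]}(\psi+\slashed{\tilde H}_3\psi)\big)$; (iii) $\mathrm{tr}(\tilde H_3^2\cdot\tilde H_3^2)\neq\tfrac32$ everywhere (i.e. the even superfunction $1-\tfrac23\mathrm{tr}(\tilde H_3^2\cdot\tilde H_3^2)$ is invertible), and $$(H_3)_{abc}=\frac{-4}{1-\tfrac23\mathrm{tr}(\tilde H_3^2\cdot\tilde H_3^2)}\big(\delta_a^{a'}+2(\tilde H_3^2)_a^{a'}\big)(\tilde H_3)_{a'bc}.$$ In particular, on any open subset where $\mathrm{tr}(\tilde H_3^2\cdot\tilde H_3^2)\neq\tfrac32$, the Bianchi identity is equivalent to (i), (ii) and the formula in (iii). -/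

import Mathlib

open TopologicalSpace
open scoped Manifold ContDiff

noncomputable section

universe u v w u' v'

/-! ## Supermanifolds, through their sheaf of super differential forms -/

/-- A topological space with a sheaf of differential graded-commutative superalgebras over `ℝ`
(forms on open sets). Bidegree `(n, s)`: form degree `n` and superdegree `s`. Signs:
`α β = (-1) ^ (n m + s r) β α` for `α` of bidegree `(n, s)` and `β` of bidegree `(m, r)`.
Bidegree `(0, *)` is the structure sheaf of superfunctions. -/
structure SuperSpace where
  body : Type u
  [top : TopologicalSpace body]
  form : Opens body → Type v
  [ring : ∀ U, Ring (form U)]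
  [algebra : ∀ U, Algebra ℝ (form U)]
  gr : ∀ U, ℕ × ZMod 2 → Submodule ℝ (form U)
  internal : ∀ U, DirectSum.IsInternal (gr U)
  one_mem : ∀ U, (1 : form U) ∈ gr U (0, 0)
  mul_mem : ∀ U (i j : ℕ × ZMod 2) (α β : form U), α ∈ gr U i → β ∈ gr U j →
    α * β ∈ gr U (i + j)
  supercomm : ∀ U (i j : ℕ × ZMod 2) (α β : form U), α ∈ gr U i → β ∈ gr U j →
    α * β = ((-1 : ℝ) ^ (i.1 * j.1 + i.2.val * j.2.val)) • (β * α)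
  d : ∀ U, form U →ₗ[ℝ] form U
  d_mem : ∀ U (n : ℕ) (s : ZMod 2) (α : form U), α ∈ gr U (n, s) → d U α ∈ gr U (n + 1, s)
  d_d : ∀ U (α : form U), d U (d U α) = 0
  d_mul : ∀ U (i : ℕ × ZMod 2) (α β : form U), α ∈ gr U i →
    d U (α * β) = d U α * β + ((-1 : ℝ) ^ i.1) • (α * d U β)
  res : ∀ {U V : Opens body}, V ≤ U → form U →ₐ[ℝ] form V
  res_self : ∀ (U : Opens body) (α : form U), res (le_refl U) α = α
  res_res : ∀ {U V W : Opens body} (h : V ≤ U) (h' : W ≤ V) (α : form U),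
    res h' (res h α) = res (h'.trans h) α
  res_mem : ∀ {U V : Opens body} (h : V ≤ U) (i : ℕ × ZMod 2) (α : form U),
    α ∈ gr U i → res h α ∈ gr V i
  res_d : ∀ {U V : Opens body} (h : V ≤ U) (α : form U), res h (d U α) = d V (res h α)
  /-- forms are determined locally -/
  separated : ∀ (𝒰 : Set (Opens body)) (α β : form (sSup 𝒰)),
    (∀ (U : Opens body) (hU : U ∈ 𝒰), res (le_sSup hU) α = res (le_sSup hU) β) → α = β
  /-- compatible families of forms of a fixed bidegree glue -/
  glue : ∀ (𝒰 : Set (Opens body)) (i : ℕ × ZMod 2) (s : ∀ U : 𝒰, form (U : Opens body)),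
    (∀ U : 𝒰, s U ∈ gr (U : Opens body) i) →
    (∀ U V : 𝒰, res (inf_le_left : (U : Opens body) ⊓ (V : Opens body) ≤ (U : Opens body)) (s U) =
      res (inf_le_right : (U : Opens body) ⊓ (V : Opens body) ≤ (V : Opens body)) (s V)) →
    ∃ α : form (sSup 𝒰), α ∈ gr (sSup 𝒰) i ∧ ∀ U : 𝒰, res (le_sSup U.2) α = s U

attribute [instance] SuperSpace.top SuperSpace.ring SuperSpace.algebra

namespace SuperSpace

/-- Superfunctions: forms of degree `0` (of either parity, or mixed). -/
def functions (Y : SuperSpace.{u, v}) (U : Opens Y.body) : Submodule ℝ (Y.form U) :=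
  Y.gr U (0, 0) ⊔ Y.gr U (0, 1)

/-- The image of an open set under an open embedding defined on `U`. -/
def imageOpens {B E : Type*} [TopologicalSpace B] [TopologicalSpace E] {U : Opens B} {f : U → E}
    (hf : Topology.IsOpenEmbedding f) (V : Opens B) : Opens E :=
  ⟨f '' {x | (x : B) ∈ V}, hf.isOpenMap _ (V.isOpen.preimage continuous_subtype_val)⟩

/-- Ordinary smooth functions on an open subset of `ℝ^p`. -/
abbrev Smooth {p : ℕ} (D : Opens (EuclideanSpace ℝ (Fin p))) : Type :=
  C^∞⟮𝓘(ℝ, EuclideanSpace ℝ (Fin p)), D; 𝓘(ℝ, ℝ), ℝ⟯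

/-- Ordered monomials in anticommuting elements `e` and commuting elements `ψ`. -/
def frameMonomial {A : Type*} [Ring A] {p q : ℕ} (e : Fin p → A) (ψ : Fin q → A)
    (i : Finset (Fin p) × (Fin q → ℕ)) : A :=
  (List.ofFn fun a => if a ∈ i.1 then e a else 1).prod * (List.ofFn fun α => ψ α ^ i.2 α).prod

/-- A supercoordinate chart of dimension `p|q` on `U`: even coordinates given by an open embedding
of `U` into `ℝ^p`, odd coordinates `θ`, such that on every open `V ≤ U` the forms are freely
generated, over the smooth functions on the image of `V`, by the `θ`, `dx` and `dθ`. -/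
structure Chart (Y : SuperSpace.{u, v}) (p q : ℕ) (U : Opens Y.body) where
  coord : U → EuclideanSpace ℝ (Fin p)
  emb : Topology.IsOpenEmbedding coord
  fn : ∀ V : Opens Y.body, V ≤ U → Smooth (imageOpens emb V) →ₐ[ℝ] Y.form V
  fn_mem : ∀ V (hV : V ≤ U) (f : Smooth (imageOpens emb V)), fn V hV f ∈ Y.gr V (0, 0)
  fn_res : ∀ V (hV : V ≤ U) V' (hV' : V' ≤ V) (f : Smooth (imageOpens emb V))
    (f' : Smooth (imageOpens emb V')),
    (∀ (y : EuclideanSpace ℝ (Fin p)) (hy : y ∈ imageOpens emb V)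
      (hy' : y ∈ imageOpens emb V'), f ⟨y, hy⟩ = f' ⟨y, hy'⟩) →
    Y.res hV' (fn V hV f) = fn V' (hV'.trans hV) f'
  θ : Fin q → Y.form U
  θ_mem : ∀ j, θ j ∈ Y.gr U (0, 1)
  dx : Fin p → Y.form U
  dx_mem : ∀ i, dx i ∈ Y.gr U (1, 0)
  /-- `df = ∑ᵢ (∂f/∂xⁱ) dxⁱ` for functions of the even coordinates -/
  d_fn : ∀ V (hV : V ≤ U) (f : Smooth (imageOpens emb V))
    (g : Fin p → Smooth (imageOpens emb V)),
    (∀ i (y : imageOpens emb V),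
      lineDeriv ℝ (Function.extend Subtype.val f 0) (y : EuclideanSpace ℝ (Fin p))
        (EuclideanSpace.single i 1) = g i y) →
    Y.d V (fn V hV f) = ∑ i, fn V hV (g i) * Y.res hV (dx i)
  free : ∀ V (hV : V ≤ U) (η : Y.form V),
    ∃! c : (Finset (Fin q) × Finset (Fin p) × (Fin q → ℕ)) →₀ Smooth (imageOpens emb V),
      η = c.sum fun i f => fn V hV f *
        ((List.ofFn fun j => if j ∈ i.1 then Y.res hV (θ j) else 1).prod *
          frameMonomial (fun a => Y.res hV (dx a)) (fun j => Y.res hV (Y.d U (θ j))) i.2)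

/-- `(e, ψ)` is a super coframe field on `U`: 1-forms, `e` even and `ψ` odd, in whose ordered
monomials every form on every open subset has a unique expansion with superfunction
coefficients. -/
def IsCoframe (Y : SuperSpace.{u, v}) {p q : ℕ} (U : Opens Y.body) (e : Fin p → Y.form U)
    (ψ : Fin q → Y.form U) : Prop :=
  (∀ a, e a ∈ Y.gr U (1, 0)) ∧ (∀ α, ψ α ∈ Y.gr U (1, 1)) ∧
  ∀ (V : Opens Y.body) (h : V ≤ U) (η : Y.form V),
    ∃! c : (Finset (Fin p) × (Fin q → ℕ)) →₀ Y.form V,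
      (∀ i, c i ∈ Y.functions V) ∧
      η = c.sum fun i f => frameMonomial (fun a => Y.res h (e a)) (fun α => Y.res h (ψ α)) i * f

/-- The coefficient of a coframe monomial in the expansion `η = ∑ᵢ monomialᵢ * coeffᵢ`. -/
def coframeCoeff {Y : SuperSpace.{u, v}} {p q : ℕ} {U : Opens Y.body} {e : Fin p → Y.form U}
    {ψ : Fin q → Y.form U} (h : Y.IsCoframe U e ψ) (η : Y.form U)
    (i : Finset (Fin p) × (Fin q → ℕ)) : Y.form U :=
  (h.2.2 U le_rfl η).choose i

end SuperSpace

/-- A smooth supermanifold of dimension `p|q`. -/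
structure SuperManifold (p q : ℕ) extends SuperSpace.{u, v} where
  t2 : T2Space body
  secondCountable : SecondCountableTopology body
  charts : ∀ x : body, ∃ U : Opens body, x ∈ U ∧ Nonempty (toSuperSpace.Chart p q U)

/-- A map of supermanifolds: a continuous map of bodies with compatible pullback of superfunctions,
given together with its (unique) extension to the pullback of forms. -/
structure SuperMap (Y : SuperSpace.{u, v}) (X : SuperSpace.{u', v'}) where
  base : C(Y.body, X.body)
  pull : ∀ V : Opens X.body, X.form V →ₐ[ℝ] Y.form (Opens.comap base V)
  pull_mem : ∀ V (i : ℕ × ZMod 2) (α : X.form V), α ∈ X.gr V i →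
    pull V α ∈ Y.gr (Opens.comap base V) i
  pull_d : ∀ V (α : X.form V), pull V (X.d V α) = Y.d _ (pull V α)
  pull_res : ∀ {V V' : Opens X.body} (h : V' ≤ V) (α : X.form V),
    pull V' (X.res h α) = Y.res (fun _ hx => h hx) (pull V α)

/-! ## Tensor conventions -/

/-- The Minkowski metric `diag(-1, 1, …, 1)`. -/
def eta {n : ℕ} (a : Fin n) : ℝ := if a.val = 0 then -1 else 1

/-- Skew-symmetrization with weight one. -/
def skew {n : ℕ} {ι A : Type*} [AddCommGroup A] [Module ℝ A] (T : (Fin n → ι) → A)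
    (v : Fin n → ι) : A :=
  ((n.factorial : ℝ)⁻¹) • ∑ σ : Equiv.Perm (Fin n), (Equiv.Perm.sign σ : ℤ) • T (v ∘ σ)

/-- Skew-symmetry in all indices. -/
def IsSkew {n : ℕ} {ι A : Type*} [AddCommGroup A] (T : (Fin n → ι) → A) : Prop :=
  ∀ (v : Fin n → ι) (σ : Equiv.Perm (Fin n)), T (v ∘ σ) = (Equiv.Perm.sign σ : ℤ) • T v

/-- The totally skew symbol with value `1` on `(0, 1, …, 5)`. -/
def levi (v : Fin 6 → Fin 6) : ℝ := (Matrix.of fun i j => if v i = j then (1 : ℝ) else 0).det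

/-- The Hodge dual `(⋆T)^{abc} = (1/3!) ε^{abcdef} T_{def}` of a 3-tensor on `ℝ^{1,5}`, with lowered
indices, in the orientation `ε^{012345} = +1`. -/
def hodgeStar {A : Type*} [AddCommGroup A] [Module ℝ A] (T : (Fin 3 → Fin 6) → A)
    (v : Fin 3 → Fin 6) : A :=
  (6⁻¹ : ℝ) • ∑ w : Fin 3 → Fin 6, ((∏ i, eta (v i)) * levi (Fin.append v w)) • T w

/-- The square on two indices, `(T²)_a^b = T_{a c d} T^{c d b}`. -/
def square {A : Type*} [Ring A] [Algebra ℝ A] (T : (Fin 3 → Fin 6) → A) :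
    Matrix (Fin 6) (Fin 6) A :=
  fun a b => ∑ c, ∑ d, (eta c * eta d * eta b) • (T ![a, c, d] * T ![c, d, b])

/-! ## Spinors -/

/-- Tangential vector indices `0, …, 5`. -/
def tang (a : Fin 6) : Fin 11 := Fin.castAdd 5 a

/-- Transversal vector indices `5', 6, 7, 8, 9`. -/
def transv (a : Fin 5) : Fin 11 := Fin.natAdd 6 a

/-- Spinor indices of `P(32)`. -/
def chirP (α : Fin 16) : Fin 32 := Fin.castAdd 16 α

/-- Spinor indices of the complement of `P(32)`. -/
def chirN (α : Fin 16) : Fin 32 := Fin.natAdd 16 α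

/-- The real Clifford representation `32` of `Pin⁺(1,10)` with its invariant skew spinor pairing
`(φ̄ ψ) = φᵀ C ψ`, in a linear basis adapted to the projector `P`. -/
structure MajoranaRep where
  Γ : Fin 11 → Matrix (Fin 32) (Fin 32) ℝ
  C : Matrix (Fin 32) (Fin 32) ℝ
  clifford : ∀ a b, Γ a * Γ b + Γ b * Γ a = (if a = b then 2 * eta a else 0) • 1
  volume : (List.ofFn Γ).prod = 1
  skew_pairing : C.transpose = -C
  nondegenerate : C.det ≠ 0
  adjoint : ∀ a, (Γ a).transpose * C = -(C * Γ a)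
  /-- the basis is adapted to `P = (1 + Γ_{5'6789}) / 2` -/
  adapted : (2⁻¹ : ℝ) • (1 + (List.ofFn fun i : Fin 5 => Γ (transv i)).prod) =
    Matrix.diagonal fun α : Fin 32 => if α.val < 16 then (1 : ℝ) else 0

namespace MajoranaRep

variable (M : MajoranaRep)

/-- The projector `P = (1 + Γ_{5'6789}) / 2`. -/
def P : Matrix (Fin 32) (Fin 32) ℝ :=
  (2⁻¹ : ℝ) • (1 + (List.ofFn fun i : Fin 5 => M.Γ (transv i)).prod)

/-- `Γ_{a₁ ⋯ aₙ}`, the skew-symmetrized product. -/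
def gam {n : ℕ} (v : Fin n → Fin 11) : Matrix (Fin 32) (Fin 32) ℝ :=
  skew (fun w => (List.ofFn fun i => M.Γ (w i)).prod) v

/-- A real matrix acting on spinors with coefficients in `A`. -/
def act {A : Type*} [Ring A] [Algebra ℝ A] (N : Matrix (Fin 32) (Fin 32) ℝ) (x : Fin 32 → A) :
    Fin 32 → A :=
  fun α => ∑ β, N α β • x β

/-- The bilinear expression `(x̄ N y)`. -/
def pair {A : Type*} [Ring A] [Algebra ℝ A] (N : Matrix (Fin 32) (Fin 32) ℝ)
    (x y : Fin 32 → A) : A :=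
  ∑ α, ∑ β, (M.C * N) α β • (x α * y β)

/-- `(1/3!) T_{abc} γ^{abc}`. -/
def slash {A : Type*} [Ring A] [Algebra ℝ A] (T : (Fin 3 → Fin 6) → A) :
    Matrix (Fin 32) (Fin 32) A :=
  fun α β => (6⁻¹ : ℝ) • ∑ v : Fin 3 → Fin 6, ((∏ i, eta (v i)) * M.gam (tang ∘ v) α β) • T v

/-- `(g, R)` is a superfunction with values in `Spin(1,10)`: `g` acts on `32` and `R` on `ℝ^{1,10}`,
compatibly with Clifford multiplication and preserving the spinor pairing. -/
def IsSpin (X : SuperSpace.{u, v}) (U : Opens X.body) (g : Matrix (Fin 32) (Fin 32) (X.form U))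
    (R : Matrix (Fin 11) (Fin 11) (X.form U)) : Prop :=
  (∀ α β, g α β ∈ X.gr U (0, 0)) ∧ (∀ a b, R a b ∈ X.gr U (0, 0)) ∧
  (∀ b, g * (M.Γ b).map (algebraMap ℝ (X.form U)) =
    ∑ a, R a b • ((M.Γ a).map (algebraMap ℝ (X.form U)) * g)) ∧
  g.transpose * M.C.map (algebraMap ℝ (X.form U)) * g = M.C.map (algebraMap ℝ (X.form U))

/-- `(g, R)` takes values in the transversal subgroup `Spin(5)`. -/
def IsTransversalSpin (X : SuperSpace.{u, v}) (U : Opens X.body)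
    (g : Matrix (Fin 32) (Fin 32) (X.form U)) (R : Matrix (Fin 11) (Fin 11) (X.form U)) : Prop :=
  M.IsSpin X U g R ∧
  ∀ (a : Fin 6) (b : Fin 11), R (tang a) b = (if tang a = b then 1 else 0) ∧
    R b (tang a) = (if b = tang a then 1 else 0)

end MajoranaRep

/-! ## Super-spacetimes and M5-brane super-immersions -/

/-- An 11-dimensional super-spacetime: on the members of an open cover there are super coframe fields
`(E, Ψ)` and spin connections `conn`, related on overlaps by `Spin(1,10)`-gauge transformations,
and subject to the torsion constraint `dE^a + Ω^a_b E^b = (Ψ̄ Γ^a Ψ)`. -/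
structure SuperSpacetime (M : MajoranaRep) (X : SuperManifold.{u, v} 11 32) where
  K : Type w
  V : K → Opens X.body
  cover : ⨆ k, V k = ⊤
  E : ∀ k, Fin 11 → X.form (V k)
  Ψ : ∀ k, Fin 32 → X.form (V k)
  coframe : ∀ k, X.IsCoframe (V k) (E k) (Ψ k)
  conn : ∀ k, Matrix (Fin 11) (Fin 11) (X.form (V k))
  conn_mem : ∀ k a b, conn k a b ∈ X.gr (V k) (1, 0)
  conn_skew : ∀ k a b, eta a • conn k a b = -(eta b • conn k b a)
  torsion : ∀ k a, X.d _ (E k a) + ∑ b, conn k a b * E k b =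
    M.pair (eta a • M.Γ a) (Ψ k) (Ψ k)
  transition : ∀ k l, ∃ g R, M.IsSpin X.toSuperSpace (V k ⊓ V l) g R ∧
    (∀ a, X.res inf_le_right (E l a) = ∑ b, R a b * X.res inf_le_left (E k b)) ∧
    (∀ α, X.res inf_le_right (Ψ l α) = ∑ β, g α β * X.res inf_le_left (Ψ k β)) ∧
    ∀ a c, X.d _ (R a c) + ∑ b, X.res inf_le_right (conn l a b) * R b c =
      ∑ b, R a b * X.res inf_le_left (conn k b c)

/-- An M5-brane super-immersion, with respect to a super-Darboux coframe `(E, Ψ)` of the target: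
for every coframe `(E', Ψ')` in the transversal `Spin(5)`-gauge orbit of `(E, Ψ)`, the pullback of
`P(E', Ψ')` is a coframe on the worldvolume, and the pullback of the complementary part is its image
under the super-shear map `Sh`, which does not depend on the gauge transformation. (That the
differential of the map is injective follows from the coframe condition.) -/
structure M5SuperImmersion {M : MajoranaRep} {X : SuperManifold.{u', v'} 11 32}
    (S : SuperSpacetime.{u', v', w} M X) (Y : SuperManifold.{u, v} 6 16) extends
    SuperMap Y.toSuperSpace X.toSuperSpace where
  Sh00 : ∀ k, Matrix (Fin 5) (Fin 6) (Y.form (Opens.comap base (S.V k)))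
  Sh01 : ∀ k, Matrix (Fin 5) (Fin 16) (Y.form (Opens.comap base (S.V k)))
  Sh10 : ∀ k, Matrix (Fin 16) (Fin 6) (Y.form (Opens.comap base (S.V k)))
  Sh11 : ∀ k, Matrix (Fin 16) (Fin 16) (Y.form (Opens.comap base (S.V k)))
  Sh00_mem : ∀ k i a, Sh00 k i a ∈ Y.gr _ (0, 0)
  Sh01_mem : ∀ k i α, Sh01 k i α ∈ Y.gr _ (0, 1)
  Sh10_mem : ∀ k β a, Sh10 k β a ∈ Y.gr _ (0, 1)
  Sh11_mem : ∀ k β α, Sh11 k β α ∈ Y.gr _ (0, 0)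
  darboux_coframe : ∀ k g R, M.IsTransversalSpin X.toSuperSpace (S.V k) g R →
    Y.IsCoframe (Opens.comap base (S.V k))
      (fun a : Fin 6 => pull _ (R.mulVec (S.E k) (tang a)))
      (fun α : Fin 16 => pull _ (g.mulVec (S.Ψ k) (chirP α)))
  darboux_even : ∀ k g R, M.IsTransversalSpin X.toSuperSpace (S.V k) g R → ∀ i : Fin 5,
    pull _ (R.mulVec (S.E k) (transv i)) =
      ∑ a, Sh00 k i a * pull _ (R.mulVec (S.E k) (tang a)) +
      ∑ α, Sh01 k i α * pull _ (g.mulVec (S.Ψ k) (chirP α))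
  darboux_odd : ∀ k g R, M.IsTransversalSpin X.toSuperSpace (S.V k) g R → ∀ β : Fin 16,
    pull _ (g.mulVec (S.Ψ k) (chirN β)) =
      ∑ a, Sh10 k β a * pull _ (R.mulVec (S.E k) (tang a)) +
      ∑ α, Sh11 k β α * pull _ (g.mulVec (S.Ψ k) (chirP α))

namespace M5SuperImmersion

variable {M : MajoranaRep} {X : SuperManifold.{u', v'} 11 32} {S : SuperSpacetime.{u', v', w} M X}
  {Y : SuperManifold.{u, v} 6 16} (φ : M5SuperImmersion S Y)

/-- The patches of the worldvolume, preimages of those of the target. -/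
def U (k : S.K) : Opens Y.body := Opens.comap φ.base (S.V k)

/-- `e = φ^*(P E)`. -/
def e (k : S.K) (a : Fin 6) : Y.form (φ.U k) := φ.pull _ (S.E k (tang a))

/-- `ψ = φ^*(P Ψ)`, as a `32`-component spinor. -/
def ψ (k : S.K) : Fin 32 → Y.form (φ.U k) := fun α => φ.pull _ (MajoranaRep.act M.P (S.Ψ k) α)

/-- `ω^a_b = φ^* Ω^a_b` for tangential indices. -/
def conn (k : S.K) (a b : Fin 6) : Y.form (φ.U k) := φ.pull _ (S.conn k (tang a) (tang b))

/-- The odd-even component `τ_a` of the super-shear map, as a `32`-component spinor. -/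
def τ (k : S.K) (a : Fin 6) : Fin 32 → Y.form (φ.U k) :=
  Fin.append (fun _ : Fin 16 => 0) (fun β : Fin 16 => φ.Sh10 k β a)

/-- Since the identity is a transversal gauge transformation, `(e, ψ)` is a coframe. -/
theorem isCoframe (k : S.K) :
    Y.IsCoframe (φ.U k) (φ.e k) (fun α : Fin 16 => φ.ψ k (chirP α)) := by
  have h1 : M.IsTransversalSpin X.toSuperSpace (S.V k) 1 1 := by
    refine ⟨⟨fun α β => ?_, fun a b => ?_, fun b => ?_, ?_⟩, fun a b => ?_⟩
    · by_cases h : α = β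
      · subst h; simpa using X.one_mem _
      · rw [Matrix.one_apply_ne h]; exact Submodule.zero_mem _
    · by_cases h : a = b
      · subst h; simpa using X.one_mem _
      · rw [Matrix.one_apply_ne h]; exact Submodule.zero_mem _
    · rw [Finset.sum_eq_single b]
      · simp
      · intro a _ h
        rw [Matrix.one_apply_ne h, zero_smul]
      · simp
    · simp
    · exact ⟨Matrix.one_apply, Matrix.one_apply⟩
  have h2 := φ.darboux_coframe k 1 1 h1
  have h3 : ∀ α : Fin 16, MajoranaRep.act M.P (S.Ψ k) (chirP α) = S.Ψ k (chirP α) := by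
    intro α
    have hP : M.P = Matrix.diagonal fun α : Fin 32 => if α.val < 16 then (1 : ℝ) else 0 :=
      M.adapted
    unfold MajoranaRep.act
    rw [hP, Finset.sum_eq_single (chirP α)]
    · rw [Matrix.diagonal_apply_eq, if_pos (by simp [chirP]), one_smul]
    · intro β _ h
      rw [Matrix.diagonal_apply_ne _ h.symm, zero_smul]
    · simp
  simp only [Matrix.one_mulVec] at h2
  have h4 : (fun α : Fin 16 => φ.ψ k (chirP α)) = fun α : Fin 16 => φ.pull _ (S.Ψ k (chirP α)) := by
    funext α
    simp only [ψ, h3]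
    rfl
  rw [h4]
  exact h2

/-- Families, over the worldvolume patches, of 3-tensors. -/
abbrev Tensor3 : Type _ := ∀ k : S.K, (Fin 3 → Fin 6) → Y.form (φ.U k)

/-- `H̃₃` is the self-dual shear component: a skew, self-dual 3-tensor of even superfunctions with
`φ^*(P̄ Ψ) = H̸̃₃ ψ + τ_a e^a`. -/
def IsShearTensor (Ht : φ.Tensor3) : Prop :=
  ∀ k, (∀ v, Ht k v ∈ Y.gr (φ.U k) (0, 0)) ∧ IsSkew (Ht k) ∧ hodgeStar (Ht k) = Ht k ∧
    ∀ α : Fin 32, φ.pull _ (MajoranaRep.act (1 - M.P) (S.Ψ k) α) =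
      (M.slash (Ht k)).mulVec (φ.ψ k) α + ∑ a, φ.τ k a α * φ.e k a

/-- Super 3-flux densities `H₃^s = (1/3!) H_{abc} e^a e^b e^c` on the worldvolume. -/
structure Flux3 where
  form : Y.form ⊤
  comp : φ.Tensor3
  comp_mem : ∀ k v, comp k v ∈ Y.gr (φ.U k) (0, 0)
  comp_skew : ∀ k, IsSkew (comp k)
  form_eq : ∀ k, Y.res (le_top : φ.U k ≤ ⊤) form =
    (6⁻¹ : ℝ) • ∑ v : Fin 3 → Fin 6,
      comp k v * (φ.e k (v 0) * φ.e k (v 1) * φ.e k (v 2))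

end M5SuperImmersion

/-- Super 4-flux densities `G₄^s = (1/4!) G_{abcd} E^a E^b E^c E^d + (1/2) (Ψ̄ Γ_{ab} Ψ) E^a E^b` on the
target. -/
structure Flux4 {M : MajoranaRep} {X : SuperManifold.{u', v'} 11 32}
    (S : SuperSpacetime.{u', v', w} M X) where
  form : X.form ⊤
  comp : ∀ k, (Fin 4 → Fin 11) → X.form (S.V k)
  comp_mem : ∀ k v, comp k v ∈ X.gr (S.V k) (0, 0)
  comp_skew : ∀ k, IsSkew (comp k)
  form_eq : ∀ k, X.res (le_top : S.V k ≤ ⊤) form =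
    (24⁻¹ : ℝ) • ∑ v : Fin 4 → Fin 11,
      comp k v * (S.E k (v 0) * S.E k (v 1) * S.E k (v 2) * S.E k (v 3)) +
    (2⁻¹ : ℝ) • ∑ a, ∑ b,
      M.pair (M.gam ![a, b]) (S.Ψ k) (S.Ψ k) * (S.E k a * S.E k b)

namespace M5SuperImmersion

variable {M : MajoranaRep} {X : SuperManifold.{u', v'} 11 32} {S : SuperSpacetime.{u', v', w} M X}
  {Y : SuperManifold.{u, v} 6 16} (φ : M5SuperImmersion S Y)

/-- The super Bianchi identity `dH₃^s = φ^* G₄^s` on the open subset `W` of the worldvolume. -/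
def Bianchi (H : φ.Flux3) (G : Flux4 S) (W : Opens Y.body) : Prop :=
  Y.res (le_top : W ≤ ⊤) (Y.d ⊤ H.form) =
    Y.res (show W ≤ Opens.comap φ.base ⊤ from fun _ _ => trivial) (φ.pull ⊤ G.form)

/-- The exterior covariant derivative `dH_{abc} - ω^d_a H_{dbc} - ω^d_b H_{adc} - ω^d_c H_{abd}`. -/
def covD (H : φ.Flux3) (k : S.K) (v : Fin 3 → Fin 6) : Y.form (φ.U k) :=
  Y.d _ (H.comp k v) -
    ∑ i : Fin 3, ∑ b, φ.conn k b (v i) * H.comp k (Function.update v i b)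

/-- `∇_a H_v`, the coefficient of `e^a` in the covariant derivative. -/
def nablaEven (H : φ.Flux3) (k : S.K) (a : Fin 6) (v : Fin 3 → Fin 6) : Y.form (φ.U k) :=
  SuperSpace.coframeCoeff (φ.isCoframe k) (φ.covD H k v) ({a}, 0)

/-- `∇_α H_v`, the coefficient of `ψ^α` in the covariant derivative. -/
def nablaOdd (H : φ.Flux3) (k : S.K) (α : Fin 16) (v : Fin 3 → Fin 6) : Y.form (φ.U k) :=
  SuperSpace.coframeCoeff (φ.isCoframe k) (φ.covD H k v) (∅, Pi.single α 1)

/-- The matrix `γ^b` for tangential `b`. -/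
def gammaUp (_φ : M5SuperImmersion S Y) (b : Fin 6) : Matrix (Fin 32) (Fin 32) ℝ :=
  eta b • M.Γ (tang b)

/-- The torsionful bosonic Bianchi identity, on `W`:
`(1/3!) ∇_[a H_{bcd]} + (1/2) H_{[ab|f|} (τ̄_c γ^f τ_{d]}) = (1/4!) (φ^* G₄)_{[abcd]}`. -/
def BosonicBianchi (H : φ.Flux3) (G : Flux4 S) (k : S.K) (W : Opens Y.body) : Prop :=
  ∀ v : Fin 4 → Fin 6,
    Y.res (inf_le_right : W ⊓ φ.U k ≤ φ.U k)
      (skew (fun a : Fin 4 → Fin 6 =>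
        (6⁻¹ : ℝ) • φ.nablaEven H k (a 0) ![a 1, a 2, a 3] +
        (2⁻¹ : ℝ) • ∑ b, H.comp k ![a 0, a 1, b] *
          M.pair (φ.gammaUp b) (φ.τ k (a 2)) (φ.τ k (a 3))) v) =
    Y.res (inf_le_right : W ⊓ φ.U k ≤ φ.U k)
      (skew (fun a : Fin 4 → Fin 6 => (24⁻¹ : ℝ) • φ.pull _ (G.comp k (tang ∘ a))) v)

/-- The rheonomy equation, on `W`:
`(1/3!) ψ^α ∇_α H_{abc} = H_{[ab|f|} (τ̄_{c]} γ^f (1 + H̸̃₃) ψ) + (τ̄_{[a} γ_{bc]} (ψ + H̸̃₃ ψ))`. -/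
def Rheonomy (H : φ.Flux3) (Ht : φ.Tensor3) (k : S.K) (W : Opens Y.body) : Prop :=
  ∀ v : Fin 3 → Fin 6,
    Y.res (inf_le_right : W ⊓ φ.U k ≤ φ.U k)
      ((6⁻¹ : ℝ) • ∑ α : Fin 16, φ.ψ k (chirP α) * φ.nablaOdd H k α v) =
    Y.res (inf_le_right : W ⊓ φ.U k ≤ φ.U k)
      (skew (fun a : Fin 3 → Fin 6 => ∑ b, H.comp k ![a 0, a 1, b] *
          M.pair (φ.gammaUp b) (φ.τ k (a 2)) ((1 + M.slash (Ht k)).mulVec (φ.ψ k))) v +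
       skew (fun a : Fin 3 → Fin 6 =>
          M.pair (M.gam ![tang (a 1), tang (a 2)]) (φ.τ k (a 0))
            ((1 + M.slash (Ht k)).mulVec (φ.ψ k))) v)

/-- The superfunction `1 - (2/3) tr(H̃² H̃²)`. -/
def denominator (Ht : φ.Tensor3) (k : S.K) : Y.form (φ.U k) :=
  1 - (2 / 3 : ℝ) • (square (Ht k) * square (Ht k)).trace

/-- `tr(H̃² H̃²) ≠ 3/2` everywhere on `W`: a superfunction is invertible precisely if its ordinary
value is nonzero at each point. -/
def NonCritical (Ht : φ.Tensor3) (k : S.K) (W : Opens Y.body) : Prop :=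
  IsUnit (Y.res (inf_le_right : W ⊓ φ.U k ≤ φ.U k) (φ.denominator Ht k))

/-- The formula `H_{abc} = -4 / (1 - (2/3) tr(H̃² H̃²)) (δ_a^{a'} + 2 (H̃²)_a^{a'}) H̃_{a'bc}`
on `W`. -/
def FluxFormula (H : φ.Flux3) (Ht : φ.Tensor3) (k : S.K) (W : Opens Y.body) : Prop :=
  ∀ a b c : Fin 6,
    Y.res (inf_le_right : W ⊓ φ.U k ≤ φ.U k) (H.comp k ![a, b, c]) =
    (-4 : ℝ) • (Ring.inverse (Y.res (inf_le_right : W ⊓ φ.U k ≤ φ.U k) (φ.denominator Ht k)) *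
      Y.res (inf_le_right : W ⊓ φ.U k ≤ φ.U k)
        (∑ a', (1 + (2 : ℝ) • square (Ht k)) a a' * Ht k ![a', b, c]))

end M5SuperImmersion

end

noncomputable section

/-! ## Skew-symmetrization -/

/-! The shape of the super-shear map is forced by its independence of the transversal gauge, and
constant gauge transformations already suffice to see this. The element `-1` of Spin(5) acts
trivially on vectors and by a sign on spinors, so the two components that mix vectors and spinors
vanish; in particular `τ = 0`. The element `Γ_i Γ_j` reverses the transversal directions `i` and
`j`, so the vector-vector component vanishes too and `φ^* E^i = 0` for transversal `i`, while the
spinor-spinor component commutes with every `Γ_i Γ_j`.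

Ordered products of ten of the eleven generators form a basis of the real 32 × 32 matrices. A matrix
from `P(32)` to its complement that commutes with all `Γ_i Γ_j` therefore involves only odd products
of tangential generators. The tangential volume element is `1` on `P(32)`, so these products reduce
to a vector plus a self-dual 3-form (`MajoranaRep.mem_chiralSpan`). The transversal torsion
constraint pulls back to `Ω^i_a e^a = (Ψ̄ Γ^i Ψ)`; its `ψψ` part is twice the vector times `Γ_i`, so
the vector is zero (`exists_shear_eq`). Anticommutators with `γ_a γ_b` recover the 3-form `T` from
its Clifford element, which gives uniqueness (`eq_zero_of_cliffSlash`).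

The difference of the two sides of the Bianchi identity splits by the number of factors `e`: four,
three or two. The first two parts are (i) and (ii). For the third, sheared bilinears are computed on
the image of `P`: `γ_c` becomes `(δ - 2T²)_c^d γ_d` (`shearForm_gen`) and `γ_a γ_b` with `a ≠ b`
becomes `-4 T_{abd} γ^d` (`shearForm_pair`). The `γ_d P` being independent, the third part reads `(1
- 2T²) H = -4 T`.

For self-dual `T` the matrix `T² T²` is scalar, so `(1 + 2T²)(1 - 2T²) = λ` with `λ = 1 - (2/3)
tr(T² T²)`, and the equation implies `λ H = -4 (1 + 2T²) T`. Contraction with `T` and `tr T² = 0`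
give `λ w = -8 tr(T² T²)` for a superfunction `w`, hence `λ (12 - w) = 12`: a solution can exist
only if `λ` is invertible, and then the formula is equivalent to the equation (`flux_iff`). Both
sides are local, so patches suffice. -/

theorem List.prod_ofFn_swap {A : Type*} [Ring A] {n : ℕ} (x : Fin (n + 1) → A)
    (hx : ∀ i j, i ≠ j → x i * x j = -(x j * x i)) (i : Fin n) :
    (List.ofFn (x ∘ Equiv.swap i.castSucc i.succ)).prod = -(List.ofFn x).prod := by
  induction n with
  | zero => exact i.elim0
  | succ n ih =>
    induction i using Fin.cases with
    | zero =>
      rw [List.ofFn_succ, List.ofFn_succ, List.ofFn_succ (f := x), List.ofFn_succ]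
      have h1 : (fun i : Fin n => (x ∘ Equiv.swap (0 : Fin (n + 1)).castSucc (0 : Fin (n + 1)).succ)
          i.succ.succ) = fun i : Fin n => x i.succ.succ := by
        funext k
        simp only [Function.comp_apply]
        rw [Equiv.swap_apply_of_ne_of_ne]
        · simp
        · simp [Fin.ext_iff]
      rw [h1]
      simp only [List.prod_cons, Function.comp_apply, Fin.castSucc_zero, Equiv.swap_apply_left,
        Equiv.swap_apply_right, ← mul_assoc]
      rw [hx _ _ (by simp), neg_mul]
    | succ j =>
      rw [List.ofFn_succ, List.ofFn_succ (f := x), List.prod_cons, List.prod_cons]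
      have h1 : (fun k : Fin (n + 1) => (x ∘ Equiv.swap j.succ.castSucc j.succ.succ) k.succ) =
          (fun k => x k.succ) ∘ Equiv.swap j.castSucc j.succ := by
        funext k
        simp only [Function.comp_apply]
        congr 1
        rw [← Fin.succ_castSucc]
        exact ((Fin.succ_injective _).swap_apply _ _ _)
      have h2 : (x ∘ Equiv.swap j.succ.castSucc j.succ.succ) 0 = x 0 := by
        simp only [Function.comp_apply]
        rw [Equiv.swap_apply_of_ne_of_ne]
        · simp [Fin.ext_iff]
        · simp [Fin.ext_iff]
      rw [h1, h2, ih (fun k => x k.succ) (fun a b hab => hx _ _ (by simpa using hab)), mul_neg]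

/-- Adjacent transpositions generate the symmetric group as a monoid, which reduces the claim to
`List.prod_ofFn_swap`. -/
theorem List.prod_ofFn_perm {A : Type*} [Ring A] {n : ℕ} (x : Fin n → A)
    (hx : ∀ i j, i ≠ j → x i * x j = -(x j * x i)) (σ : Equiv.Perm (Fin n)) :
    (List.ofFn (x ∘ σ)).prod = (Equiv.Perm.sign σ : ℤ) • (List.ofFn x).prod := by
  cases n with
  | zero => simp [Subsingleton.elim σ 1]
  | succ n =>
    have hσ : σ ∈ Submonoid.closure
        (Set.range fun i : Fin n => Equiv.swap i.castSucc i.succ) := by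
      rw [Equiv.Perm.mclosure_swap_castSucc_succ]; trivial
    induction hσ using Submonoid.closure_induction_right generalizing x with
    | one => simp
    | mul_right σ _ τ hτ ih =>
      obtain ⟨i, rfl⟩ := hτ
      have h1 : x ∘ ⇑(σ * Equiv.swap i.castSucc i.succ) = (x ∘ σ) ∘ Equiv.swap i.castSucc i.succ :=
        rfl
      simp only [h1]
      rw [List.prod_ofFn_swap (x ∘ σ) (fun a b hab => hx _ _ (σ.injective.ne hab)), ih x hx,
        Equiv.Perm.sign_mul, Equiv.Perm.sign_swap (by simp [Fin.ext_iff])]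
      simp

section Skew

variable {n : ℕ} {ι A : Type*} [AddCommGroup A] [Module ℝ A]

theorem isSkew_skew (T : (Fin n → ι) → A) : IsSkew (skew T) := by
  intro v σ
  unfold skew
  rw [smul_comm]
  congr 1
  rw [Finset.smul_sum]
  refine Fintype.sum_equiv (Equiv.mulLeft σ) _ _ fun τ => ?_
  rw [Equiv.coe_mulLeft, Equiv.Perm.sign_mul, smul_smul]
  push_cast
  rw [← mul_assoc, Int.units_coe_mul_self, one_mul]
  rfl

theorem IsSkew.skew_eq {T : (Fin n → ι) → A} (hT : IsSkew T) : skew T = T := by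
  funext v
  unfold skew
  have : ∀ σ : Equiv.Perm (Fin n), (Equiv.Perm.sign σ : ℤ) • T (v ∘ σ) = T v := fun σ => by
    rw [hT, smul_smul, Int.units_coe_mul_self, one_smul]
  rw [Finset.sum_congr rfl fun σ _ => this σ, Finset.sum_const, Finset.card_univ,
    Fintype.card_perm, Fintype.card_fin, ← Nat.cast_smul_eq_nsmul ℝ, smul_smul,
    inv_mul_cancel₀ (by exact_mod_cast n.factorial_ne_zero), one_smul]

theorem IsSkew.eq_zero {T : (Fin n → ι) → A} (hT : IsSkew T) {v : Fin n → ι}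
    (hv : ¬ Function.Injective v) : T v = 0 := by
  classical
  simp only [Function.Injective, not_forall] at hv
  obtain ⟨i, j, hij, hne⟩ := hv
  have h1 : v ∘ Equiv.swap i j = v := by
    funext k
    simp only [Function.comp_apply]
    rcases eq_or_ne k i with rfl | h
    · simp [hij]
    rcases eq_or_ne k j with rfl | h'
    · simp [hij]
    rw [Equiv.swap_apply_of_ne_of_ne h h']
  have h2 := hT v (Equiv.swap i j)
  rw [h1, Equiv.Perm.sign_swap hne] at h2
  simp only [Units.val_neg, Units.val_one, neg_smul, one_smul] at h2
  have h3 : (2 : ℝ) • T v = 0 := by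
    rw [two_smul]; nth_rewrite 1 [h2]; simp
  exact (smul_eq_zero.1 h3).resolve_left two_ne_zero

theorem skew_sub (T T' : (Fin n → ι) → A) : skew (T - T') = skew T - skew T' := by
  funext v; simp [skew, Finset.sum_sub_distrib, smul_sub]

theorem map_skew {B : Type*} [AddCommGroup B] [Module ℝ B] (f : A →ₗ[ℝ] B) (T : (Fin n → ι) → A)
    (v : Fin n → ι) : f (skew T v) = skew (fun w => f (T w)) v := by
  simp [skew, map_sum]

/-- The functions with the same image as an injective one are its reorderings. -/
theorem sum_filter_image_eq [DecidableEq ι] [Fintype ι] {M : Type*} [AddCommMonoid M]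
    (f : (Fin n → ι) → M) {u : Fin n → ι} (hu : Function.Injective u) :
    ∑ w with Finset.univ.image w = Finset.univ.image u, f w =
      ∑ σ : Equiv.Perm (Fin n), f (u ∘ σ) := by
  symm
  refine Finset.sum_bij (fun σ _ => u ∘ σ) ?_ ?_ ?_ ?_
  · intro σ _
    simp only [Finset.mem_filter, Finset.mem_univ, true_and]
    ext a
    simp only [Finset.mem_image, Finset.mem_univ, true_and, Function.comp_apply]
    exact ⟨fun ⟨x, hx⟩ => ⟨σ x, hx⟩, fun ⟨x, hx⟩ => ⟨σ.symm x, by simpa using hx⟩⟩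
  · intro σ _ τ _ h
    ext x
    exact congrArg _ (hu (congrFun h x))
  · intro w hw
    simp only [Finset.mem_filter, Finset.mem_univ, true_and] at hw
    have hex : ∀ x, ∃ y, u y = w x := fun x => by
      have : w x ∈ Finset.univ.image u := hw ▸ Finset.mem_image_of_mem w (Finset.mem_univ x)
      simpa using this
    choose τ hτ using hex
    have hsurj : Function.Surjective τ := fun y => by
      have : u y ∈ Finset.univ.image w := hw.symm ▸ Finset.mem_image_of_mem u (Finset.mem_univ y)
      obtain ⟨x, -, hx⟩ := Finset.mem_image.1 this
      exact ⟨x, hu (by rw [hτ, hx])⟩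
    exact ⟨Equiv.ofBijective τ (Finite.surjective_iff_bijective.1 hsurj), Finset.mem_univ _,
      funext hτ⟩
  · intros; rfl

end Skew

/-! ## The totally skew symbol and Hodge duality -/

theorem levi_comp_perm (u : Fin 6 → Fin 6) (ρ : Equiv.Perm (Fin 6)) :
    levi (u ∘ ρ) = ((Equiv.Perm.sign ρ : ℤ) : ℝ) * levi u :=
  Matrix.det_permute ρ (Matrix.of fun i j => if u i = j then (1 : ℝ) else 0)

theorem levi_perm (π : Equiv.Perm (Fin 6)) : levi π = ((Equiv.Perm.sign π : ℤ) : ℝ) := by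
  have h := levi_comp_perm id π
  have h1 : levi id = 1 := by
    unfold levi
    convert Matrix.det_one (n := Fin 6) (R := ℝ)
    ext i j
    simp [Matrix.one_apply]
  rw [h1, mul_one] at h
  exact h

theorem levi_eq_zero {u : Fin 6 → Fin 6} (hu : ¬ Function.Injective u) : levi u = 0 := by
  simp only [Function.Injective, not_forall] at hu
  obtain ⟨i, j, hij, hne⟩ := hu
  exact Matrix.det_zero_of_row_eq hne (by funext k; simp [hij])

/-- The first three values of a permutation. -/
def fst3 (π : Equiv.Perm (Fin 6)) : Fin 3 → Fin 6 := fun i => π (Fin.castAdd 3 i)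

/-- The last three values of a permutation. -/
def snd3 (π : Equiv.Perm (Fin 6)) : Fin 3 → Fin 6 := fun i => π (Fin.natAdd 3 i)

theorem append_fst3_snd3 (π : Equiv.Perm (Fin 6)) : Fin.append (fst3 π) (snd3 π) = π :=
  Fin.append_castAdd_natAdd (f := fun i : Fin (3 + 3) => π i)

theorem fst3_injective (π : Equiv.Perm (Fin 6)) : Function.Injective (fst3 π) := fun _ _ h =>
  Fin.castAdd_injective 3 3 (π.injective h)

theorem snd3_injective (π : Equiv.Perm (Fin 6)) : Function.Injective (snd3 π) := fun _ _ h =>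
  Fin.natAdd_injective 3 3 (π.injective h)

/-- The permutation exchanging the first and the last three elements. -/
def blockSwap : Equiv.Perm (Fin 6) := finRotate 6 ^ 3

theorem fst3_mul_blockSwap (π : Equiv.Perm (Fin 6)) : fst3 (π * blockSwap) = snd3 π := by
  funext i
  unfold fst3 snd3
  rw [Equiv.Perm.mul_apply]
  congr 1
  revert i; decide

theorem snd3_mul_blockSwap (π : Equiv.Perm (Fin 6)) : snd3 (π * blockSwap) = fst3 π := by
  funext i
  unfold fst3 snd3
  rw [Equiv.Perm.mul_apply]
  congr 1
  revert i; decide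

theorem sign_blockSwap : Equiv.Perm.sign blockSwap = -1 := by
  rw [blockSwap, map_pow, sign_finRotate]; rfl

/-- An injective triple is a partial bijection of the six indices and extends to a permutation.
Statements about complementary triples of indices thus become statements about permutations. -/
theorem exists_fst3_eq {v : Fin 3 → Fin 6} (hv : Function.Injective v) :
    ∃ π : Equiv.Perm (Fin 6), fst3 π = v := by
  classical
  have hc : Function.Injective (Fin.castAdd 3 : Fin 3 → Fin 6) := Fin.castAdd_injective 3 3
  let e : {x // x ∈ Set.range (Fin.castAdd 3 : Fin 3 → Fin 6)} ≃ {x // x ∈ Set.range v} :=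
    (Equiv.ofInjective _ hc).symm.trans (Equiv.ofInjective v hv)
  refine ⟨e.extendSubtype, funext fun i => ?_⟩
  unfold fst3
  rw [Equiv.extendSubtype_apply_of_mem e _ ⟨i, rfl⟩]
  have : (Equiv.ofInjective _ hc).symm ⟨Fin.castAdd 3 i, ⟨i, rfl⟩⟩ = i :=
    Equiv.ofInjective_symm_apply hc i
  simp only [e, Equiv.trans_apply]
  erw [this]
  rfl

theorem exists_snd3_eq {v : Fin 3 → Fin 6} (hv : Function.Injective v) :
    ∃ π : Equiv.Perm (Fin 6), snd3 π = v := by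
  obtain ⟨π, hπ⟩ := exists_fst3_eq hv
  exact ⟨π * blockSwap, by rw [snd3_mul_blockSwap, hπ]⟩

/-- Exchanging two blocks of three is an odd permutation, having nine inversions. -/
theorem levi_append_swap (v w : Fin 3 → Fin 6) : levi (Fin.append v w) = -levi (Fin.append w v) := by
  have h : Fin.append v w = Fin.append w v ∘ blockSwap := by
    funext i
    fin_cases i <;> rfl
  rw [h, levi_comp_perm, sign_blockSwap]
  simp

theorem levi_append_comp (v w : Fin 3 → Fin 6) (σ : Equiv.Perm (Fin 3)) :
    levi (Fin.append v (w ∘ σ)) = ((Equiv.Perm.sign σ : ℤ) : ℝ) * levi (Fin.append v w) := by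
  have h : Fin.append v (w ∘ σ) =
      Fin.append v w ∘ (finSumFinEquiv.permCongr (Equiv.Perm.sumCongr 1 σ) : Equiv.Perm (Fin 6)) := by
    funext i
    induction i using Fin.addCases (m := 3) (n := 3) with
    | left i =>
      rw [Fin.append_left, Function.comp_apply (f := Fin.append v w), Equiv.permCongr_apply,
        finSumFinEquiv_symm_apply_castAdd]
      exact (Fin.append_left v w i).symm
    | right i =>
      rw [Fin.append_right, Function.comp_apply, Function.comp_apply (f := Fin.append v w), Equiv.permCongr_apply,
        finSumFinEquiv_symm_apply_natAdd]
      exact (Fin.append_right v w (σ i)).symm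
  rw [h, levi_comp_perm, Equiv.Perm.sign_permCongr, Equiv.Perm.sign_sumCongr]
  simp

/-- Only the `3!` orderings of the complementary triple contribute, and they contribute equally
because `F` and the symbol change by the same sign. -/
theorem sum_levi_smul {A : Type*} [AddCommGroup A] [Module ℝ A] {F : (Fin 3 → Fin 6) → A}
    (hF : IsSkew F) (π : Equiv.Perm (Fin 6)) :
    ∑ w, levi (Fin.append (fst3 π) w) • F w =
      (6 * ((Equiv.Perm.sign π : ℤ) : ℝ)) • F (snd3 π) := by
  rw [← Finset.sum_filter_add_sum_filter_not Finset.univ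
    (fun w => Finset.univ.image w = Finset.univ.image (snd3 π))]
  rw [sum_filter_image_eq _ (snd3_injective π), Finset.sum_eq_zero (s := Finset.univ.filter _),
    add_zero]
  · have : ∀ σ : Equiv.Perm (Fin 3), levi (Fin.append (fst3 π) (snd3 π ∘ σ)) • F (snd3 π ∘ σ) =
        ((Equiv.Perm.sign π : ℤ) : ℝ) • F (snd3 π) := fun σ => by
      rw [levi_append_comp, hF, append_fst3_snd3, levi_perm, ← Int.cast_smul_eq_zsmul ℝ, smul_smul]
      congr 1
      rw [mul_right_comm, ← Int.cast_mul, Int.units_coe_mul_self]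
      simp
    rw [Finset.sum_congr rfl fun σ _ => this σ, Finset.sum_const, Finset.card_univ,
      Fintype.card_perm, Fintype.card_fin, ← Nat.cast_smul_eq_nsmul ℝ, smul_smul]
    rfl
  · intro w hw
    rw [levi_eq_zero, zero_smul]
    intro hinj
    apply (Finset.mem_filter.1 hw).2
    -- A nonzero symbol forces `w` to be injective and to avoid `fst3 π`, so that `w` enumerates the
    -- complement.
    have hdisj : ∀ i j, fst3 π i ≠ w j := fun i j h => by
      have := @hinj (Fin.castAdd 3 i) (Fin.natAdd 3 j) (by
        rw [Fin.append_left, Fin.append_right, h])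
      simp [Fin.ext_iff] at this
      omega
    have hw' : Function.Injective w := fun i j h => by
      have := @hinj (Fin.natAdd 3 i) (Fin.natAdd 3 j) (by rw [Fin.append_right, Fin.append_right, h])
      exact Fin.natAdd_injective 3 3 this
    refine Finset.eq_of_subset_of_card_le ?_ ?_
    · intro a ha
      obtain ⟨j, -, rfl⟩ := Finset.mem_image.1 ha
      obtain ⟨x, hx⟩ := π.surjective (w j)
      induction x using Fin.addCases (m := 3) (n := 3) with
      | left i => exact absurd hx (hdisj i j)
      | right i => exact Finset.mem_image.2 ⟨i, Finset.mem_univ _, hx⟩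
    · rw [Finset.card_image_of_injective _ hw', Finset.card_image_of_injective _ (snd3_injective π)]

theorem eta_mul_self {n : ℕ} (a : Fin n) : eta a * eta a = 1 := by
  unfold eta; split <;> norm_num

theorem eta_ne_zero {n : ℕ} (a : Fin n) : eta a ≠ 0 := by
  unfold eta; split <;> norm_num

/-- The product of the metric coefficients of three indices. -/
def eta3 (v : Fin 3 → Fin 6) : ℝ := ∏ i, eta (v i)

theorem eta3_mul_self (v : Fin 3 → Fin 6) : eta3 v * eta3 v = 1 := by
  unfold eta3
  rw [← Finset.prod_mul_distrib]
  exact Finset.prod_eq_one fun i _ => eta_mul_self _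

/-- Exactly one of the six directions is timelike. -/
theorem eta3_fst3_mul (π : Equiv.Perm (Fin 6)) : eta3 (fst3 π) * eta3 (snd3 π) = -1 := by
  have h : ∏ i, eta (π i) = -1 := by
    rw [Equiv.prod_comp π (fun i => eta i)]
    simp [eta]
  rw [← h]
  exact (Fin.prod_univ_add (a := 3) (b := 3) fun i => eta (π i)).symm

theorem eta3_comp (v : Fin 3 → Fin 6) (σ : Equiv.Perm (Fin 3)) : eta3 (v ∘ σ) = eta3 v :=
  Equiv.prod_comp σ fun i => eta (v i)

section Hodge

variable {A : Type*} [AddCommGroup A] [Module ℝ A] {T : (Fin 3 → Fin 6) → A}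

theorem hodgeStar_fst3 (hT : IsSkew T) (π : Equiv.Perm (Fin 6)) :
    hodgeStar T (fst3 π) = (eta3 (fst3 π) * ((Equiv.Perm.sign π : ℤ) : ℝ)) • T (snd3 π) := by
  unfold hodgeStar
  have : ∀ w, ((∏ i, eta (fst3 π i)) * levi (Fin.append (fst3 π) w)) • T w =
      eta3 (fst3 π) • (levi (Fin.append (fst3 π) w) • T w) := fun w => by rw [smul_smul]; rfl
  rw [Finset.sum_congr rfl fun w _ => this w, ← Finset.smul_sum, sum_levi_smul hT, smul_smul,
    smul_smul]
  congr 1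
  ring

theorem isSkew_hodgeStar (T : (Fin 3 → Fin 6) → A) : IsSkew (hodgeStar T) := by
  intro v σ
  unfold hodgeStar
  rw [smul_comm]
  congr 1
  rw [Finset.smul_sum]
  refine Finset.sum_congr rfl fun w _ => ?_
  rw [← Int.cast_smul_eq_zsmul ℝ, smul_smul, levi_append_swap (v ∘ σ), levi_append_comp,
    levi_append_swap v]
  have : (∏ i, eta ((v ∘ σ) i)) = ∏ i, eta (v i) := eta3_comp v σ
  rw [this]
  congr 1
  ring

/-- Two signs cancel: the exchange of the blocks is odd, and there is one timelike direction. This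
is why real self-dual 3-forms exist in Lorentzian signature. -/
theorem hodgeStar_hodgeStar (hT : IsSkew T) : hodgeStar (hodgeStar T) = T := by
  funext v
  by_cases hv : Function.Injective v
  · obtain ⟨π, rfl⟩ := exists_fst3_eq hv
    rw [hodgeStar_fst3 (isSkew_hodgeStar _), ← fst3_mul_blockSwap, hodgeStar_fst3 hT,
      snd3_mul_blockSwap, fst3_mul_blockSwap, smul_smul, Equiv.Perm.sign_mul, sign_blockSwap]
    have h1 := eta3_fst3_mul π
    have h2 : ((Equiv.Perm.sign π : ℤ) : ℝ) * ((Equiv.Perm.sign π : ℤ) : ℝ) = 1 := by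
      rw [← Int.cast_mul, Int.units_coe_mul_self]; simp
    have h3 : eta3 (fst3 π) * ((Equiv.Perm.sign π : ℤ) : ℝ) *
        (eta3 (snd3 π) * (((Equiv.Perm.sign π * -1 : ℤˣ) : ℤ) : ℝ)) = 1 := by
      push_cast
      linear_combination (-((Equiv.Perm.sign π : ℤ) : ℝ) * ((Equiv.Perm.sign π : ℤ) : ℝ)) * h1 + h2
    rw [h3, one_smul]
  · rw [(isSkew_hodgeStar _).eq_zero hv, hT.eq_zero hv]

theorem map_hodgeStar {B : Type*} [AddCommGroup B] [Module ℝ B] (f : A →ₗ[ℝ] B)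
    (T : (Fin 3 → Fin 6) → A) (v : Fin 3 → Fin 6) :
    f (hodgeStar T v) = hodgeStar (fun w => f (T w)) v := by
  simp [hodgeStar, map_sum]

end Hodge

end

noncomputable section

/-! ## Self-dual 3-forms in the Clifford algebra of `ℝ^{1,5}` -/

theorem sum_fin_three_arrow {ι M : Type*} [Fintype ι] [AddCommMonoid M] (f : (Fin 3 → ι) → M) :
    ∑ v, f v = ∑ a, ∑ b, ∑ c, f ![a, b, c] := by
  let e : (Fin 3 → ι) ≃ ι × ι × ι :=
    { toFun := fun v => (v 0, v 1, v 2)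
      invFun := fun x => ![x.1, x.2.1, x.2.2]
      left_inv := fun v => by funext i; fin_cases i <;> rfl
      right_inv := fun _ => rfl }
  rw [← Equiv.sum_comp e.symm, Fintype.sum_prod_type]
  exact Finset.sum_congr rfl fun a _ => Fintype.sum_prod_type _

/-! ### Exchanges of indices in skew 3-tensors -/

section IsSkewThree

variable {ι A : Type*} [AddCommGroup A] {T : (Fin 3 → ι) → A}

theorem IsSkew.swap01 (hT : IsSkew T) (a b c : ι) : T ![b, a, c] = -T ![a, b, c] := by
  have h := hT ![a, b, c] (Equiv.swap 0 1)
  rw [Equiv.Perm.sign_swap (by decide)] at h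
  have h1 : ![a, b, c] ∘ Equiv.swap (0 : Fin 3) 1 = ![b, a, c] := by
    funext i; fin_cases i <;> rfl
  rw [h1] at h
  simpa using h

theorem IsSkew.swap12 (hT : IsSkew T) (a b c : ι) : T ![a, c, b] = -T ![a, b, c] := by
  have h := hT ![a, b, c] (Equiv.swap 1 2)
  rw [Equiv.Perm.sign_swap (by decide)] at h
  have h1 : ![a, b, c] ∘ Equiv.swap (1 : Fin 3) 2 = ![a, c, b] := by
    funext i; fin_cases i <;> rfl
  rw [h1] at h
  simpa using h

theorem IsSkew.rotate (hT : IsSkew T) (a b c : ι) : T ![b, c, a] = T ![a, b, c] := by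
  rw [hT.swap12 b a c, hT.swap01 a b c, neg_neg]

end IsSkewThree

set_option linter.unusedSectionVars false

section Clifford

variable {R 𝔐 : Type*} [CommRing R] [Algebra ℝ R] [Ring 𝔐] [Algebra R 𝔐] [Algebra ℝ 𝔐]
  [IsScalarTower ℝ R 𝔐]

/-- Elements of an algebra obeying the Clifford relations of `ℝ^{1,5}`. -/
def IsClifford (g : Fin 6 → 𝔐) : Prop :=
  ∀ a b, g a * g b + g b * g a = (if a = b then 2 * eta a else 0 : ℝ) • (1 : 𝔐)

/-- The product of three members of a family. -/
def triple (g : Fin 6 → 𝔐) (v : Fin 3 → Fin 6) : 𝔐 := g (v 0) * g (v 1) * g (v 2)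

/-- Contraction of a 3-tensor with skew-symmetrized Clifford products. -/
def cliffSlash (g : Fin 6 → 𝔐) (T : (Fin 3 → Fin 6) → R) : 𝔐 :=
  (6⁻¹ : ℝ) • ∑ v, (eta3 v • T v) • skew (triple g) v

/-- Contraction of two indices of a 3-tensor with Clifford products. -/
def cliffContract (g : Fin 6 → 𝔐) (T : (Fin 3 → Fin 6) → R) (d : Fin 6) : 𝔐 :=
  ∑ b, ∑ c, ((eta b * eta c) • T ![d, b, c]) • (g b * g c)

variable {g : Fin 6 → 𝔐} {T : (Fin 3 → Fin 6) → R}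

theorem triple_eq_prod (g : Fin 6 → 𝔐) (v : Fin 3 → Fin 6) :
    triple g v = (List.ofFn fun i => g (v i)).prod := by
  simp [triple, List.ofFn_succ, mul_assoc]

theorem IsClifford.anticomm (hg : IsClifford g) {a b : Fin 6} (h : a ≠ b) :
    g a * g b = -(g b * g a) := by
  have := hg a b
  rw [if_neg h, zero_smul] at this
  exact eq_neg_of_add_eq_zero_left this

theorem IsClifford.sq (hg : IsClifford g) (a : Fin 6) : g a * g a = eta a • (1 : 𝔐) := by
  have := hg a a
  rw [if_pos rfl, ← two_smul ℝ, mul_smul] at this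
  exact smul_right_injective 𝔐 (two_ne_zero (α := ℝ)) this

theorem IsClifford.skew_triple (hg : IsClifford g) {v : Fin 3 → Fin 6}
    (hv : Function.Injective v) : skew (triple g) v = triple g v := by
  unfold skew
  have h : ∀ σ : Equiv.Perm (Fin 3),
      (Equiv.Perm.sign σ : ℤ) • triple g (v ∘ σ) = triple g v := fun σ => by
    rw [triple_eq_prod, triple_eq_prod]
    have := List.prod_ofFn_perm (fun i => g (v i)) (fun i j hij => hg.anticomm (hv.ne hij)) σ
    simp only [Function.comp_def] at this ⊢
    rw [this, smul_smul, Int.units_coe_mul_self, one_smul]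
  rw [Finset.sum_congr rfl fun σ _ => h σ, Finset.sum_const, Finset.card_univ,
    Fintype.card_perm, Fintype.card_fin, ← Nat.cast_smul_eq_nsmul ℝ, smul_smul,
    inv_mul_cancel₀ (by exact_mod_cast (3).factorial_ne_zero), one_smul]

/-- Up to the sign of `π`, the volume element is the product of the two complementary triples. These
anticommute, by nine sign changes, and a triple of distinct generators squares to minus its metric
coefficients. -/
theorem IsClifford.triple_mul_volume (hg : IsClifford g) (π : Equiv.Perm (Fin 6)) :
    triple g (snd3 π) * (List.ofFn g).prod =
      (((Equiv.Perm.sign π : ℤ) : ℝ) * eta3 (snd3 π)) • triple g (fst3 π) := by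
  have h1 := List.prod_ofFn_perm g (fun i j hij => hg.anticomm hij) π
  have h2 : (List.ofFn (g ∘ π)).prod = triple g (fst3 π) * triple g (snd3 π) := by
    simp only [triple, List.ofFn_succ, List.ofFn_zero, List.prod_cons, List.prod_nil, mul_one,
      mul_assoc, Function.comp_apply]
    rfl
  have h3 : (List.ofFn g).prod =
      ((Equiv.Perm.sign π : ℤ) : ℝ) • (triple g (fst3 π) * triple g (snd3 π)) := by
    rw [← h2, h1, ← Int.cast_smul_eq_zsmul ℝ, smul_smul, ← Int.cast_mul, Int.units_coe_mul_self]
    simp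
  have hne : ∀ i j, g (snd3 π i) * g (fst3 π j) = -(g (fst3 π j) * g (snd3 π i)) := fun i j => by
    refine hg.anticomm fun h => ?_
    have := π.injective h
    simp [Fin.ext_iff] at this
    omega
  have hz : ∀ j, triple g (snd3 π) * g (fst3 π j) = -(g (fst3 π j) * triple g (snd3 π)) :=
    fun j => by
      unfold triple
      rw [mul_assoc, hne 2 j, mul_neg, ← mul_assoc, mul_assoc (g (snd3 π 0)), hne 1 j, mul_neg,
        ← mul_assoc, hne 0 j]
      simp only [neg_mul, neg_neg, mul_assoc]
  have hz3 : triple g (snd3 π) * triple g (fst3 π) = -(triple g (fst3 π) * triple g (snd3 π)) := by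
    conv_lhs => rw [triple.eq_def g (fst3 π)]
    rw [← mul_assoc, ← mul_assoc, hz, neg_mul, neg_mul, mul_assoc (g (fst3 π 0)), hz, mul_neg,
      neg_mul, mul_assoc, mul_assoc (g (fst3 π 1)), hz]
    simp only [triple, mul_neg, neg_neg, mul_assoc]
  have hsq : triple g (snd3 π) * triple g (snd3 π) = (-eta3 (snd3 π)) • 1 := by
    have hi := snd3_injective π
    have a10 := hg.anticomm (hi.ne (show (1 : Fin 3) ≠ 0 by decide))
    have a20 := hg.anticomm (hi.ne (show (2 : Fin 3) ≠ 0 by decide))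
    have a21 := hg.anticomm (hi.ne (show (2 : Fin 3) ≠ 1 by decide))
    have s0 := hg.sq (snd3 π 0)
    have s1 := hg.sq (snd3 π 1)
    have s2 := hg.sq (snd3 π 2)
    unfold triple eta3
    generalize g (snd3 π 0) = x at *
    generalize g (snd3 π 1) = y at *
    generalize g (snd3 π 2) = z at *
    calc x * y * z * (x * y * z) = x * y * (z * x) * y * z := by noncomm_ring
      _ = -(x * (y * x) * (z * y) * z) := by rw [a20]; noncomm_ring
      _ = -((x * x) * (y * y) * (z * z)) := by rw [a10, a21]; noncomm_ring
      _ = _ := by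
        rw [s0, s1, s2, Fin.prod_univ_three]
        simp only [smul_mul_assoc, mul_smul_comm, one_mul, smul_smul, neg_smul]
        rw [mul_comm (eta (snd3 π 2)), mul_comm (eta (snd3 π 1))]
  rw [h3, mul_smul_comm, ← mul_assoc, hz3, neg_mul, mul_assoc, hsq, mul_smul_comm, mul_one,
    neg_smul, neg_neg, smul_smul]

/-- Duality of 3-forms becomes multiplication by the volume element, so that self-duality can be
compared with chirality. -/
theorem IsClifford.cliffSlash_hodgeStar (hg : IsClifford g) (T : (Fin 3 → Fin 6) → R) :
    cliffSlash g (hodgeStar T) = cliffSlash g T * (List.ofFn g).prod := by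
  unfold cliffSlash
  rw [smul_mul_assoc, Finset.sum_mul]
  congr 1
  have h1 : ∀ v, (eta3 v • hodgeStar T v) • skew (triple g) v =
      ∑ w, T w • ((6⁻¹ * levi (Fin.append v w)) • skew (triple g) v) := fun v => by
    unfold hodgeStar
    rw [Finset.smul_sum, Finset.smul_sum, Finset.sum_smul]
    refine Finset.sum_congr rfl fun w _ => ?_
    rw [smul_smul, smul_smul, smul_assoc, smul_comm]
    congr 2
    have := eta3_mul_self v
    unfold eta3 at this ⊢
    linear_combination (6⁻¹ * levi (Fin.append v w)) * this
  rw [Finset.sum_congr rfl fun v _ => h1 v, Finset.sum_comm]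
  refine Finset.sum_congr rfl fun w _ => ?_
  rw [← Finset.smul_sum, smul_assoc, smul_comm (eta3 w), smul_mul_assoc]
  congr 1
  by_cases hw : Function.Injective w
  · obtain ⟨π, rfl⟩ := exists_snd3_eq hw
    -- Here the summation runs over the first block of the symbol; `blockSwap` and a sign bring it
    -- to the form of `sum_levi_smul`.
    have h2 := sum_levi_smul (isSkew_skew (triple g)) (π * blockSwap)
    rw [fst3_mul_blockSwap, snd3_mul_blockSwap, Equiv.Perm.sign_mul, sign_blockSwap] at h2
    have h3 : ∀ v, (6⁻¹ * levi (Fin.append v (snd3 π))) • skew (triple g) v =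
        (-6⁻¹ : ℝ) • (levi (Fin.append (snd3 π) v) • skew (triple g) v) := fun v => by
      rw [levi_append_swap, smul_smul]
      congr 1
      ring
    rw [Finset.sum_congr rfl fun v _ => h3 v, ← Finset.smul_sum, h2, hg.skew_triple hw,
      hg.skew_triple (fst3_injective π), smul_mul_assoc, hg.triple_mul_volume, smul_smul, smul_smul]
    congr 1
    push_cast
    linear_combination (-((Equiv.Perm.sign π : ℤ) : ℝ)) * eta3_mul_self (snd3 π)
  · rw [(isSkew_skew (triple g)).eq_zero hw, smul_zero, zero_mul]
    refine Finset.sum_eq_zero fun v _ => ?_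
    rw [levi_eq_zero, mul_zero, zero_smul]
    intro h
    refine hw fun i j hij => ?_
    have := @h (Fin.natAdd 3 i) (Fin.natAdd 3 j) (by rw [Fin.append_right, Fin.append_right, hij])
    exact Fin.natAdd_injective 3 3 this

/-- Reindexing the sum moves the skew-symmetrization from the Clifford product onto `T`, where it
has no effect. -/
theorem cliffSlash_eq (g : Fin 6 → 𝔐) (hT : IsSkew T) :
    cliffSlash g T = (6⁻¹ : ℝ) • ∑ v, (eta3 v • T v) • triple g v := by
  unfold cliffSlash
  congr 1
  have h1 : ∀ v, (eta3 v • T v) • skew (triple g) v = ((Nat.factorial 3 : ℝ)⁻¹) •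
      ∑ σ : Equiv.Perm (Fin 3), (eta3 (v ∘ σ) • T (v ∘ σ)) • triple g (v ∘ σ) := fun v => by
    unfold skew
    rw [smul_comm]
    congr 1
    rw [Finset.smul_sum]
    refine Finset.sum_congr rfl fun σ _ => ?_
    rw [hT, eta3_comp, ← Int.cast_smul_eq_zsmul ℝ, ← Int.cast_smul_eq_zsmul ℝ, smul_comm]
    simp only [smul_assoc]
    rw [smul_comm]
  rw [Finset.sum_congr rfl fun v _ => h1 v, ← Finset.smul_sum, Finset.sum_comm]
  have h2 : ∀ σ : Equiv.Perm (Fin 3), ∑ v : Fin 3 → Fin 6,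
      (eta3 (v ∘ σ) • T (v ∘ σ)) • triple g (v ∘ σ) = ∑ v, (eta3 v • T v) • triple g v :=
    fun σ => Fintype.sum_equiv (Equiv.arrowCongr σ.symm (Equiv.refl _)) _ _ fun v => rfl
  rw [Finset.sum_congr rfl fun σ _ => h2 σ, Finset.sum_const, Finset.card_univ,
    Fintype.card_perm, Fintype.card_fin, ← Nat.cast_smul_eq_nsmul ℝ, smul_smul,
    inv_mul_cancel₀ (by exact_mod_cast (3).factorial_ne_zero), one_smul]

theorem cliffSlash_eq_sum (g : Fin 6 → 𝔐) (hT : IsSkew T) :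
    cliffSlash g T = (6⁻¹ : ℝ) • ∑ a, ∑ b, ∑ c,
      ((eta a * eta b * eta c) • T ![a, b, c]) • (g a * g b * g c) := by
  rw [cliffSlash_eq g hT, sum_fin_three_arrow]
  simp [eta3, Fin.prod_univ_three, triple]

theorem IsClifford.triple_anticomm (hg : IsClifford g) (a b c d : Fin 6) :
    g a * g b * g c * g d + g d * (g a * g b * g c) =
      (if c = d then 2 * eta c else 0 : ℝ) • (g a * g b) -
      (if b = d then 2 * eta b else 0 : ℝ) • (g a * g c) +
      (if a = d then 2 * eta a else 0 : ℝ) • (g b * g c) := by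
  have h1 := hg a d
  have h2 := hg b d
  have h3 := hg c d
  generalize (if c = d then 2 * eta c else 0 : ℝ) = r at *
  generalize (if b = d then 2 * eta b else 0 : ℝ) = s at *
  generalize (if a = d then 2 * eta a else 0 : ℝ) = t at *
  calc g a * g b * g c * g d + g d * (g a * g b * g c)
      = g a * g b * (g c * g d + g d * g c) - g a * (g b * g d + g d * g b) * g c +
        (g a * g d + g d * g a) * (g b * g c) := by noncomm_ring
    _ = _ := by rw [h1, h2, h3]; simp

theorem IsClifford.pair_comm (hg : IsClifford g) (b c e : Fin 6) :
    g b * g c * g e - g e * (g b * g c) =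
      (if c = e then 2 * eta c else 0 : ℝ) • g b - (if b = e then 2 * eta b else 0 : ℝ) • g c := by
  have h2 := hg b e
  have h3 := hg c e
  generalize (if c = e then 2 * eta c else 0 : ℝ) = r at *
  generalize (if b = e then 2 * eta b else 0 : ℝ) = s at *
  calc g b * g c * g e - g e * (g b * g c)
      = g b * (g c * g e + g e * g c) - (g b * g e + g e * g b) * g c := by noncomm_ring
    _ = _ := by rw [h2, h3]; simp

theorem ite_two_eta_smul {M : Type*} [AddCommGroup M] [Module R M] [Module ℝ M]
    [IsScalarTower ℝ R M] (p : Prop) [Decidable p] (r s : ℝ) (x : R) (y : M) :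
    (r • x) • ((if p then s else 0 : ℝ) • y) = if p then ((r * s) • x) • y else 0 := by
  split
  · rw [smul_assoc, smul_assoc, smul_comm x s y, smul_smul]
  · simp

/-- The terms with four generators cancel and only contractions remain. By skewness each of the
three slots gives twice the same contraction, which absorbs the factor `1/6`. -/
theorem IsClifford.cliffSlash_anticomm (hg : IsClifford g) (hT : IsSkew T) (d : Fin 6) :
    cliffSlash g T * g d + g d * cliffSlash g T = cliffContract g T d := by
  rw [cliffSlash_eq_sum g hT]
  simp only [smul_mul_assoc, mul_smul_comm, Finset.sum_mul, Finset.mul_sum]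
  rw [← smul_add]
  simp only [← Finset.sum_add_distrib, ← smul_add, hg.triple_anticomm]
  simp only [smul_add, smul_sub, ite_two_eta_smul, Finset.sum_add_distrib, Finset.sum_sub_distrib]
  have h1 : ∑ a, ∑ b, ∑ c, (if c = d then ((eta a * eta b * eta c * (2 * eta c)) • T ![a, b, c]) •
      (g a * g b) else 0) = (2 : ℝ) • cliffContract g T d := by
    simp only [Finset.sum_ite_eq', Finset.mem_univ, if_true, cliffContract, Finset.smul_sum]
    refine Finset.sum_congr rfl fun a _ => Finset.sum_congr rfl fun b _ => ?_
    rw [← hT.rotate d a b, ← smul_assoc, smul_smul]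
    congr 2
    linear_combination (2 * eta a * eta b) * eta_mul_self d
  have h2 : ∑ a, ∑ b, ∑ c, (if b = d then ((eta a * eta b * eta c * (2 * eta b)) • T ![a, b, c]) •
      (g a * g c) else 0) = -((2 : ℝ) • cliffContract g T d) := by
    simp only [cliffContract, Finset.smul_sum, ← Finset.sum_neg_distrib]
    refine Finset.sum_congr rfl fun a _ => ?_
    rw [Finset.sum_comm]
    refine Finset.sum_congr rfl fun b _ => ?_
    simp only [Finset.sum_ite_eq', Finset.mem_univ, if_true]
    rw [hT.swap01 d a b, smul_neg, neg_smul, ← smul_assoc, smul_smul]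
    congr 3
    linear_combination (2 * eta a * eta b) * eta_mul_self d
  have h3 : ∑ a, ∑ b, ∑ c, (if a = d then ((eta a * eta b * eta c * (2 * eta a)) • T ![a, b, c]) •
      (g b * g c) else 0) = (2 : ℝ) • cliffContract g T d := by
    rw [Finset.sum_comm]
    simp only [cliffContract, Finset.smul_sum]
    refine Finset.sum_congr rfl fun a _ => ?_
    rw [Finset.sum_comm]
    refine Finset.sum_congr rfl fun b _ => ?_
    simp only [Finset.sum_ite_eq', Finset.mem_univ, if_true]
    rw [← smul_assoc, smul_smul]
    congr 2
    linear_combination (2 * eta a * eta b) * eta_mul_self d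
  rw [h1, h2, h3]
  module

/-- Each of the two remaining slots can be contracted with `g e`, and by skewness both contribute
`-2`. -/
theorem IsClifford.cliffContract_comm (hg : IsClifford g) (hT : IsSkew T) (d e : Fin 6) :
    cliffContract g T d * g e - g e * cliffContract g T d =
      (-4 : ℝ) • ∑ b, (eta b • T ![d, e, b]) • g b := by
  unfold cliffContract
  simp only [smul_mul_assoc, mul_smul_comm, Finset.sum_mul, Finset.mul_sum]
  simp only [← Finset.sum_sub_distrib, ← smul_sub, hg.pair_comm]
  simp only [smul_sub, ite_two_eta_smul, Finset.sum_sub_distrib]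
  have h1 : ∑ b, ∑ c, (if c = e then ((eta b * eta c * (2 * eta c)) • T ![d, b, c]) • g b else 0) =
      (-2 : ℝ) • ∑ b, (eta b • T ![d, e, b]) • g b := by
    simp only [Finset.sum_ite_eq', Finset.mem_univ, if_true, Finset.smul_sum]
    refine Finset.sum_congr rfl fun b _ => ?_
    rw [hT.swap12 d e b, smul_neg, neg_smul, ← neg_smul, ← smul_assoc, smul_smul, ← neg_smul]
    congr 2
    linear_combination (-2 * eta b) * eta_mul_self e
  have h2 : ∑ b, ∑ c, (if b = e then ((eta b * eta c * (2 * eta b)) • T ![d, b, c]) • g c else 0) =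
      (2 : ℝ) • ∑ b, (eta b • T ![d, e, b]) • g b := by
    rw [Finset.sum_comm]
    simp only [Finset.sum_ite_eq', Finset.mem_univ, if_true, Finset.smul_sum]
    refine Finset.sum_congr rfl fun b _ => ?_
    rw [← smul_assoc, smul_smul]
    congr 2
    linear_combination (2 * eta b) * eta_mul_self e
  rw [h1, h2, ← sub_smul]
  norm_num

/-- A projector exchanged with its complement by the Clifford generators, on whose complement the
volume element is `-1`. -/
structure IsChiral (g : Fin 6 → 𝔐) (p : 𝔐) : Prop where
  clifford : IsClifford g
  exchange : ∀ a, g a * p = (1 - p) * g a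
  volume : (List.ofFn g).prod * p = p
  volume' : (List.ofFn g).prod * (1 - p) = -(1 - p)

variable {p : 𝔐}

theorem IsChiral.exchange' (h : IsChiral g p) (a : Fin 6) : g a * (1 - p) = p * g a := by
  rw [mul_sub, h.exchange]; noncomm_ring

theorem IsChiral.triple_mul (h : IsChiral g p) (v : Fin 3 → Fin 6) :
    triple g v * p = (1 - p) * triple g v := by
  unfold triple
  rw [mul_assoc, h.exchange, ← mul_assoc, mul_assoc (g (v 0)), h.exchange', ← mul_assoc,
    h.exchange]
  simp only [mul_assoc]

theorem IsChiral.cliffSlash_mul (h : IsChiral g p) (T : (Fin 3 → Fin 6) → R) :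
    cliffSlash g T * p = (1 - p) * cliffSlash g T := by
  unfold cliffSlash skew
  simp only [smul_mul_assoc, mul_smul_comm, Finset.sum_mul, Finset.mul_sum, h.triple_mul]

/-- Right multiplication by the volume element fixes a self-dual element and is `-1` on the
complement, so the product equals its own negative. -/
theorem IsChiral.cliffSlash_mul_compl (h : IsChiral g p) (hT : hodgeStar T = T) :
    cliffSlash g T * (1 - p) = 0 := by
  have h1 := h.clifford.cliffSlash_hodgeStar T
  rw [hT] at h1
  have h2 : cliffSlash g T * (1 - p) = -(cliffSlash g T * (1 - p)) := by
    conv_lhs => rw [h1, mul_assoc, h.volume', mul_neg]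
  have h3 : (2 : ℝ) • (cliffSlash g T * (1 - p)) = 0 := by
    rw [two_smul]; nth_rewrite 1 [h2]; simp
  exact (smul_eq_zero.1 h3).resolve_left two_ne_zero

/-- The other half of the anticommutator vanishes, because `g d` carries the image of `p` to the
complement, which a self-dual element annihilates. -/
theorem IsChiral.mul_cliffSlash_mul (h : IsChiral g p) (hs : IsSkew T) (hT : hodgeStar T = T)
    (d : Fin 6) : g d * cliffSlash g T * p = cliffContract g T d * p := by
  rw [← h.clifford.cliffSlash_anticomm hs, add_mul, mul_assoc (cliffSlash g T), h.exchange,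
    ← mul_assoc, h.cliffSlash_mul_compl hT, zero_mul, zero_add]

/-- On the image of `p` both terms reduce to the contraction at `a`. The sign from exchanging `g a`
and `g b` turns their sum into a commutator, evaluated by `cliffContract_comm`. -/
theorem IsChiral.cliffSlash_anticomm_pair (h : IsChiral g p) (hs : IsSkew T)
    (hT : hodgeStar T = T) {a b : Fin 6} (hab : a ≠ b) :
    (cliffSlash g T * (g a * g b) + g a * g b * cliffSlash g T) * p =
      (-4 : ℝ) • ∑ c, (eta c • T ![a, b, c]) • (g c * p) := by
  have h1 : cliffSlash g T * (g a * g b) * p = cliffContract g T a * g b * p := by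
    rw [← h.clifford.cliffSlash_anticomm hs, add_mul, add_mul, mul_assoc (g a * _), h.exchange,
      mul_assoc (g a), ← mul_assoc (cliffSlash g T) (1 - p), h.cliffSlash_mul_compl hT, zero_mul,
      mul_zero, add_zero]
    simp only [mul_assoc]
  have h2 : g a * g b * cliffSlash g T * p = -(g b * cliffContract g T a * p) := by
    rw [h.clifford.anticomm hab, neg_mul, neg_mul, mul_assoc (g b), mul_assoc (g b),
      h.mul_cliffSlash_mul hs hT, mul_assoc (g b)]
  rw [add_mul, h1, h2, ← sub_eq_add_neg, ← sub_mul, h.clifford.cliffContract_comm hs,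
    smul_mul_assoc, Finset.sum_mul]
  simp only [smul_mul_assoc]

/-- Write `S` for the Clifford element of `T` and `K` for the contraction at `c`. Since `S S p = 0`,
the left-hand side equals both `S K p` and `K S p`. Their sum is an anticommutator of `S` with
products of two generators, and half of it produces the factor `-2`. -/
theorem IsChiral.cliffSlash_mul_mul_cliffSlash (h : IsChiral g p) (hs : IsSkew T)
    (hT : hodgeStar T = T) (c : Fin 6) :
    cliffSlash g T * g c * cliffSlash g T * p =
      (-2 : ℝ) • ∑ d, square T c d • (g d * p) := by
  have hSS : cliffSlash g T * cliffSlash g T * p = 0 := by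
    rw [mul_assoc, h.cliffSlash_mul, ← mul_assoc, h.cliffSlash_mul_compl hT, zero_mul]
  have h1 : cliffContract g T c * cliffSlash g T * p =
      cliffSlash g T * g c * cliffSlash g T * p := by
    rw [← h.clifford.cliffSlash_anticomm hs, add_mul, add_mul, mul_assoc (g c), mul_assoc (g c),
      hSS, mul_zero, add_zero]
  have h2 : cliffSlash g T * cliffContract g T c * p =
      cliffSlash g T * g c * cliffSlash g T * p := by
    rw [mul_assoc, ← h.mul_cliffSlash_mul hs hT]
    simp only [mul_assoc]
  have h3 : (cliffSlash g T * cliffContract g T c + cliffContract g T c * cliffSlash g T) * p =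
      (-4 : ℝ) • ∑ d, square T c d • (g d * p) := by
    have h4 : ∀ a b, (eta a * eta b) • T ![c, a, b] • ((cliffSlash g T * (g a * g b) +
        g a * g b * cliffSlash g T) * p) = (-4 : ℝ) • ∑ d,
          ((eta a * eta b * eta d) • (T ![c, a, b] * T ![a, b, d])) • (g d * p) := fun a b => by
      by_cases hab : a = b
      · subst hab
        have : T ![c, a, a] = 0 := hs.eq_zero fun hi => by
          simpa using @hi 1 2 rfl
        simp [this]
      · rw [h.cliffSlash_anticomm_pair hs hT hab, smul_comm (T _), smul_comm (eta a * eta b)]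
        congr 1
        rw [Finset.smul_sum, Finset.smul_sum]
        refine Finset.sum_congr rfl fun d _ => ?_
        rw [smul_smul, ← smul_assoc, mul_smul_comm, smul_smul]
    unfold cliffContract
    simp only [Finset.mul_sum, Finset.sum_mul, mul_smul_comm, smul_mul_assoc,
      ← Finset.sum_add_distrib, ← smul_add, smul_assoc]
    rw [Finset.sum_congr rfl fun a _ => Finset.sum_congr rfl fun b _ => h4 a b]
    simp only [← Finset.smul_sum]
    congr 1
    rw [Finset.sum_congr rfl fun a _ => Finset.sum_comm, Finset.sum_comm]
    refine Finset.sum_congr rfl fun d _ => ?_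
    simp only [square, Finset.sum_smul]
  rw [add_mul, h1, h2, ← two_smul ℝ] at h3
  have h5 := congrArg (fun x => (2⁻¹ : ℝ) • x) h3
  simp only [smul_smul] at h5
  norm_num at h5
  rw [h5]
  norm_num

end Clifford

end

noncomputable section

/-! ## The square of a self-dual 3-form -/

section Square

variable {R : Type*} [CommRing R] [Algebra ℝ R] {T : (Fin 3 → Fin 6) → R}

theorem selfDual_fst3 (hs : IsSkew T) (hT : hodgeStar T = T) (π : Equiv.Perm (Fin 6)) :
    T (fst3 π) = (eta3 (fst3 π) * ((Equiv.Perm.sign π : ℤ) : ℝ)) • T (snd3 π) := by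
  rw [← hodgeStar_fst3 hs, hT]

/-- The ten components containing the index `0` are coordinates on self-dual forms; the other ten
are expressed through them. -/
theorem selfDual_components (hs : IsSkew T) (hT : hodgeStar T = T) :
    (T ![3, 4, 5] = -T ![0, 1, 2] ∧ T ![2, 4, 5] = T ![0, 1, 3] ∧ T ![2, 3, 5] = -T ![0, 1, 4] ∧
      T ![2, 3, 4] = T ![0, 1, 5] ∧ T ![1, 4, 5] = -T ![0, 2, 3]) ∧
    (T ![1, 3, 5] = T ![0, 2, 4] ∧ T ![1, 3, 4] = -T ![0, 2, 5] ∧ T ![1, 2, 5] = -T ![0, 3, 4] ∧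
      T ![1, 2, 4] = T ![0, 3, 5] ∧ T ![1, 2, 3] = -T ![0, 4, 5]) := by
  have key : ∀ (a b c d e f : Fin 6) (π : Equiv.Perm (Fin 6)), fst3 π = ![a, b, c] →
      snd3 π = ![d, e, f] → ∀ s : ℝ, eta a * eta b * eta c * ((Equiv.Perm.sign π : ℤ) : ℝ) = s →
      T ![a, b, c] = s • T ![d, e, f] := fun a b c d e f π h1 h2 s h3 => by
    have := selfDual_fst3 hs hT π
    rw [h1, h2] at this
    rw [this, ← h3]
    simp [eta3, Fin.prod_univ_three]
  -- The triples are left unsorted so that each permutation is a product of at most two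
  -- transpositions; skewness sorts them afterwards.
  have k1 := key 0 1 2 3 4 5 1 (by decide) (by decide) (-1) (by simp [eta])
  have k2 := key 0 1 3 2 4 5 (Equiv.swap 2 3) (by decide) (by decide) 1 (by simp [eta])
  have k3 := key 0 1 4 3 2 5 (Equiv.swap 2 4) (by decide) (by decide) 1 (by simp [eta])
  have k4 := key 0 1 5 3 4 2 (Equiv.swap 2 5) (by decide) (by decide) 1 (by simp [eta])
  have k5 := key 0 3 2 1 4 5 (Equiv.swap 1 3) (by decide) (by decide) 1 (by simp [eta])
  have k6 := key 0 4 2 3 1 5 (Equiv.swap 1 4) (by decide) (by decide) 1 (by simp [eta])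
  have k7 := key 0 5 2 3 4 1 (Equiv.swap 1 5) (by decide) (by decide) 1 (by simp [eta])
  have k8 := key 0 3 4 1 2 5 (Equiv.swap 1 3 * Equiv.swap 2 4) (by decide) (by decide) (-1)
    (by simp [eta])
  have k9 := key 0 3 5 1 4 2 (Equiv.swap 1 3 * Equiv.swap 2 5) (by decide) (by decide) (-1)
    (by simp [eta])
  have k10 := key 0 4 5 3 1 2 (Equiv.swap 1 4 * Equiv.swap 2 5) (by decide) (by decide) (-1)
    (by simp [eta])
  simp only [neg_smul, one_smul] at k1 k2 k3 k4 k5 k6 k7 k8 k9 k10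
  rw [hs.swap01 2 3 5] at k3
  rw [hs.rotate 2 3 4] at k4
  rw [hs.swap12 0 2 3] at k5
  rw [hs.swap12 0 2 4, hs.swap01 1 3 5] at k6
  rw [hs.swap12 0 2 5, hs.rotate 1 3 4] at k7
  rw [hs.swap12 1 2 4] at k9
  rw [← hs.rotate 3 1 2] at k10
  refine ⟨⟨?_, ?_, ?_, ?_, ?_⟩, ?_, ?_, ?_, ?_, ?_⟩
  · rw [k1, neg_neg]
  · rw [k2]
  · rw [k3, neg_neg]
  · rw [k4]
  · rw [← k5]
  · rw [← neg_neg (T ![0, 2, 4]), k6, neg_neg]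
  · rw [← k7]
  · rw [k8, neg_neg]
  · rw [k9, neg_neg]
  · rw [k10, neg_neg]

theorem square_comm (T : (Fin 3 → Fin 6) → R) (hs : IsSkew T) (a b : Fin 6) :
    eta b • square T a b = eta a • square T b a := by
  unfold square
  simp only [Finset.smul_sum, smul_smul]
  refine Finset.sum_congr rfl fun c _ => Finset.sum_congr rfl fun d _ => ?_
  rw [← hs.rotate b c d, ← hs.rotate a c d, mul_comm (T ![c, d, b])]
  congr 1
  linear_combination (eta c * eta d) * eta_mul_self b - (eta c * eta d) * eta_mul_self a

-- After elimination of the dependent components, every entry on or above the diagonal of the square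
-- is an explicit quadratic polynomial in ten unknowns, and `square_comm` supplies the entries
-- below. Both claims are then polynomial identities.
set_option maxHeartbeats 2000000 in
theorem square_explicit (hs : IsSkew T) (hT : hodgeStar T = T) (a b : Fin 6) :
    (square T).trace = 0 ∧ (square T * square T) a b =
      if a = b then (square T * square T) 0 0 else 0 := by
  obtain ⟨⟨d1, d2, d3, d4, d5⟩, d6, d7, d8, d9, d10⟩ := selfDual_components hs hT
  have z1 : ∀ a b, T ![a, a, b] = 0 := fun a b => hs.eq_zero fun hi => by simpa using @hi 0 1 rfl
  have z2 : ∀ a b, T ![a, b, b] = 0 := fun a b => hs.eq_zero fun hi => by simpa using @hi 1 2 rfl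
  have z3 : ∀ a b, T ![a, b, a] = 0 := fun a b => hs.eq_zero fun hi => by simpa using @hi 0 2 rfl
  -- The inequality orients the rewriting, so that indices get sorted and the simplification
  -- terminates.
  have s1 : ∀ a b c, b < a → T ![a, b, c] = -T ![b, a, c] := fun a b c _ => hs.swap01 b a c
  have s2 : ∀ a b c, c < b → T ![a, b, c] = -T ![a, c, b] := fun a b c _ => hs.swap12 a c b
  have e0 : eta (0 : Fin 6) = -1 := by simp [eta]
  have e1 : eta (1 : Fin 6) = 1 := by simp [eta]
  have e2 : eta (2 : Fin 6) = 1 := by simp [eta]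
  have e3 : eta (3 : Fin 6) = 1 := by simp [eta]
  have e4 : eta (4 : Fin 6) = 1 := by simp [eta]
  have e5 : eta (5 : Fin 6) = 1 := by simp [eta]
  have H : ∀ a b, square T a b =
      ∑ c, ∑ d, (eta c * eta d * eta b) • (T ![a, c, d] * T ![c, d, b]) := fun a b => rfl
  have C := square_comm T hs
  have h00 := H 0 0
  have h01 := H 0 1
  have h02 := H 0 2
  have h03 := H 0 3
  have h04 := H 0 4
  have h05 := H 0 5
  have h11 := H 1 1
  have h12 := H 1 2
  have h13 := H 1 3
  have h14 := H 1 4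
  have h15 := H 1 5
  have h22 := H 2 2
  have h23 := H 2 3
  have h24 := H 2 4
  have h25 := H 2 5
  have h33 := H 3 3
  have h34 := H 3 4
  have h35 := H 3 5
  have h44 := H 4 4
  have h45 := H 4 5
  have h55 := H 5 5
  simp only [Fin.sum_univ_six, z1, z2, z3, e0, e1, e2, e3, e4, e5, zero_mul, mul_zero, smul_zero,
    add_zero, zero_add, mul_one, mul_neg, one_smul, neg_smul] at h00 h01 h02 h03 h04 h05 h11 h12 h13 h14 h15 h22 h23 h24 h25 h33 h34 h35 h44 h45 h55
  simp [s1, s2, d1, d2, d3, d4, d5, d6, d7, d8, d9, d10] at h00 h01 h02 h03 h04 h05 h11 h12 h13 h14 h15 h22 h23 h24 h25 h33 h34 h35 h44 h45 h55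
  have h10 := C 1 0
  have h20 := C 2 0
  have h30 := C 3 0
  have h40 := C 4 0
  have h50 := C 5 0
  have h21 := C 2 1
  have h31 := C 3 1
  have h41 := C 4 1
  have h51 := C 5 1
  have h32 := C 3 2
  have h42 := C 4 2
  have h52 := C 5 2
  have h43 := C 4 3
  have h53 := C 5 3
  have h54 := C 5 4
  simp only [e0, e1, e2, e3, e4, e5, one_smul, neg_smul] at h10 h20 h30 h40 h50 h21 h31 h41 h51 h32 h42 h52 h43 h53 h54
  rw [neg_eq_iff_eq_neg] at h10 h20 h30 h40 h50
  clear H C s1 s2 z1 z2 z3 d1 d2 d3 d4 d5 d6 d7 d8 d9 d10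
  ring_nf at h00 h01 h02 h03 h04 h05 h11 h12 h13 h14 h15 h22 h23 h24 h25 h33 h34 h35 h44 h45 h55
  generalize square T = M at *
  generalize T ![0, 1, 2] = x12 at h00 h01 h02 h03 h04 h05 h11 h12 h13 h14 h15 h22 h23 h24 h25 h33 h34 h35 h44 h45 h55
  generalize T ![0, 1, 3] = x13 at h00 h01 h02 h03 h04 h05 h11 h12 h13 h14 h15 h22 h23 h24 h25 h33 h34 h35 h44 h45 h55
  generalize T ![0, 1, 4] = x14 at h00 h01 h02 h03 h04 h05 h11 h12 h13 h14 h15 h22 h23 h24 h25 h33 h34 h35 h44 h45 h55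
  generalize T ![0, 1, 5] = x15 at h00 h01 h02 h03 h04 h05 h11 h12 h13 h14 h15 h22 h23 h24 h25 h33 h34 h35 h44 h45 h55
  generalize T ![0, 2, 3] = x23 at h00 h01 h02 h03 h04 h05 h11 h12 h13 h14 h15 h22 h23 h24 h25 h33 h34 h35 h44 h45 h55
  generalize T ![0, 2, 4] = x24 at h00 h01 h02 h03 h04 h05 h11 h12 h13 h14 h15 h22 h23 h24 h25 h33 h34 h35 h44 h45 h55
  generalize T ![0, 2, 5] = x25 at h00 h01 h02 h03 h04 h05 h11 h12 h13 h14 h15 h22 h23 h24 h25 h33 h34 h35 h44 h45 h55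
  generalize T ![0, 3, 4] = x34 at h00 h01 h02 h03 h04 h05 h11 h12 h13 h14 h15 h22 h23 h24 h25 h33 h34 h35 h44 h45 h55
  generalize T ![0, 3, 5] = x35 at h00 h01 h02 h03 h04 h05 h11 h12 h13 h14 h15 h22 h23 h24 h25 h33 h34 h35 h44 h45 h55
  generalize T ![0, 4, 5] = x45 at h00 h01 h02 h03 h04 h05 h11 h12 h13 h14 h15 h22 h23 h24 h25 h33 h34 h35 h44 h45 h55
  constructor
  · rw [Matrix.trace, Fin.sum_univ_six]
    simp only [Matrix.diag_apply, h00, h11, h22, h33, h44, h55]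
    ring
  · fin_cases a <;> fin_cases b <;>
    simp only [Fin.zero_eta, Fin.mk_one, Fin.reduceFinMk, Matrix.mul_apply, Fin.sum_univ_six,
      reduceIte, Fin.reduceEq, zero_ne_one, one_ne_zero, h00, h01, h02, h03, h04, h05, h10, h11, h12, h13, h14, h15, h20, h21, h22, h23, h24, h25, h30, h31, h32, h33, h34, h35, h40, h41, h42, h43, h44, h45, h50, h51, h52, h53, h54, h55] <;>
    ring

theorem trace_square (hs : IsSkew T) (hT : hodgeStar T = T) : (square T).trace = 0 :=
  (square_explicit hs hT 0 0).1

theorem square_mul_square (hs : IsSkew T) (hT : hodgeStar T = T) :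
    square T * square T = (6⁻¹ : ℝ) • (square T * square T).trace • (1 : Matrix (Fin 6) (Fin 6) R) := by
  have h := fun a b => (square_explicit hs hT a b).2
  ext a b
  have htr : (square T * square T).trace = (6 : ℝ) • (square T * square T) 0 0 := by
    rw [Matrix.trace, Fin.sum_univ_six]
    simp only [Matrix.diag_apply]
    rw [h 1 1, h 2 2, h 3 3, h 4 4, h 5 5]
    simp only [if_true]
    module
  rw [htr, h a b, Matrix.smul_apply, Matrix.smul_apply, Matrix.one_apply]
  split
  · rw [smul_assoc, smul_smul]; simp
  · simp

end Square

end

noncomputable section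

set_option linter.unusedSectionVars false

/-! ## The algebraic equation for the flux -/

section Flux

variable {R : Type*} [CommRing R] [Algebra ℝ R] {T H : (Fin 3 → Fin 6) → R}

/-- Contraction of the first index of a 3-tensor with a matrix. -/
def contractFirst (m : Matrix (Fin 6) (Fin 6) R) (T : (Fin 3 → Fin 6) → R) (a b c : Fin 6) : R :=
  ∑ a', m a a' * T ![a', b, c]

/-- The square of `square T` is scalar, so `1 + 2T²` and `1 - 2T²` are mutually inverse up to the
scalar `l`. From left to right the invertibility of `l` is a consequence, obtained by contracting
`H` with `T`. -/
theorem flux_iff (hs : IsSkew T) (hT : hodgeStar T = T) :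
    (∀ a b c, contractFirst (1 - (2 : ℝ) • square T) H a b c = (-4 : ℝ) • T ![a, b, c]) ↔
      IsUnit (1 - (2 / 3 : ℝ) • (square T * square T).trace) ∧
      ∀ a b c, (1 - (2 / 3 : ℝ) • (square T * square T).trace) * H ![a, b, c] =
        (-4 : ℝ) • contractFirst (1 + (2 : ℝ) • square T) T a b c := by
  have hq := square_mul_square hs hT
  have htr := trace_square hs hT
  set t := (square T * square T).trace with ht
  set l : R := 1 - (2 / 3 : ℝ) • t with hl
  have e1 : (1 + (2 : ℝ) • square T) * (1 - (2 : ℝ) • square T) =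
      l • (1 : Matrix (Fin 6) (Fin 6) R) := by
    have : (1 + (2 : ℝ) • square T) * (1 - (2 : ℝ) • square T) =
        1 - (4 : ℝ) • (square T * square T) := by
      simp only [add_mul, mul_sub, one_mul, mul_one, smul_mul_assoc, mul_smul_comm]
      module
    rw [this, hq, hl, sub_smul, one_smul, smul_assoc, smul_smul]
    norm_num
  have e2 : (1 - (2 : ℝ) • square T) * (1 + (2 : ℝ) • square T) =
      l • (1 : Matrix (Fin 6) (Fin 6) R) := by
    rw [← e1]
    simp only [add_mul, mul_sub, sub_mul, mul_add, one_mul, mul_one, smul_mul_assoc, mul_smul_comm]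
    module
  constructor
  · intro h
    have h1 : ∀ a b c, l * H ![a, b, c] =
        (-4 : ℝ) • contractFirst (1 + (2 : ℝ) • square T) T a b c := fun a b c => by
      have h2 : (1 - (2 : ℝ) • square T).mulVec (fun a => H ![a, b, c]) =
          (-4 : ℝ) • fun a => T ![a, b, c] := funext fun a => h a b c
      have h3 := congrArg (fun x => (1 + (2 : ℝ) • square T).mulVec x a) h2
      simp only [Matrix.mulVec_mulVec, e1, Matrix.smul_mulVec, Matrix.one_mulVec,
        Matrix.mulVec_smul] at h3
      exact h3
    refine ⟨?_, h1⟩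
    -- The full contraction of `H` with `T`: applied to `l H = -4 (1 + 2T²) T` it yields the trace
    -- of `T² + 2 T² T²`, whose first part vanishes.
    let w : R := ∑ a, ∑ c, ∑ d, (eta c * eta d * eta a) • (H ![a, c, d] * T ![c, d, a])
    have h4 : l * w = (-4 : ℝ) • ((1 + (2 : ℝ) • square T) * square T).trace := by
      simp only [w, Finset.mul_sum, mul_smul_comm, ← mul_assoc, h1, Matrix.trace, Matrix.diag_apply,
        Matrix.mul_apply, Finset.smul_sum, contractFirst, square, Finset.sum_mul, smul_mul_assoc]
      refine Finset.sum_congr rfl fun a _ => ?_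
      rw [Finset.sum_congr rfl fun c _ => Finset.sum_comm, Finset.sum_comm]
      refine Finset.sum_congr rfl fun b _ => Finset.sum_congr rfl fun c _ =>
        Finset.sum_congr rfl fun d _ => ?_
      rw [smul_comm, mul_assoc]
    have h5 : ((1 + (2 : ℝ) • square T) * square T).trace = (2 : ℝ) • t := by
      rw [add_mul, one_mul, Matrix.trace_add, htr, zero_add, smul_mul_assoc, Matrix.trace_smul]
    rw [h5] at h4
    -- From `l w = -8t` and `12 l = 12 - 8t` it follows that `l (12 - w) = 12`.
    have h6 : l * ((12⁻¹ : ℝ) • ((12 : ℝ) • (1 : R) - w)) = 1 := by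
      rw [mul_smul_comm, mul_sub, h4, mul_smul_comm, mul_one, hl]
      module
    exact IsUnit.of_mul_eq_one _ h6
  · rintro ⟨hu, h⟩ a b c
    have h2 : l • (fun a => H ![a, b, c]) =
        (-4 : ℝ) • (1 + (2 : ℝ) • square T).mulVec fun a => T ![a, b, c] :=
      funext fun a => h a b c
    have h3 := congrArg (fun x => (1 - (2 : ℝ) • square T).mulVec x a) h2
    simp only [Matrix.mulVec_smul, Matrix.mulVec_mulVec, e2, Matrix.smul_mulVec,
      Matrix.one_mulVec] at h3
    apply hu.mul_left_cancel
    rw [mul_smul_comm]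
    exact h3

end Flux

/-! ## The Clifford representation -/

theorem mul_prod_ofFn {A : Type*} [Ring A] [Algebra ℝ A] {n : ℕ} (x : A) (f : Fin n → A)
    (ε : Fin n → ℝ) (h : ∀ i, x * f i = ε i • (f i * x)) :
    x * (List.ofFn f).prod = (∏ i, ε i) • ((List.ofFn f).prod * x) := by
  induction n with
  | zero => simp
  | succ n ih =>
    rw [List.ofFn_succ, List.prod_cons, ← mul_assoc, h, smul_mul_assoc, mul_assoc,
      ih (fun i => f i.succ) (fun i => ε i.succ) fun i => h i.succ, Fin.prod_univ_succ,
      mul_smul_comm, smul_smul, mul_assoc]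

theorem tang_injective : Function.Injective tang := Fin.castAdd_injective 6 5

theorem transv_injective : Function.Injective transv := Fin.natAdd_injective 5 6

theorem tang_ne_transv (a : Fin 6) (i : Fin 5) : tang a ≠ transv i := by
  simp [tang, transv, Fin.ext_iff]; omega

theorem eta_tang (a : Fin 6) : eta (tang a) = eta a := rfl

theorem eta_transv (i : Fin 5) : eta (transv i) = 1 := by
  simp [eta, transv]

namespace MajoranaRep

variable (M : MajoranaRep)

theorem anticomm {a b : Fin 11} (h : a ≠ b) : M.Γ a * M.Γ b = -(M.Γ b * M.Γ a) := by
  have := M.clifford a b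
  rw [if_neg h, zero_smul] at this
  exact eq_neg_of_add_eq_zero_left this

theorem sq (a : Fin 11) : M.Γ a * M.Γ a = eta a • 1 := by
  have := M.clifford a a
  rw [if_pos rfl, ← two_smul ℝ, mul_smul] at this
  exact smul_right_injective _ (two_ne_zero (α := ℝ)) this

theorem isUnit_Γ (a : Fin 11) : IsUnit (M.Γ a) := by
  refine IsUnit.of_mul_eq_one (eta a • M.Γ a) ?_
  rw [mul_smul_comm, M.sq, smul_smul, eta_mul_self, one_smul]

/-- The product of the transversal Clifford generators. -/
def transvVolume : Matrix (Fin 32) (Fin 32) ℝ := (List.ofFn fun i : Fin 5 => M.Γ (transv i)).prod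

theorem P_eq : M.P = (2⁻¹ : ℝ) • (1 + M.transvVolume) := rfl

theorem P_eq_diagonal :
    M.P = Matrix.diagonal fun α : Fin 32 => if α.val < 16 then (1 : ℝ) else 0 := M.adapted

theorem P_mul_P : M.P * M.P = M.P := by
  rw [P_eq_diagonal, Matrix.diagonal_mul_diagonal]
  congr 1
  funext α
  split <;> simp

theorem transvVolume_eq : M.transvVolume = (2 : ℝ) • M.P - 1 := by
  rw [P_eq, smul_smul]; norm_num

theorem transvVolume_mul_self : M.transvVolume * M.transvVolume = 1 := by
  rw [transvVolume_eq]
  simp only [mul_sub, sub_mul, smul_mul_assoc, mul_smul_comm, M.P_mul_P, one_mul, mul_one]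
  module

/-- The product of all generators is `1` and the transversal volume element is its own inverse. -/
theorem tangVolume_eq : (List.ofFn fun a : Fin 6 => M.Γ (tang a)).prod = M.transvVolume := by
  have h : (List.ofFn fun a : Fin 6 => M.Γ (tang a)).prod * M.transvVolume = 1 := by
    rw [← M.volume, transvVolume, ← List.prod_append, ← List.ofFn_fin_append]
    congr 2
    exact Fin.append_castAdd_natAdd (m := 6) (n := 5) (f := M.Γ)
  have := congrArg (· * M.transvVolume) h
  simpa [mul_assoc, M.transvVolume_mul_self] using this

theorem tang_mul_transvVolume (a : Fin 6) :
    M.Γ (tang a) * M.transvVolume = -(M.transvVolume * M.Γ (tang a)) := by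
  unfold transvVolume
  rw [mul_prod_ofFn _ _ (fun _ => -1)]
  · rw [Fin.prod_const, Odd.neg_one_pow (by decide), neg_smul, one_smul]
  · intro i
    rw [neg_smul, one_smul]
    exact M.anticomm (tang_ne_transv a i)

theorem transv_mul_transvVolume (j : Fin 5) :
    M.Γ (transv j) * M.transvVolume = M.transvVolume * M.Γ (transv j) := by
  unfold transvVolume
  rw [mul_prod_ofFn _ _ (fun i => if i = j then 1 else -1)]
  · have : (∏ i : Fin 5, if i = j then (1 : ℝ) else -1) = 1 := by
      have h : (∏ i : Fin 5, if i = j then (1 : ℤ) else -1) = 1 := by revert j; decide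
      exact_mod_cast congrArg (Int.cast (R := ℝ)) h
    rw [this, one_smul]
  · intro i
    split
    · next h => rw [h, one_smul]
    · next h =>
      rw [neg_smul, one_smul]
      exact M.anticomm (transv_injective.ne (Ne.symm h))

theorem tang_mul_P (a : Fin 6) : M.Γ (tang a) * M.P = (1 - M.P) * M.Γ (tang a) := by
  rw [P_eq, mul_smul_comm, mul_add, M.tang_mul_transvVolume, sub_mul, smul_mul_assoc, add_mul,
    one_mul, mul_one]
  module

theorem transv_mul_P (j : Fin 5) : M.Γ (transv j) * M.P = M.P * M.Γ (transv j) := by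
  rw [P_eq, mul_smul_comm, mul_add, M.transv_mul_transvVolume, smul_mul_assoc, add_mul,
    one_mul, mul_one]

theorem isChiral : IsChiral (fun a => M.Γ (tang a)) M.P where
  clifford := fun a b => by
    have := M.clifford (tang a) (tang b)
    rw [this]
    simp only [tang_injective.eq_iff]
    rfl
  exchange := M.tang_mul_P
  volume := by
    rw [tangVolume_eq, transvVolume_eq, sub_mul, smul_mul_assoc, M.P_mul_P, one_mul]
    module
  volume' := by
    rw [tangVolume_eq, transvVolume_eq]
    simp only [mul_sub, sub_mul, smul_mul_assoc, M.P_mul_P, mul_one, one_mul]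
    module

/-- Passing to the adjoint reverses the five factors, an even permutation, and gives five signs. The
transversal volume element is thus skew self-adjoint, and the adjoint of `P` is `1 - P`. -/
theorem transpose_P_mul_C : M.P.transpose * M.C = M.C * (1 - M.P) := by
  have h1 : ∀ l : List (Fin 11), (l.map M.Γ).prod.transpose * M.C =
      ((-1 : ℝ) ^ l.length) • (M.C * (l.reverse.map M.Γ).prod) := fun l => by
    induction l with
    | nil => simp
    | cons a l ih =>
      simp only [List.map_cons, List.prod_cons, Matrix.transpose_mul, Matrix.mul_assoc, M.adjoint,
        List.length_cons, List.reverse_cons, List.map_append, List.prod_append, List.map_nil,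
        List.prod_nil, mul_one]
      rw [Matrix.mul_neg, ← Matrix.mul_assoc, ih, pow_succ, smul_mul_assoc, Matrix.mul_assoc,
        mul_neg_one, neg_smul]
  have h2 := h1 (List.ofFn transv)
  have h3 : ((List.ofFn transv).map M.Γ).prod = M.transvVolume := by
    rw [List.map_ofFn]; rfl
  have h4 : (((List.ofFn transv).reverse).map M.Γ).prod = M.transvVolume := by
    have := List.prod_ofFn_perm (fun i => M.Γ (transv i))
      (fun i j hij => M.anticomm (transv_injective.ne hij)) Fin.revPerm
    have hs : Equiv.Perm.sign (Fin.revPerm : Equiv.Perm (Fin 5)) = 1 := by decide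
    rw [hs] at this
    simp only [Units.val_one, one_smul] at this
    rw [transvVolume, ← this]
    congr 1
  rw [h3, h4, List.length_ofFn] at h2
  rw [P_eq, Matrix.transpose_smul, Matrix.transpose_add, Matrix.transpose_one, smul_mul_assoc,
    add_mul, h2, one_mul, mul_sub, mul_smul_comm, mul_add, mul_one]
  norm_num
  module

theorem trace_P : M.P.trace = 16 := by
  rw [P_eq_diagonal, Matrix.trace_diagonal]
  simp only [Fin.sum_univ_succ]
  norm_num

/-- For `a ≠ b` a third generator `f` commutes with the product of the two and exchanges `P` with `1
- P`. Hence the trace of that product, which is zero, is shared equally by the two halves. -/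
theorem trace_tang_mul_tang_mul_P (a b : Fin 6) :
    (M.Γ (tang a) * M.Γ (tang b) * M.P).trace = if a = b then 16 * eta a else 0 := by
  split
  · next h =>
    rw [h, M.sq, smul_mul_assoc, one_mul, Matrix.trace_smul, M.trace_P, eta_tang, smul_eq_mul,
      mul_comm]
  · next h =>
    obtain ⟨f, hfa, hfb⟩ : ∃ f : Fin 6, f ≠ a ∧ f ≠ b := by
      revert a b; decide
    have h0 : (M.Γ (tang a) * M.Γ (tang b)).trace = 0 := by
      have h1 := Matrix.trace_mul_comm (M.Γ (tang a)) (M.Γ (tang b))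
      rw [M.anticomm (tang_injective.ne h), Matrix.trace_neg] at h1 ⊢
      linarith
    have hc : M.Γ (tang f) * (M.Γ (tang a) * M.Γ (tang b)) =
        M.Γ (tang a) * M.Γ (tang b) * M.Γ (tang f) := by
      rw [← mul_assoc, M.anticomm (tang_injective.ne hfa), neg_mul, mul_assoc,
        M.anticomm (tang_injective.ne hfb), mul_neg, neg_neg, mul_assoc]
    have h2 : (M.Γ (tang a) * M.Γ (tang b) * M.P).trace =
        (M.Γ (tang a) * M.Γ (tang b) * (1 - M.P)).trace := by
      have h3 : M.Γ (tang a) * M.Γ (tang b) * M.P =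
          (eta (tang f) • M.Γ (tang f)) * (M.Γ (tang f) * (M.Γ (tang a) * M.Γ (tang b) * M.P)) := by
        rw [smul_mul_assoc, ← mul_assoc (M.Γ (tang f)), M.sq, smul_mul_assoc, smul_smul,
          eta_mul_self, one_smul, one_mul]
      have h4 : M.Γ (tang f) * (M.Γ (tang a) * M.Γ (tang b) * M.P) * (eta (tang f) • M.Γ (tang f))
          = M.Γ (tang a) * M.Γ (tang b) * (1 - M.P) := by
        rw [← mul_assoc, hc, mul_assoc _ (M.Γ (tang f)), M.tang_mul_P, mul_smul_comm]
        simp only [mul_assoc]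
        rw [M.sq]
        simp only [mul_smul_comm, smul_smul, eta_mul_self, one_smul, mul_one]
      conv_lhs => rw [h3]
      rw [Matrix.trace_mul_comm, h4]
    rw [mul_sub, Matrix.trace_sub, mul_one, h0] at h2
    linarith

end MajoranaRep

end

noncomputable section

set_option linter.unusedSectionVars false

/-! ## The Clifford representation over a commutative algebra -/

/-- Real matrices as matrices over a real algebra. -/
def realMatrix (R : Type*) [CommRing R] [Algebra ℝ R] :
    Matrix (Fin 32) (Fin 32) ℝ →ₐ[ℝ] Matrix (Fin 32) (Fin 32) R :=
  (Algebra.ofId ℝ R).mapMatrix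

section RealMatrix

variable {R : Type*} [CommRing R] [Algebra ℝ R]

theorem realMatrix_apply (X : Matrix (Fin 32) (Fin 32) ℝ) (α β : Fin 32) :
    realMatrix R X α β = algebraMap ℝ R (X α β) := rfl

theorem trace_realMatrix (X : Matrix (Fin 32) (Fin 32) ℝ) :
    (realMatrix R X).trace = algebraMap ℝ R X.trace := by
  simp [Matrix.trace, realMatrix_apply]

theorem transpose_realMatrix (X : Matrix (Fin 32) (Fin 32) ℝ) :
    (realMatrix R X).transpose = realMatrix R X.transpose := rfl

end RealMatrix

/-! ### Transport of Clifford relations along algebra homomorphisms -/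

section MapClifford

variable {A B : Type*} [Ring A] [Ring B] [Algebra ℝ A] [Algebra ℝ B]

theorem IsClifford.map {g : Fin 6 → A} (hg : IsClifford g) (f : A →ₐ[ℝ] B) :
    IsClifford fun a => f (g a) := fun a b => by
  rw [← map_mul, ← map_mul, ← map_add, hg a b, map_smul, map_one]

theorem map_volume (g : Fin 6 → A) (f : A →ₐ[ℝ] B) :
    (List.ofFn fun a => f (g a)).prod = f (List.ofFn g).prod := by
  rw [map_list_prod, List.map_ofFn]; rfl

theorem IsChiral.map {g : Fin 6 → A} {p : A} (h : IsChiral g p) (f : A →ₐ[ℝ] B) :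
    IsChiral (fun a => f (g a)) (f p) where
  clifford := h.clifford.map f
  exchange a := by rw [← map_mul, h.exchange, map_mul, map_sub, map_one]
  volume := by rw [map_volume, ← map_mul, h.volume]
  volume' := by
    rw [map_volume, ← map_one f, ← map_sub, ← map_mul, h.volume', map_neg]

theorem map_skew_triple (g : Fin 6 → A) (f : A →ₐ[ℝ] B) (v : Fin 3 → Fin 6) :
    f (skew (triple g) v) = skew (triple fun a => f (g a)) v := by
  rw [← AlgHom.toLinearMap_apply, map_skew]
  congr 1
  funext w
  simp [triple]

end MapClifford

namespace MajoranaRep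

variable (M : MajoranaRep) (R : Type*) [CommRing R] [Algebra ℝ R]

/-- The tangential Clifford generators over `R`. -/
def gen (a : Fin 6) : Matrix (Fin 32) (Fin 32) R := realMatrix R (M.Γ (tang a))

/-- The projector `P` over `R`. -/
def proj : Matrix (Fin 32) (Fin 32) R := realMatrix R M.P

/-- The spinor pairing over `R`. -/
def form : Matrix (Fin 32) (Fin 32) R := realMatrix R M.C

theorem isChiral_gen : IsChiral (M.gen R) (M.proj R) := M.isChiral.map _

variable {R} {T : (Fin 3 → Fin 6) → R}

/-- The trace against `gen e` extracts `16 η_e` times the coefficient `y e`. -/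
theorem eq_zero_of_sum_gen (y : Fin 6 → R) (h : ∑ d, y d • (M.gen R d * M.proj R) = 0) : y = 0 := by
  funext e
  have h1 := congrArg (fun X => (M.gen R e * X).trace) h
  simp only [Finset.mul_sum, mul_smul_comm, mul_zero, Matrix.trace_sum, Matrix.trace_smul,
    Matrix.trace_zero] at h1
  have h2 : ∀ d, (M.gen R e * (M.gen R d * M.proj R)).trace =
      if e = d then algebraMap ℝ R (16 * eta e) else 0 := fun d => by
    unfold gen proj
    rw [← map_mul, ← map_mul, trace_realMatrix, ← mul_assoc, M.trace_tang_mul_tang_mul_P]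
    split <;> simp
  simp only [h2, smul_eq_mul, mul_ite, mul_zero, Finset.sum_ite_eq, Finset.mem_univ, if_true] at h1
  have h3 : ((16 * eta e : ℝ)) • y e = 0 := by rw [Algebra.smul_def, mul_comm]; exact h1
  exact (smul_eq_zero.1 h3).resolve_left (mul_ne_zero (by norm_num) (eta_ne_zero e))

/-- The anticommutator with two distinct generators has the components of `T` as its coefficients,
and it vanishes on the image of the projector as soon as the 3-form does. -/
theorem eq_zero_of_cliffSlash (hs : IsSkew T) (hT : hodgeStar T = T)
    (h : cliffSlash (M.gen R) T * M.proj R = 0) : T = 0 := by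
  have hc := M.isChiral_gen R
  funext v
  by_cases hv : Function.Injective v
  · have h1 := hc.cliffSlash_anticomm_pair hs hT (hv.ne (show (0 : Fin 3) ≠ 1 by decide))
    have h2 : (cliffSlash (M.gen R) T * (M.gen R (v 0) * M.gen R (v 1)) +
        M.gen R (v 0) * M.gen R (v 1) * cliffSlash (M.gen R) T) * M.proj R = 0 := by
      rw [add_mul, mul_assoc, mul_assoc (M.gen R (v 0)), hc.exchange, ← mul_assoc (M.gen R (v 0)),
        hc.exchange', mul_assoc (M.proj R), ← mul_assoc, h, mul_assoc (_ * _), h]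
      simp
    rw [h2] at h1
    have h3 : ∑ c, (eta c • T ![v 0, v 1, c]) • (M.gen R c * M.proj R) = 0 :=
      (smul_eq_zero.1 h1.symm).resolve_left (by norm_num)
    have h4 := congrFun (M.eq_zero_of_sum_gen _ h3) (v 2)
    have h5 : ![v 0, v 1, v 2] = v := by funext i; fin_cases i <;> rfl
    rw [h5] at h4
    exact (smul_eq_zero.1 h4).resolve_left (eta_ne_zero _)
  · exact hs.eq_zero hv

/-! ### Adjoints -/

theorem transpose_gen_mul_form (a : Fin 6) :
    (M.gen R a).transpose * M.form R = -(M.form R * M.gen R a) := by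
  unfold gen form
  rw [transpose_realMatrix, ← map_mul, ← map_mul, M.adjoint, map_neg]

theorem transpose_proj_mul_form :
    (M.proj R).transpose * M.form R = M.form R * (1 - M.proj R) := by
  unfold proj form
  rw [transpose_realMatrix, ← map_mul, M.transpose_P_mul_C, map_mul, map_sub, map_one]

theorem transpose_form : (M.form R).transpose = -M.form R := by
  unfold form
  rw [transpose_realMatrix, M.skew_pairing, map_neg]

theorem isUnit_form : IsUnit (M.form R) := by
  have : IsUnit M.C := (Matrix.isUnit_iff_isUnit_det _).2 (isUnit_iff_ne_zero.2 M.nondegenerate)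
  exact this.map (realMatrix R)

/-- Three signs from the generators cancel the odd sign of reversing three factors: 3-forms are
self-adjoint, whereas vectors are skew self-adjoint. -/
theorem transpose_skew_triple_mul_form (v : Fin 3 → Fin 6) :
    (skew (triple (M.gen R)) v).transpose * M.form R =
      M.form R * skew (triple (M.gen R)) v := by
  by_cases hv : Function.Injective v
  · have hg := (M.isChiral_gen R).clifford
    rw [hg.skew_triple hv]
    unfold triple
    simp only [Matrix.transpose_mul]
    rw [mul_assoc, mul_assoc, M.transpose_gen_mul_form, mul_neg, ← mul_assoc,
      M.transpose_gen_mul_form, mul_neg, neg_mul, mul_neg, neg_neg, ← mul_assoc, ← mul_assoc,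
      M.transpose_gen_mul_form, neg_mul, neg_mul]
    simp only [mul_assoc]
    rw [hg.anticomm (hv.ne (show (1 : Fin 3) ≠ 0 by decide)), mul_neg, mul_neg, neg_neg,
      ← mul_assoc (M.gen R (v 2)), hg.anticomm (hv.ne (show (2 : Fin 3) ≠ 0 by decide)), neg_mul,
      mul_neg, mul_assoc, hg.anticomm (hv.ne (show (2 : Fin 3) ≠ 1 by decide)), mul_neg, mul_neg,
      neg_neg]
  · rw [(isSkew_skew _).eq_zero hv]; simp

theorem transpose_cliffSlash_mul_form (T : (Fin 3 → Fin 6) → R) :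
    (cliffSlash (M.gen R) T).transpose * M.form R = M.form R * cliffSlash (M.gen R) T := by
  unfold cliffSlash
  simp only [Matrix.transpose_smul, Matrix.transpose_sum, smul_mul_assoc, Finset.sum_mul,
    mul_smul_comm, Finset.mul_sum, M.transpose_skew_triple_mul_form]

/-- Odd coframe members commute, so a quadratic expression in them sees only symmetric coefficients.
Symmetry here ensures that no coefficient is lost. -/
theorem transpose_form_gen_proj (a : Fin 6) :
    (M.form R * (M.gen R a * M.proj R)).transpose = M.form R * (M.gen R a * M.proj R) := by
  rw [Matrix.transpose_mul, Matrix.transpose_mul, M.transpose_form, mul_neg, mul_assoc,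
    M.transpose_gen_mul_form, mul_neg, neg_neg, ← mul_assoc, M.transpose_proj_mul_form, mul_assoc,
    (M.isChiral_gen R).exchange]

/-- The bilinear form of `Y` on the image of `P`, after the shear `1 + N`. -/
def shearForm (N Y : Matrix (Fin 32) (Fin 32) R) : Matrix (Fin 32) (Fin 32) R :=
  ((1 + N) * M.proj R).transpose * (M.form R * Y) * ((1 + N) * M.proj R)

/-- Moving the pairing to the left replaces the first shear by its adjoint and the first projector
by its complement. This leaves the block from the image of `P` to its complement, in which only odd
Clifford elements survive. -/
theorem shearForm_eq {N N' : Matrix (Fin 32) (Fin 32) R}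
    (hN : N.transpose * M.form R = M.form R * N') (Y : Matrix (Fin 32) (Fin 32) R) :
    M.shearForm N Y = M.form R * ((1 - M.proj R) * ((1 + N') * Y * (1 + N)) * M.proj R) := by
  have h : (1 + N).transpose * M.form R = M.form R * (1 + N') := by
    rw [Matrix.transpose_add, Matrix.transpose_one, add_mul, hN, one_mul, mul_add, mul_one]
  calc M.shearForm N Y
      = (M.proj R).transpose * ((1 + N).transpose * M.form R) * Y * (1 + N) * M.proj R := by
        unfold shearForm; rw [Matrix.transpose_mul]; simp only [mul_assoc]
    _ = ((M.proj R).transpose * M.form R) * (1 + N') * Y * (1 + N) * M.proj R := by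
        rw [h]; simp only [mul_assoc]
    _ = _ := by rw [M.transpose_proj_mul_form]; simp only [mul_assoc]

theorem proj_mul_proj : M.proj R * M.proj R = M.proj R := by
  unfold proj; rw [← map_mul, M.P_mul_P]

theorem compl_mul_proj : (1 - M.proj R) * M.proj R = 0 := by
  rw [sub_mul, one_mul, M.proj_mul_proj, sub_self]

theorem compl_mul_compl : (1 - M.proj R) * (1 - M.proj R) = 1 - M.proj R := by
  rw [mul_sub, M.compl_mul_proj, mul_one, sub_zero]

/-- With `S` the Clifford element of `T`, the odd terms of `(1 + S) γ_c (1 + S)` are `γ_c` and `S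
γ_c S`; the latter is given by `cliffSlash_mul_mul_cliffSlash`. -/
theorem shearForm_gen (hs : IsSkew T) (hT : hodgeStar T = T) (c : Fin 6) :
    M.shearForm (cliffSlash (M.gen R) T) (M.gen R c) =
      M.form R * ∑ d, (1 - (2 : ℝ) • square T) c d • (M.gen R d * M.proj R) := by
  have hc := M.isChiral_gen R
  rw [M.shearForm_eq (M.transpose_cliffSlash_mul_form T)]
  congr 1
  have hS := hc.cliffSlash_mul T
  have hS0 := hc.cliffSlash_mul_compl hT
  have hSgS := hc.cliffSlash_mul_mul_cliffSlash hs hT c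
  have hg := hc.exchange c
  have hg' := hc.exchange' c
  have hpp := M.compl_mul_proj (R := R)
  have hqq := M.compl_mul_compl (R := R)
  set S := cliffSlash (M.gen R) T
  set p := M.proj R
  set x := M.gen R c
  have h1 : (1 - p) * x * p = x * p := by rw [mul_assoc, hg, ← mul_assoc, hqq]
  have h2 : S * x * p = 0 := by rw [mul_assoc, hg, ← mul_assoc, hS0, zero_mul]
  have h3 : (1 - p) * (x * S * p) = 0 := by
    rw [mul_assoc x, hS, ← mul_assoc x, hg', ← mul_assoc, ← mul_assoc, hpp, zero_mul, zero_mul]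
  have h4 : (1 - p) * (S * x * S * p) = S * x * S * p := by
    have : S * x * S * p = (1 - p) * (S * x * S) := by
      rw [mul_assoc (S * x), hS, ← mul_assoc (S * x), mul_assoc S, hg', ← mul_assoc S, hS]
      simp only [mul_assoc]
    rw [this, ← mul_assoc, hqq]
  have h5 : (1 - p) * ((1 + S) * x * (1 + S)) * p = (1 - p) * x * p + (1 - p) * (S * x * p) +
      (1 - p) * (x * S * p) + (1 - p) * (S * x * S * p) := by noncomm_ring
  rw [h5, h1, h2, h3, h4, hSgS, mul_zero, add_zero, add_zero]
  have h6 : ∀ d, (1 - (2 : ℝ) • square T) c d • (M.gen R d * p) =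
      (if c = d then M.gen R d * p else 0) + (-2 : ℝ) • square T c d • (M.gen R d * p) := fun d => by
    rw [Matrix.sub_apply, sub_smul, Matrix.one_apply, Matrix.smul_apply, smul_assoc]
    split <;> simp [sub_eq_add_neg]
  simp only [h6, Finset.sum_add_distrib, Finset.sum_ite_eq, Finset.mem_univ, if_true,
    Finset.smul_sum]
  rfl

/-- For an even element in the middle only the terms linear in the shear are odd, and they form the
anticommutator of `cliffSlash_anticomm_pair`. -/
theorem shearForm_pair (hs : IsSkew T) (hT : hodgeStar T = T) {a b : Fin 6} (hab : a ≠ b) :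
    M.shearForm (cliffSlash (M.gen R) T) (M.gen R a * M.gen R b) =
      M.form R * ∑ d, ((-4 : ℝ) • eta d • T ![a, b, d]) • (M.gen R d * M.proj R) := by
  have hc := M.isChiral_gen R
  rw [M.shearForm_eq (M.transpose_cliffSlash_mul_form T)]
  congr 1
  have hS := hc.cliffSlash_mul T
  have hS0 := hc.cliffSlash_mul_compl hT
  have hpair := hc.cliffSlash_anticomm_pair hs hT hab
  have hga := hc.exchange' a
  have hgb := hc.exchange b
  have hga' := hc.exchange a
  have hgb' := hc.exchange' b
  have hpp := M.compl_mul_proj (R := R)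
  have hqq := M.compl_mul_compl (R := R)
  have hpp' := M.proj_mul_proj (R := R)
  simp only [smul_assoc (-4 : ℝ)]
  rw [← Finset.smul_sum, ← hpair]
  set S := cliffSlash (M.gen R) T
  set p := M.proj R
  set y := M.gen R a * M.gen R b
  have hy : y * p = p * y := by
    rw [mul_assoc, hgb, ← mul_assoc, hga, mul_assoc]
  have hy' : y * (1 - p) = (1 - p) * y := by rw [mul_sub, hy]; noncomm_ring
  have h1 : (1 - p) * y * p = 0 := by rw [mul_assoc, hy, ← mul_assoc, hpp, zero_mul]
  have h2 : S * y * p = (1 - p) * (S * y) := by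
    rw [mul_assoc, hy, ← mul_assoc, hS, mul_assoc]
  have h3 : y * S * p = (1 - p) * (y * S) := by
    rw [mul_assoc, hS, ← mul_assoc, hy', mul_assoc]
  have h4 : S * y * S * p = 0 := by
    rw [mul_assoc, hS, ← mul_assoc, mul_assoc S, hy', ← mul_assoc S, hS0, zero_mul, zero_mul]
  have h5 : (1 - p) * ((1 + S) * y * (1 + S)) * p = (1 - p) * y * p + (1 - p) * (S * y * p) +
      (1 - p) * (y * S * p) + (1 - p) * (S * y * S * p) := by noncomm_ring
  rw [h5, h1, h2, h3, h4, mul_zero, add_zero, zero_add, ← mul_assoc, hqq, ← mul_assoc (1 - p) (1 - p),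
    hqq, add_mul, h2, h3]

/-! ### Transversal generators -/

/-- The transversal Clifford generators over `R`. -/
def tgen (i : Fin 5) : Matrix (Fin 32) (Fin 32) R := realMatrix R (M.Γ (transv i))

theorem tgen_mul_gen (i : Fin 5) (a : Fin 6) :
    M.tgen (R := R) i * M.gen R a = -(M.gen R a * M.tgen i) := by
  unfold tgen gen
  rw [← map_mul, ← map_mul, M.anticomm (tang_ne_transv a i).symm, map_neg]

theorem tgen_mul_proj (i : Fin 5) : M.tgen (R := R) i * M.proj R = M.proj R * M.tgen i := by
  unfold tgen proj
  rw [← map_mul, ← map_mul, M.transv_mul_P]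

theorem isUnit_tgen (i : Fin 5) : IsUnit (M.tgen (R := R) i) := (M.isUnit_Γ _).map (realMatrix R)

theorem transpose_tgen_mul_form (i : Fin 5) :
    (M.tgen i).transpose * M.form R = -(M.form R * M.tgen i) := by
  unfold tgen form
  rw [transpose_realMatrix, ← map_mul, ← map_mul, M.adjoint, map_neg]

theorem tgen_mul_cliffSlash (i : Fin 5) (T : (Fin 3 → Fin 6) → R) :
    M.tgen i * cliffSlash (M.gen R) T = -(cliffSlash (M.gen R) T * M.tgen i) := by
  have h : ∀ v, M.tgen i * triple (M.gen R) v = -(triple (M.gen R) v * M.tgen i) := fun v => by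
    unfold triple
    rw [← mul_assoc, ← mul_assoc, M.tgen_mul_gen, neg_mul, mul_assoc (M.gen R (v 0)),
      M.tgen_mul_gen, mul_neg, neg_mul, neg_mul, neg_neg, mul_assoc, mul_assoc (M.gen R (v 1)),
      M.tgen_mul_gen]
    simp only [mul_neg, mul_assoc]
  unfold cliffSlash skew
  simp only [mul_smul_comm, smul_mul_assoc, Finset.mul_sum, Finset.sum_mul, h, smul_neg,
    Finset.sum_neg_distrib]

/-- A transversal generator commutes with the projector, so only terms linear in the shear survive.
It anticommutes with both parts of the shear; the 3-form is self-adjoint and cancels, the vector is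
skew self-adjoint and doubles. -/
theorem shearForm_tgen (v : Fin 6 → R) (T : (Fin 3 → Fin 6) → R) (i : Fin 5) :
    M.shearForm (∑ a, v a • M.gen R a + cliffSlash (M.gen R) T) (M.tgen i) =
      (2 : ℝ) • (M.form R * (M.tgen i * ∑ a, v a • (M.gen R a * M.proj R))) := by
  have hU : (∑ a, v a • M.gen R a).transpose * M.form R =
      -(M.form R * ∑ a, v a • M.gen R a) := by
    simp only [Matrix.transpose_sum, Matrix.transpose_smul, Finset.sum_mul, Finset.mul_sum,
      smul_mul_assoc, mul_smul_comm, M.transpose_gen_mul_form, smul_neg, Finset.sum_neg_distrib]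
  have hN : (∑ a, v a • M.gen R a + cliffSlash (M.gen R) T).transpose * M.form R =
      M.form R * (-(∑ a, v a • M.gen R a) + cliffSlash (M.gen R) T) := by
    rw [Matrix.transpose_add, add_mul, hU, M.transpose_cliffSlash_mul_form, mul_add, mul_neg]
  rw [M.shearForm_eq hN, ← mul_smul_comm]
  congr 1
  have hS := (M.isChiral_gen R).cliffSlash_mul T
  have hUp : (∑ a, v a • M.gen R a) * M.proj R = (1 - M.proj R) * ∑ a, v a • M.gen R a := by
    simp only [Finset.sum_mul, Finset.mul_sum, smul_mul_assoc, mul_smul_comm,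
      (M.isChiral_gen R).exchange]
  have hUs : ∑ a, v a • (M.gen R a * M.proj R) = (∑ a, v a • M.gen R a) * M.proj R := by
    simp only [Finset.sum_mul, smul_mul_assoc]
  have hx := M.tgen_mul_proj (R := R) i
  have hxS := M.tgen_mul_cliffSlash i T
  have hxU : M.tgen i * (∑ a, v a • M.gen R a) = -((∑ a, v a • M.gen R a) * M.tgen i) := by
    simp only [Finset.sum_mul, Finset.mul_sum, smul_mul_assoc, mul_smul_comm, M.tgen_mul_gen,
      smul_neg, Finset.sum_neg_distrib]
  have hpp := M.compl_mul_proj (R := R)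
  have hqq := M.compl_mul_compl (R := R)
  rw [hUs]
  set S := cliffSlash (M.gen R) T
  set p := M.proj R
  set U := ∑ a, v a • M.gen R a
  set x := M.tgen (R := R) i
  have hx' : x * (1 - p) = (1 - p) * x := by rw [mul_sub, hx]; noncomm_ring
  have hN1 : (U + S) * p = (1 - p) * (U + S) := by rw [add_mul, hUp, hS, mul_add]
  have hN2 : (-U + S) * (1 - p) = p * (-U + S) := by
    have : (-U + S) * p = (1 - p) * (-U + S) := by rw [add_mul, neg_mul, hUp, hS]; noncomm_ring
    rw [mul_sub, this]; noncomm_ring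
  have h1 : (1 - p) * x * p = 0 := by rw [mul_assoc, hx, ← mul_assoc, hpp, zero_mul]
  have h4 : (1 - p) * ((-U + S) * x * (U + S) * p) = 0 := by
    rw [mul_assoc _ (U + S), hN1, ← mul_assoc _ (1 - p), mul_assoc _ x, hx', ← mul_assoc _ _ x, hN2,
      ← mul_assoc, ← mul_assoc, ← mul_assoc, hpp, zero_mul, zero_mul, zero_mul]
  have h2 : (-U + S) * x * p + x * (U + S) * p = (2 : ℝ) • (x * (U * p)) := by
    rw [mul_add, hxS, add_mul, neg_mul, add_mul, add_mul, neg_mul, neg_mul]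
    have : U * x = -(x * U) := by rw [hxU, neg_neg]
    rw [this, neg_mul, neg_neg, two_smul, mul_assoc x]
    abel
  have h3 : (1 - p) * ((2 : ℝ) • (x * (U * p))) = (2 : ℝ) • (x * (U * p)) := by
    rw [mul_smul_comm, ← mul_assoc, ← hx', mul_assoc, hUp, ← mul_assoc (1 - p), hqq]
  have h5 : (1 - p) * ((1 + (-U + S)) * x * (1 + (U + S))) * p = (1 - p) * x * p +
      (1 - p) * ((-U + S) * x * p + x * (U + S) * p) +
      (1 - p) * ((-U + S) * x * (U + S) * p) := by noncomm_ring
  rw [h5, h1, h4, h2, h3, zero_add, add_zero]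

theorem transpose_form_tgen_gen_proj (i : Fin 5) (a : Fin 6) :
    (M.form R * (M.tgen i * (M.gen R a * M.proj R))).transpose =
      M.form R * (M.tgen i * (M.gen R a * M.proj R)) := by
  rw [Matrix.transpose_mul, Matrix.transpose_mul, Matrix.transpose_mul, M.transpose_form, mul_neg,
    mul_assoc, M.transpose_tgen_mul_form, mul_neg, neg_neg, mul_assoc, ← mul_assoc _ (M.form R),
    M.transpose_gen_mul_form, neg_mul, mul_neg, mul_assoc, ← mul_assoc, M.transpose_proj_mul_form,
    ← mul_assoc (M.tgen i), M.tgen_mul_gen, neg_mul, mul_neg, mul_assoc (M.gen R a),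
    M.tgen_mul_proj, ← mul_assoc (M.gen R a), (M.isChiral_gen R).exchange]
  simp only [mul_assoc]

end MajoranaRep

end

noncomputable section

set_option linter.unusedSectionVars false

/-! ## The odd part of the tangential Clifford algebra -/

section ChiralSpan

variable {R : Type*} [CommRing R] [Algebra ℝ R]

theorem hodgeStar_add {A : Type*} [AddCommGroup A] [Module ℝ A] (T T' : (Fin 3 → Fin 6) → A) :
    hodgeStar (T + T') = hodgeStar T + hodgeStar T' := by
  funext v
  simp [hodgeStar, Finset.sum_add_distrib, smul_add]

theorem hodgeStar_smul (r : R) (T : (Fin 3 → Fin 6) → R) : hodgeStar (r • T) = r • hodgeStar T := by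
  funext v
  simp only [hodgeStar, Pi.smul_apply, Finset.smul_sum]
  refine Finset.sum_congr rfl fun w _ => ?_
  rw [smul_comm r, smul_comm r]

theorem IsSkew.add {n : ℕ} {ι A : Type*} [AddCommGroup A] {T T' : (Fin n → ι) → A} (h : IsSkew T)
    (h' : IsSkew T') : IsSkew (T + T') := fun v σ => by
  simp [h v σ, h' v σ, smul_add]

theorem IsSkew.smul {n : ℕ} {ι : Type*} {T : (Fin n → ι) → R} (h : IsSkew T) (r : R) :
    IsSkew (r • T) := fun v σ => by
  simp only [Pi.smul_apply, h v σ]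
  rw [smul_comm]

variable {𝔐 : Type*} [Ring 𝔐] [Algebra R 𝔐] [Algebra ℝ 𝔐] [IsScalarTower ℝ R 𝔐]

theorem cliffSlash_add (g : Fin 6 → 𝔐) (T T' : (Fin 3 → Fin 6) → R) :
    cliffSlash g (T + T') = cliffSlash g T + cliffSlash g T' := by
  simp [cliffSlash, smul_add, add_smul, Finset.sum_add_distrib]

theorem cliffSlash_smul (g : Fin 6 → 𝔐) (r : R) (T : (Fin 3 → Fin 6) → R) :
    cliffSlash g (r • T) = r • cliffSlash g T := by
  simp only [cliffSlash, Pi.smul_apply, Finset.smul_sum]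
  refine Finset.sum_congr rfl fun v _ => ?_
  rw [smul_comm r, smul_comm (eta3 v) r, smul_assoc]

/-- Sums of a vector and a self-dual 3-form in the Clifford algebra, times the projector. -/
def chiralSpan (R : Type*) [CommRing R] [Algebra ℝ R] [Algebra R 𝔐] [IsScalarTower ℝ R 𝔐]
    (g : Fin 6 → 𝔐) (p : 𝔐) : Submodule R 𝔐 where
  carrier := {X | ∃ (v : Fin 6 → R) (T : (Fin 3 → Fin 6) → R), IsSkew T ∧ hodgeStar T = T ∧
    X = (∑ a, v a • g a + cliffSlash g T) * p}
  zero_mem' := ⟨0, 0, fun v σ => by simp, by funext v; simp [hodgeStar], by simp [cliffSlash]⟩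
  add_mem' := by
    rintro _ _ ⟨v, T, hs, hT, rfl⟩ ⟨v', T', hs', hT', rfl⟩
    refine ⟨v + v', T + T', hs.add hs', by rw [hodgeStar_add, hT, hT'], ?_⟩
    rw [cliffSlash_add]
    simp only [Pi.add_apply, add_smul, Finset.sum_add_distrib, ← add_mul]
    congr 1
    abel
  smul_mem' := by
    rintro r _ ⟨v, T, hs, hT, rfl⟩
    refine ⟨r • v, r • T, hs.smul r, by rw [hodgeStar_smul, hT], ?_⟩
    rw [cliffSlash_smul]
    simp only [Pi.smul_apply, smul_eq_mul, mul_smul, ← Finset.smul_sum, ← smul_add, smul_mul_assoc]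

variable {g : Fin 6 → 𝔐} {p : 𝔐}

theorem gen_mem_chiralSpan (a : Fin 6) : g a * p ∈ chiralSpan R g p :=
  ⟨Pi.single a 1, 0, fun v σ => by simp, by funext v; simp [hodgeStar], by
    simp [cliffSlash, Pi.single_apply]⟩

theorem real_smul_mem_chiralSpan (r : ℝ) {x : 𝔐} (h : x ∈ chiralSpan R g p) :
    r • x ∈ chiralSpan R g p := by
  rw [← one_smul R x, ← smul_assoc]
  exact Submodule.smul_mem _ _ h

/-- On the image of `p` the volume element is `1`, so a 3-form and its dual act alike there and a
3-form may be replaced by its self-dual part. -/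
theorem IsChiral.skew_triple_mem (h : IsChiral g p) (v : Fin 3 → Fin 6) :
    skew (triple g) v * p ∈ chiralSpan R g p := by
  -- The factor `6 η` undoes the normalization `1/3!` and the raising of indices.
  let t : (Fin 3 → Fin 6) → R := fun w => if w = v then algebraMap ℝ R (6 * eta3 v) else 0
  have ht : cliffSlash g t = skew (triple g) v := by
    unfold cliffSlash
    rw [Finset.sum_eq_single v]
    · simp only [t, if_true]
      rw [← Algebra.algebraMap_eq_smul_one (6 * eta3 v) |>.symm, smul_smul, smul_assoc, one_smul,
        smul_smul]
      have : (6⁻¹ : ℝ) * (eta3 v * (6 * eta3 v)) = 1 := by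
        linear_combination eta3_mul_self v
      rw [this, one_smul]
    · intro w _ hw
      simp [t, hw]
    · simp
  let u := hodgeStar t
  have hu : IsSkew u := isSkew_hodgeStar t
  -- `t` is not skew; its double dual takes the place of its skew-symmetrization.
  let s := hodgeStar u
  have hs : IsSkew s := isSkew_hodgeStar u
  have hsu : hodgeStar s = u := hodgeStar_hodgeStar hu
  have e1 : cliffSlash g u * p = skew (triple g) v * p := by
    rw [h.clifford.cliffSlash_hodgeStar, ht, mul_assoc, h.volume]
  have e2 : cliffSlash g s * p = skew (triple g) v * p := by
    rw [h.clifford.cliffSlash_hodgeStar, mul_assoc, h.volume, e1]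
  have hmem : (cliffSlash g (s + u)) * p ∈ chiralSpan R g p :=
    ⟨0, s + u, hs.add hu, by rw [hodgeStar_add, hsu, add_comm], by simp⟩
  rw [cliffSlash_add, add_mul, e1, e2] at hmem
  have := real_smul_mem_chiralSpan (1 / 2 : ℝ) hmem
  rwa [← two_smul ℝ, smul_smul, one_div, inv_mul_cancel₀ two_ne_zero, one_smul] at this

theorem IsChiral.three_mem (h : IsChiral g p) (a b c : Fin 6) :
    g a * g b * g c * p ∈ chiralSpan R g p := by
  have hg := h.clifford
  by_cases hab : a = b
  · rw [hab, hg.sq, smul_mul_assoc, one_mul, smul_mul_assoc]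
    exact real_smul_mem_chiralSpan _ (gen_mem_chiralSpan c)
  by_cases hbc : b = c
  · rw [hbc, mul_assoc (g a), hg.sq, mul_smul_comm, mul_one, smul_mul_assoc]
    exact real_smul_mem_chiralSpan _ (gen_mem_chiralSpan a)
  by_cases hac : a = c
  · rw [← hac, mul_assoc (g a), hg.anticomm (Ne.symm hab), mul_neg, ← mul_assoc, hg.sq,
      smul_mul_assoc, one_mul, neg_mul, smul_mul_assoc]
    exact Submodule.neg_mem _ (real_smul_mem_chiralSpan _ (gen_mem_chiralSpan b))
  have hinj : Function.Injective ![a, b, c] := by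
    intro i j hij
    fin_cases i <;> fin_cases j <;> simp_all
  have := h.skew_triple_mem (R := R) ![a, b, c]
  rwa [hg.skew_triple hinj] at this

/-- On the image of `p` a generator times a self-dual 3-form is a contraction, hence quadratic in
the generators. One more generator gives at most three, so forms of higher degree never arise. -/
theorem IsChiral.pair_mul_mem (h : IsChiral g p) (a b : Fin 6) {X : 𝔐}
    (hX : X ∈ chiralSpan R g p) : g a * g b * X ∈ chiralSpan R g p := by
  obtain ⟨v, T, hs, hT, rfl⟩ := hX
  rw [add_mul, mul_add, Finset.sum_mul, Finset.mul_sum, ← mul_assoc, mul_assoc (g a) (g b),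
    mul_assoc (g a), h.mul_cliffSlash_mul hs hT, cliffContract, Finset.sum_mul, Finset.mul_sum]
  refine Submodule.add_mem _ (Submodule.sum_mem _ fun c _ => ?_) (Submodule.sum_mem _ fun c _ => ?_)
  · rw [smul_mul_assoc, mul_smul_comm, ← mul_assoc]
    exact Submodule.smul_mem _ _ (h.three_mem a b c)
  · rw [Finset.sum_mul, Finset.mul_sum]
    refine Submodule.sum_mem _ fun d _ => ?_
    rw [smul_mul_assoc, mul_smul_comm, ← mul_assoc, ← mul_assoc]
    exact Submodule.smul_mem _ _ (h.three_mem a c d)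

/-- The two alternatives are even and odd length; the induction strips two generators at a time. -/
theorem IsChiral.even_or_odd (h : IsChiral g p) (l : List (Fin 6)) :
    (l.map g).prod * p = p * (l.map g).prod ∨
      ((l.map g).prod * p ∈ chiralSpan R g p ∧
        (l.map g).prod * p = (1 - p) * (l.map g).prod) := by
  suffices H : ∀ n (l : List (Fin 6)), l.length ≤ n → ((l.map g).prod * p = p * (l.map g).prod ∨
      ((l.map g).prod * p ∈ chiralSpan R g p ∧
        (l.map g).prod * p = (1 - p) * (l.map g).prod)) from H _ l le_rfl
  intro n
  induction n with
  | zero =>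
    intro l hl
    rw [List.length_eq_zero_iff.1 (Nat.le_zero.1 hl)]
    left; simp
  | succ n ih =>
    intro l hl
    match l, hl with
    | [], _ => left; simp
    | [a], _ =>
      right
      simp only [List.map_cons, List.map_nil, List.prod_cons, List.prod_nil, mul_one]
      exact ⟨gen_mem_chiralSpan a, h.exchange a⟩
    | a :: b :: l, hl =>
      simp only [List.length_cons] at hl
      simp only [List.map_cons, List.prod_cons, ← mul_assoc]
      have e1 : g a * g b * p = p * (g a * g b) := by
        rw [mul_assoc, h.exchange, ← mul_assoc, h.exchange', mul_assoc]
      rcases ih l (by omega) with hl' | ⟨hl', hl''⟩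
      · left
        rw [mul_assoc, hl', ← mul_assoc, e1]
        simp only [mul_assoc]
      · right
        rw [mul_assoc (g a * g b)]
        refine ⟨h.pair_mul_mem a b hl', ?_⟩
        rw [hl'', ← mul_assoc, mul_sub, e1]
        noncomm_ring

end ChiralSpan

/-! ## Completeness of the Clifford algebra -/

namespace MajoranaRep

variable (M : MajoranaRep)

/-- Ordered products of the first ten Clifford generators. -/
def word (J : Finset (Fin 10)) : Matrix (Fin 32) (Fin 32) ℝ :=
  (List.ofFn fun a : Fin 10 => if a ∈ J then M.Γ a.castSucc else 1).prod

/-- The sign by which a generator commutes with an ordered product. -/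
def wordSign (b : Fin 10) (J : Finset (Fin 10)) : ℝ := (-1) ^ J.card * if b ∈ J then -1 else 1

theorem prod_ite_neg_one (J : Finset (Fin 10)) :
    (∏ a : Fin 10, if a ∈ J then (-1 : ℝ) else 1) = (-1) ^ J.card := by
  rw [Finset.prod_ite_mem, Finset.univ_inter, Finset.prod_const]

theorem Γ_mul_word (b : Fin 10) (J : Finset (Fin 10)) :
    M.Γ b.castSucc * M.word J = wordSign b J • (M.word J * M.Γ b.castSucc) := by
  unfold word
  rw [mul_prod_ofFn _ _ (fun a => (if a ∈ J then -1 else 1) *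
    if a = b then (if a ∈ J then -1 else 1) else 1)]
  · rw [Finset.prod_mul_distrib, prod_ite_neg_one, Finset.prod_ite_eq', if_pos (Finset.mem_univ b)]
    rfl
  · intro a
    by_cases ha : a ∈ J
    · by_cases hab : a = b
      · subst hab; simp [ha]
      · simp only [ha, hab, if_true, if_false, mul_one, neg_smul, one_smul]
        exact M.anticomm fun h => hab (Fin.castSucc_injective _ h).symm
    · simp [ha]

theorem Γ_last_mul_word (J : Finset (Fin 10)) :
    M.Γ (Fin.last 10) * M.word J = ((-1 : ℝ) ^ J.card) • (M.word J * M.Γ (Fin.last 10)) := by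
  unfold word
  rw [mul_prod_ofFn _ _ (fun a => if a ∈ J then -1 else 1), prod_ite_neg_one]
  intro a
  by_cases ha : a ∈ J
  · simp only [ha, if_true, neg_smul, one_smul]
    exact M.anticomm (Fin.castSucc_lt_last a).ne'
  · simp [ha]

theorem neg_one_pow_mul_self (n : ℕ) : (-1 : ℝ) ^ n * (-1) ^ n = 1 := by
  rw [← mul_pow]; simp

/-- If all signs agreed, their product over the ten generators would give equal parities of the
cardinalities, ten being even; with equal parities each sign decides membership of `b`. -/
theorem exists_wordSign_mul_eq {J J' : Finset (Fin 10)} (h : J ≠ J') :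
    ∃ b, wordSign b J * wordSign b J' = -1 := by
  by_contra! hne
  have hpm : ∀ b J, wordSign b J = 1 ∨ wordSign b J = -1 := fun b J => by
    unfold wordSign
    rcases neg_one_pow_eq_or ℝ J.card with h | h <;> rw [h] <;> split <;> simp
  have heq : ∀ b, wordSign b J = wordSign b J' := fun b => by
    have := hne b
    rcases hpm b J with h1 | h1 <;> rcases hpm b J' with h2 | h2 <;> rw [h1, h2] at this ⊢ <;>
      norm_num at this
  have hprod : ∀ J, ∏ b, wordSign b J = (-1) ^ J.card := fun J => by
    unfold wordSign
    have h10 : ((-1 : ℝ) ^ J.card) ^ 10 = 1 := by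
      rw [← pow_mul]; exact Even.neg_one_pow ⟨J.card * 5, by ring⟩
    rw [Finset.prod_mul_distrib, prod_ite_neg_one, Finset.prod_const, Finset.card_univ,
      Fintype.card_fin, h10, one_mul]
  have hc : (-1 : ℝ) ^ J.card = (-1) ^ J'.card := by
    rw [← hprod, ← hprod]; exact Finset.prod_congr rfl fun b _ => heq b
  apply h
  ext b
  have := heq b
  unfold wordSign at this
  rw [hc] at this
  have h1 := mul_left_cancel₀ (pow_ne_zero _ (by norm_num : (-1 : ℝ) ≠ 0)) this
  by_cases hb : b ∈ J <;> by_cases hb' : b ∈ J' <;> simp [hb, hb'] at h1 ⊢ <;> norm_num at h1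

theorem isUnit_word (J : Finset (Fin 10)) : IsUnit (M.word J) := by
  refine List.prod_isUnit fun x hx => ?_
  obtain ⟨a, rfl⟩ := (List.mem_ofFn' _ _).1 hx
  dsimp only
  split
  · exact M.isUnit_Γ _
  · exact isUnit_one

theorem inv_word_mul_word (J : Finset (Fin 10)) : (M.word J)⁻¹ * M.word J = 1 :=
  Matrix.nonsing_inv_mul _ ((Matrix.isUnit_iff_isUnit_det _).1 (M.isUnit_word J))

theorem word_mul_inv_word (J : Finset (Fin 10)) : M.word J * (M.word J)⁻¹ = 1 :=
  Matrix.mul_nonsing_inv _ ((Matrix.isUnit_iff_isUnit_det _).1 (M.isUnit_word J))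

theorem mul_inv_word {x : Matrix (Fin 32) (Fin 32) ℝ} {J : Finset (Fin 10)} {s : ℝ}
    (h : x * M.word J = s • (M.word J * x)) :
    (M.word J)⁻¹ * x = s • (x * (M.word J)⁻¹) := by
  have := congrArg (fun y => (M.word J)⁻¹ * y * (M.word J)⁻¹) h
  simp only [mul_smul_comm, smul_mul_assoc] at this
  rw [← mul_assoc, mul_assoc, M.word_mul_inv_word, mul_one, ← mul_assoc (M.word J)⁻¹,
    M.inv_word_mul_word, one_mul] at this
  exact this

/-- Some generator anticommutes with this product, and the trace is invariant under conjugation by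
it. -/
theorem trace_inv_word_mul_word {J J' : Finset (Fin 10)} (h : J ≠ J') :
    ((M.word J)⁻¹ * M.word J').trace = 0 := by
  obtain ⟨b, hb⟩ := exists_wordSign_mul_eq h
  set x := M.Γ b.castSucc
  have h1 := M.mul_inv_word (M.Γ_mul_word b J)
  have h2 := M.Γ_mul_word b J'
  set Y := (M.word J)⁻¹ * M.word J'
  have h3 : Y * x = -(x * Y) := by
    have hs : wordSign b J' * wordSign b J' = 1 := by
      unfold wordSign
      rw [mul_mul_mul_comm, neg_one_pow_mul_self]; split <;> simp
    have h4 : M.word J' * x = wordSign b J' • (x * M.word J') := by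
      rw [h2, smul_smul, hs, one_smul]
    simp only [Y, x] at h4 ⊢
    rw [mul_assoc, h4, mul_smul_comm, ← mul_assoc, h1, smul_mul_assoc, smul_smul, mul_comm, hb,
      neg_smul, one_smul, mul_assoc]
  have h5 : (Y * x * (eta b.castSucc • x)).trace = Y.trace := by
    rw [mul_assoc, mul_smul_comm, M.sq, smul_smul, eta_mul_self, one_smul, mul_one]
  have h6 : (Y * x * (eta b.castSucc • x)).trace = -Y.trace := by
    rw [h3, neg_mul, Matrix.trace_neg, Matrix.trace_mul_comm, ← mul_assoc, smul_mul_assoc, M.sq,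
      smul_smul, eta_mul_self, one_smul, one_mul]
  linarith

theorem linearIndependent_word : LinearIndependent ℝ M.word := by
  rw [linearIndependent_iff']
  intro s c hc J hJ
  have h1 := congrArg (fun X => ((M.word J)⁻¹ * X).trace) hc
  simp only [Finset.mul_sum, mul_smul_comm, mul_zero, Matrix.trace_sum, Matrix.trace_smul,
    Matrix.trace_zero] at h1
  rw [Finset.sum_eq_single J] at h1
  · rw [M.inv_word_mul_word, Matrix.trace_one, smul_eq_mul] at h1
    exact (mul_eq_zero.1 h1).resolve_right (by simp)
  · intro J' _ hJ'
    rw [M.trace_inv_word_mul_word hJ'.symm, smul_zero]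
  · exact fun h => absurd hJ h

/-- There are `2 ^ 10 = 32 ^ 2` independent words. -/
theorem span_word : Submodule.span ℝ (Set.range M.word) = ⊤ :=
  M.linearIndependent_word.span_eq_top_of_card_eq_finrank' (by
    rw [Module.finrank_matrix]; simp)

variable {R : Type*} [CommRing R] [Algebra ℝ R]

/-- The expansions of the real matrix units are extended linearly to coefficients in `R`. -/
theorem exists_eq_sum_word (N : Matrix (Fin 32) (Fin 32) R) :
    ∃ c : Finset (Fin 10) → R, N = ∑ J, c J • realMatrix R (M.word J) := by
  have h : ∀ X : Matrix (Fin 32) (Fin 32) ℝ, ∃ c : Finset (Fin 10) → ℝ, ∑ J, c J • M.word J = X :=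
    fun X => by
      have : X ∈ Submodule.span ℝ (Set.range M.word) := by rw [M.span_word]; trivial
      exact (Submodule.mem_span_range_iff_exists_fun ℝ).1 this
  choose c hc using fun α β => h (Matrix.single α β 1)
  refine ⟨fun J => ∑ α, ∑ β, N α β * algebraMap ℝ R (c α β J), ?_⟩
  ext γ δ
  have h2 : ∀ α β, ∑ J, algebraMap ℝ R (c α β J) * algebraMap ℝ R (M.word J γ δ) =
      if α = γ ∧ β = δ then 1 else 0 := fun α β => by
    have := congrFun (congrFun (hc α β) γ) δ
    simp only [Matrix.sum_apply, Matrix.smul_apply, smul_eq_mul, Matrix.single_apply] at this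
    rw [Finset.sum_congr rfl fun J _ => (map_mul (algebraMap ℝ R) _ _).symm, ← map_sum, this]
    split <;> simp
  simp only [Matrix.sum_apply, Matrix.smul_apply, smul_eq_mul, realMatrix_apply, Finset.sum_mul,
    mul_assoc]
  rw [Finset.sum_comm, Finset.sum_congr rfl fun α _ => Finset.sum_comm]
  simp only [← Finset.mul_sum, h2]
  rw [Finset.sum_eq_single γ, Finset.sum_eq_single δ]
  · simp
  · intro β _ h; simp [h]
  · simp
  · intro α _ h; simp [h]
  · simp

/-- Conjugation by `x = Γ_b Γ_last` fixes `N` but reverses every word that contains `b`, the last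
generator not occurring in words. Pairing with the inverse word by the trace isolates `c J`, which
is then its own negative. -/
theorem coeff_eq_zero {N : Matrix (Fin 32) (Fin 32) R} {c : Finset (Fin 10) → R}
    (hN : N = ∑ J, c J • realMatrix R (M.word J)) {b : Fin 10}
    (hb : realMatrix R (M.Γ b.castSucc * M.Γ (Fin.last 10)) * N =
      N * realMatrix R (M.Γ b.castSucc * M.Γ (Fin.last 10)))
    (heta : eta b.castSucc = 1) {J : Finset (Fin 10)} (hJ : b ∈ J) : c J = 0 := by
  set x := M.Γ b.castSucc * M.Γ (Fin.last 10) with hx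
  have hxx : x * x = -1 := by
    rw [hx, mul_assoc, ← mul_assoc (M.Γ (Fin.last 10)),
      M.anticomm (Fin.castSucc_lt_last b).ne', neg_mul, mul_neg, mul_assoc, M.sq, ← mul_assoc, M.sq,
      heta]
    simp [eta]
  have hxW : x * M.word J = (-1 : ℝ) • (M.word J * x) := by
    rw [hx, mul_assoc, M.Γ_last_mul_word, mul_smul_comm, ← mul_assoc, M.Γ_mul_word, smul_mul_assoc,
      smul_smul, mul_assoc]
    congr 1
    rw [wordSign, if_pos hJ, ← mul_assoc, neg_one_pow_mul_self, one_mul]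
  have hW := M.mul_inv_word hxW
  set W := realMatrix R (M.word J)⁻¹ with hWdef
  set X := realMatrix R x with hXdef
  have hWX : W * X = -(X * W) := by
    rw [hWdef, hXdef, ← map_mul, hW, ← map_mul, neg_smul, one_smul, map_neg]
  have hXX : X * X = -1 := by rw [hXdef, ← map_mul, hxx, map_neg, map_one]
  have h1 : (W * N).trace = (32 : R) * c J := by
    rw [hN, Finset.mul_sum, Matrix.trace_sum, Finset.sum_eq_single J]
    · rw [mul_smul_comm, hWdef, ← map_mul, M.inv_word_mul_word, map_one, Matrix.trace_smul,
        Matrix.trace_one]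
      simp [mul_comm]
    · intro J' _ hJ'
      rw [mul_smul_comm, hWdef, ← map_mul, Matrix.trace_smul, trace_realMatrix,
        M.trace_inv_word_mul_word hJ'.symm]
      simp
    · simp
  have h2 : (W * N * X * X).trace = -(W * N).trace := by
    rw [mul_assoc, hXX, mul_neg_one, Matrix.trace_neg]
  have h3 : (W * N * X * X).trace = (W * N).trace := by
    rw [Matrix.trace_mul_comm, ← mul_assoc, ← mul_assoc]
    have : X * W = -(W * X) := by rw [hWX, neg_neg]
    rw [this, neg_mul, neg_mul, mul_assoc W, hb, mul_assoc, mul_assoc, hXX]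
    simp
  rw [h2, h1] at h3
  have h4 : (64 : ℝ) • c J = 0 := by
    have : (64 : ℝ) • c J = (64 : R) * c J := by
      rw [Algebra.smul_def, map_ofNat]
    rw [this]
    linear_combination -h3
  exact (smul_eq_zero.1 h4).resolve_left (by norm_num)

theorem exists_list_of_prod {g : Fin 6 → Matrix (Fin 32) (Fin 32) R}
    (l : List (Matrix (Fin 32) (Fin 32) R)) (hl : ∀ x ∈ l, x = 1 ∨ ∃ a, x = g a) :
    ∃ L : List (Fin 6), l.prod = (L.map g).prod := by
  induction l with
  | nil => exact ⟨[], by simp⟩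
  | cons x l ih =>
    obtain ⟨L, hL⟩ := ih fun y hy => hl y (List.mem_cons_of_mem x hy)
    rcases hl x List.mem_cons_self with rfl | ⟨a, rfl⟩
    · exact ⟨L, by rw [List.prod_cons, one_mul, hL]⟩
    · exact ⟨a :: L, by rw [List.prod_cons, hL]; simp⟩

/-- A linear map from the image of `P` to that of `1 - P` commuting with `Spin(5)` is a sum of a
vector and a self-dual 3-form. -/
theorem mem_chiralSpan {N : Matrix (Fin 32) (Fin 32) R} (hN : (1 - M.proj R) * N * M.proj R = N)
    (hcomm : ∀ i j : Fin 5, i ≠ j → M.tgen i * M.tgen j * N = N * (M.tgen i * M.tgen j)) :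
    N ∈ chiralSpan R (M.gen R) (M.proj R) := by
  obtain ⟨c, hc⟩ := M.exists_eq_sum_word N
  -- The letters `6, …, 9` of the words are the first four transversal generators; the fifth is
  -- `Γ_last`, and it serves as their partner.
  have hz : ∀ J : Finset (Fin 10), (∃ b ∈ J, 6 ≤ b.val) → c J = 0 := fun J ⟨b, hbJ, hb⟩ => by
    have e1 : transv ⟨b.val - 6, by omega⟩ = b.castSucc := by
      ext; simp [transv]; omega
    have e2 : transv 4 = Fin.last 10 := rfl
    have e3 : (⟨b.val - 6, by omega⟩ : Fin 5) ≠ 4 := by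
      intro h
      have := congrArg Fin.val h
      simp at this
      omega
    refine M.coeff_eq_zero hc (b := b) ?_ ?_ hbJ
    · have := hcomm _ _ e3
      unfold tgen at this
      rw [e1, e2] at this
      rw [map_mul]
      exact this
    · rw [← e1, eta_transv]
  rw [← hN, hc, Finset.mul_sum, Finset.sum_mul]
  refine Submodule.sum_mem _ fun J _ => ?_
  rw [mul_smul_comm, smul_mul_assoc]
  by_cases hJ : ∃ b ∈ J, 6 ≤ b.val
  · rw [hz J hJ, zero_smul]; exact Submodule.zero_mem _
  refine Submodule.smul_mem _ _ ?_
  push Not at hJ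
  obtain ⟨L, hL⟩ : ∃ L : List (Fin 6), realMatrix R (M.word J) = (L.map (M.gen R)).prod := by
    rw [word, map_list_prod]
    refine exists_list_of_prod _ fun x hx => ?_
    obtain ⟨y, hy, rfl⟩ := List.mem_map.1 hx
    obtain ⟨a, rfl⟩ := (List.mem_ofFn' _ _).1 hy
    dsimp only
    by_cases ha : a ∈ J
    · right
      refine ⟨⟨a.val, hJ a ha⟩, ?_⟩
      rw [if_pos ha]
      rfl
    · left
      rw [if_neg ha, map_one]
  rw [hL]
  -- The compression by `1 - P` on the left and `P` on the right annihilates even products and keeps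
  -- odd ones.
  rcases (M.isChiral_gen R).even_or_odd (R := R) L with h | ⟨h1, h2⟩
  · rw [mul_assoc, h, ← mul_assoc, M.compl_mul_proj, zero_mul]
    exact Submodule.zero_mem _
  · rw [← h2, mul_assoc, M.proj_mul_proj]
    exact h1

end MajoranaRep

end

noncomputable section

universe u v w u' v'

/-! ## Superfunctions and coframe expansions -/

theorem exists_perm_of_image_eq {n : ℕ} {ι : Type*} [DecidableEq ι] {u w : Fin n → ι}
    (hu : Function.Injective u) (hw : Finset.univ.image w = Finset.univ.image u) :
    ∃ σ : Equiv.Perm (Fin n), u ∘ σ = w := by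
  have hex : ∀ x, ∃ y, u y = w x := fun x => by
    have : w x ∈ Finset.univ.image u := hw ▸ Finset.mem_image_of_mem w (Finset.mem_univ x)
    simpa using this
  choose τ hτ using hex
  have hsurj : Function.Surjective τ := fun y => by
    have : u y ∈ Finset.univ.image w := hw.symm ▸ Finset.mem_image_of_mem u (Finset.mem_univ y)
    obtain ⟨x, -, hx⟩ := Finset.mem_image.1 this
    exact ⟨x, hu (by rw [hτ, hx])⟩
  exact ⟨Equiv.ofBijective τ (Finite.surjective_iff_bijective.1 hsurj), funext hτ⟩

namespace SuperSpace

variable (Y : SuperSpace.{u, v})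

/-- Even superfunctions. -/
def even (U : Opens Y.body) : Subalgebra ℝ (Y.form U) where
  carrier := Y.gr U (0, 0)
  mul_mem' {a b} ha hb := by simpa using Y.mul_mem U (0, 0) (0, 0) a b ha hb
  add_mem' ha hb := Submodule.add_mem _ ha hb
  algebraMap_mem' r := by
    rw [Algebra.algebraMap_eq_smul_one]
    exact Submodule.smul_mem _ _ (Y.one_mem U)

variable {Y} {U V : Opens Y.body}

theorem even_mul_comm {f η : Y.form U} {i : ℕ × ZMod 2} (hf : f ∈ Y.gr U (0, 0))
    (hη : η ∈ Y.gr U i) : f * η = η * f := by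
  simpa using Y.supercomm U (0, 0) i f η hf hη

instance evenCommRing : CommRing (Y.even U) :=
  { (inferInstance : Ring (Y.even U)) with
    mul_comm := fun a b => Subtype.ext (even_mul_comm a.2 b.2) }

theorem even_smul_eq (f : Y.even U) (r : ℝ) : ((r • f : Y.even U) : Y.form U) = r • (f : Y.form U) :=
  rfl

/-- Restriction of even superfunctions. -/
def evenRes (h : V ≤ U) : Y.even U →ₐ[ℝ] Y.even V :=
  ((Y.res h).comp (Y.even U).val).codRestrict (Y.even V) fun f => Y.res_mem h _ _ f.2

theorem even_mem_functions {f : Y.form U} (hf : f ∈ Y.gr U (0, 0)) : f ∈ Y.functions U :=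
  Submodule.mem_sup_left hf

theorem odd_mem_functions {f : Y.form U} (hf : f ∈ Y.gr U (0, 1)) : f ∈ Y.functions U :=
  Submodule.mem_sup_right hf

theorem res_mem_functions (h : V ≤ U) {f : Y.form U} (hf : f ∈ Y.functions U) :
    Y.res h f ∈ Y.functions V := by
  obtain ⟨a, ha, b, hb, rfl⟩ := Submodule.mem_sup.1 hf
  rw [map_add]
  exact Submodule.add_mem_sup (Y.res_mem h _ _ ha) (Y.res_mem h _ _ hb)

theorem prod_ofFn_mem {n : ℕ} (f : Fin n → Y.form U) (d : Fin n → ℕ × ZMod 2)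
    (h : ∀ i, f i ∈ Y.gr U (d i)) : (List.ofFn f).prod ∈ Y.gr U (∑ i, d i) := by
  induction n with
  | zero =>
    simp only [List.ofFn_zero, List.prod_nil, Finset.univ_eq_empty, Finset.sum_empty]
    exact Y.one_mem U
  | succ n ih =>
    rw [List.ofFn_succ, List.prod_cons, Fin.sum_univ_succ]
    exact Y.mul_mem U _ _ _ _ (h 0) (ih _ _ fun i => h i.succ)

theorem pow_mem_gr {x : Y.form U} {d : ℕ × ZMod 2} (h : x ∈ Y.gr U d) (n : ℕ) :
    x ^ n ∈ Y.gr U (n • d) := by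
  induction n with
  | zero =>
    rw [pow_zero, zero_smul]
    exact Y.one_mem U
  | succ n ih =>
    rw [pow_succ, succ_nsmul]
    exact Y.mul_mem U _ _ _ _ ih h

variable {p q : ℕ} {e : Fin p → Y.form U} {ψ : Fin q → Y.form U}

/-- The product of the members of a coframe indexed by a finite set. -/
def wedge (e : Fin p → Y.form U) (s : Finset (Fin p)) : Y.form U :=
  (List.ofFn fun a => if a ∈ s then e a else 1).prod

/-- A commuting monomial. -/
def monomial (ψ : Fin q → Y.form U) (m : Fin q → ℕ) : Y.form U :=
  (List.ofFn fun α => ψ α ^ m α).prod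

/-- The product of a sequence of members of a coframe. -/
def wedgeSeq (e : Fin p → Y.form U) {n : ℕ} (w : Fin n → Fin p) : Y.form U :=
  (List.ofFn fun i => e (w i)).prod

theorem IsCoframe.res (h : Y.IsCoframe U e ψ) (hV : V ≤ U) :
    Y.IsCoframe V (fun a => Y.res hV (e a)) (fun α => Y.res hV (ψ α)) := by
  refine ⟨fun a => Y.res_mem hV _ _ (h.1 a), fun α => Y.res_mem hV _ _ (h.2.1 α), ?_⟩
  intro W hW η
  simp only [Y.res_res]
  exact h.2.2 W (hW.trans hV) η

theorem IsCoframe.expand (h : Y.IsCoframe U e ψ) (η : Y.form U) :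
    ∃! c : (Finset (Fin p) × (Fin q → ℕ)) →₀ Y.form U, (∀ i, c i ∈ Y.functions U) ∧
      η = c.sum fun i f => frameMonomial e ψ i * f := by
  have := h.2.2 U le_rfl η
  simpa only [Y.res_self] using this

theorem IsCoframe.coeff_eq (h : Y.IsCoframe U e ψ) {η : Y.form U}
    {c : (Finset (Fin p) × (Fin q → ℕ)) →₀ Y.form U} (hc : ∀ i, c i ∈ Y.functions U)
    (hη : η = c.sum fun i f => frameMonomial e ψ i * f) (i : Finset (Fin p) × (Fin q → ℕ)) :
    coframeCoeff h η i = c i := by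
  unfold coframeCoeff
  have h1 := (h.2.2 U le_rfl η).choose_spec.1
  have h2 : (h.2.2 U le_rfl η).choose = c := by
    refine (h.expand η).unique ?_ ⟨hc, hη⟩
    simpa only [Y.res_self] using h1
  rw [h2]

theorem IsCoframe.coeff_mem (h : Y.IsCoframe U e ψ) (η : Y.form U)
    (i : Finset (Fin p) × (Fin q → ℕ)) : coframeCoeff h η i ∈ Y.functions U :=
  (h.2.2 U le_rfl η).choose_spec.1.1 i

theorem IsCoframe.coeff_neg (h : Y.IsCoframe U e ψ) (η : Y.form U)
    (i : Finset (Fin p) × (Fin q → ℕ)) : coframeCoeff h (-η) i = -coframeCoeff h η i := by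
  obtain ⟨c, ⟨hc, hη⟩, -⟩ := h.expand η
  rw [h.coeff_eq hc hη, h.coeff_eq (c := -c)]
  · rfl
  · exact fun i => Submodule.neg_mem _ (hc i)
  · rw [Finsupp.sum_neg_index (fun i => mul_zero _), hη]
    simp [Finsupp.sum]

theorem IsCoframe.eq_zero (h : Y.IsCoframe U e ψ)
    {c : (Finset (Fin p) × (Fin q → ℕ)) →₀ Y.form U} (hc : ∀ i, c i ∈ Y.functions U)
    (h0 : (c.sum fun i f => frameMonomial e ψ i * f) = 0) : c = 0 :=
  (h.expand 0).unique ⟨hc, h0.symm⟩ ⟨fun _ => Submodule.zero_mem _, by simp⟩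

/-- Polynomials in the odd coframe members with superfunction coefficients. -/
def oddPoly (ψ : Fin q → Y.form U) : Submodule ℝ (Y.form U) :=
  Submodule.span ℝ {x | ∃ m f, f ∈ Y.functions U ∧ x = monomial ψ m * f}

theorem exists_of_mem_oddPoly {x : Y.form U} (hx : x ∈ oddPoly ψ) :
    ∃ c : (Fin q → ℕ) →₀ Y.form U, (∀ m, c m ∈ Y.functions U) ∧
      x = c.sum fun m f => monomial ψ m * f := by
  induction hx using Submodule.span_induction with
  | mem x hx =>
    obtain ⟨m, f, hf, rfl⟩ := hx
    refine ⟨Finsupp.single m f, fun m' => ?_, by simp⟩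
    rw [Finsupp.single_apply]
    split
    · exact hf
    · exact Submodule.zero_mem _
  | zero => exact ⟨0, fun _ => Submodule.zero_mem _, by simp⟩
  | add x y _ _ hx hy =>
    obtain ⟨c, hc, rfl⟩ := hx
    obtain ⟨c', hc', rfl⟩ := hy
    refine ⟨c + c', fun m => Submodule.add_mem _ (hc m) (hc' m), ?_⟩
    rw [Finsupp.sum_add_index' (fun _ => mul_zero _) fun _ _ _ => mul_add _ _ _]
  | smul r x _ hx =>
    obtain ⟨c, hc, rfl⟩ := hx
    refine ⟨r • c, fun m => Submodule.smul_mem _ _ (hc m), ?_⟩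
    rw [Finsupp.sum_smul_index' fun _ => mul_zero _, Finsupp.smul_sum]
    simp only [mul_smul_comm]

/-- A coframe monomial is a wedge of even members times a monomial in the odd ones, so uniqueness of
expansions separates different wedges. -/
theorem IsCoframe.eq_zero_of_sum_wedge (h : Y.IsCoframe U e ψ) (x : Finset (Fin p) → Y.form U)
    (hx : ∀ s, x s ∈ oddPoly ψ) (h0 : ∑ s, wedge e s * x s = 0) (s : Finset (Fin p)) : x s = 0 := by
  choose c hc hcx using fun s => exists_of_mem_oddPoly (hx s)
  let C : (Finset (Fin p) × (Fin q → ℕ)) →₀ Y.form U :=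
    ∑ s, (c s).mapDomain (Prod.mk s)
  have hCs : ∀ i, C i = c i.1 i.2 := fun ⟨s, m⟩ => by
    simp only [C, Finsupp.coe_finsetSum, Finset.sum_apply]
    rw [Finset.sum_eq_single s]
    · exact Finsupp.mapDomain_apply (Prod.mk_right_injective s) _ _
    · intro t _ ht
      refine Finsupp.mapDomain_of_notMem_range _ _ ?_
      rintro ⟨m', hm'⟩
      exact ht (congrArg Prod.fst hm')
    · simp
  have hC : C = 0 := by
    refine h.eq_zero (fun i => hCs i ▸ hc _ _) ?_
    rw [← h0, ← Finsupp.sum_finsetSum_index (fun _ => mul_zero _) fun _ _ _ => mul_add _ _ _]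
    refine Finset.sum_congr rfl fun s _ => ?_
    rw [Finsupp.sum_mapDomain_index (fun _ => mul_zero _) fun _ _ _ => mul_add _ _ _, hcx s,
      Finsupp.sum, Finsupp.sum, Finset.mul_sum]
    exact Finset.sum_congr rfl fun m _ => mul_assoc _ _ _
  have : c s = 0 := by
    ext m
    rw [← hCs (s, m), hC]
    rfl
  rw [hcx s, this]
  simp

/-! ### Products of even coframe members -/

theorem even_one_forms_anticomm (he : ∀ a, e a ∈ Y.gr U (1, 0)) (a b : Fin p) :
    e a * e b = -(e b * e a) := by
  simpa using Y.supercomm U _ _ _ _ (he a) (he b)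

theorem isSkew_wedgeSeq (he : ∀ a, e a ∈ Y.gr U (1, 0)) (n : ℕ) :
    IsSkew (wedgeSeq e : (Fin n → Fin p) → Y.form U) := fun w σ =>
  List.prod_ofFn_perm (fun i => e (w i)) (fun _ _ _ => even_one_forms_anticomm he _ _) σ

theorem exists_ordering (e : Fin p → Y.form U) (s : Finset (Fin p)) :
    ∃ o : Fin s.card → Fin p, Function.Injective o ∧ Finset.univ.image o = s ∧
      wedgeSeq e o = wedge e s := by
  let L := (List.finRange p).filter (· ∈ s)
  have hnd : L.Nodup := (List.nodup_finRange p).filter _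
  have hs : L.toFinset = s := by ext a; simp [L]
  have hlen : L.length = s.card := by rw [← hs, List.toFinset_card_of_nodup hnd]
  refine ⟨fun i => L.get (Fin.cast hlen.symm i), ?_, ?_, ?_⟩
  · exact (List.nodup_iff_injective_get.1 hnd).comp (Fin.cast_injective _)
  · ext a
    have ha : a ∈ s ↔ a ∈ L.toFinset := by rw [hs]
    rw [ha]
    simp only [Finset.mem_image, Finset.mem_univ, true_and, List.mem_toFinset, List.mem_iff_get]
    exact ⟨fun ⟨i, hi⟩ => ⟨_, hi⟩, fun ⟨i, hi⟩ => ⟨Fin.cast hlen i, hi⟩⟩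
  · have h1 : wedgeSeq e (fun i => L.get (Fin.cast hlen.symm i)) = (L.map e).prod := by
      unfold wedgeSeq
      congr 1
      refine List.ext_getElem (by simp [hlen]) fun i h1 h2 => by simp
    rw [h1]
    unfold wedge
    rw [List.ofFn_eq_map]
    simp only [L]
    induction List.finRange p with
    | nil => simp
    | cons a l ih =>
      by_cases ha : a ∈ s
      · simp only [ha, List.map_cons, if_true, List.prod_cons, List.filter_cons_of_pos,
          decide_true]
        rw [ih]
      · simp only [ha, List.map_cons, if_false, List.prod_cons, one_mul]
        rw [List.filter_cons_of_neg (by simpa using ha), ih]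

/-- An ordering of a finite set. -/
def ordering (e : Fin p → Y.form U) (s : Finset (Fin p)) : Fin s.card → Fin p :=
  (exists_ordering e s).choose

theorem ordering_injective (s : Finset (Fin p)) : Function.Injective (ordering e s) :=
  (exists_ordering e s).choose_spec.1

theorem image_ordering (s : Finset (Fin p)) : Finset.univ.image (ordering e s) = s :=
  (exists_ordering e s).choose_spec.2.1

theorem wedgeSeq_ordering (s : Finset (Fin p)) : wedgeSeq e (ordering e s) = wedge e s :=
  (exists_ordering e s).choose_spec.2.2

/-- The coefficient of `wedge e s` in `∑ w, wedgeSeq e w * Q w`. -/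
def wedgeCoeff (e : Fin p → Y.form U) {n : ℕ} (Q : (Fin n → Fin p) → Y.form U)
    (s : Finset (Fin p)) : Y.form U :=
  if h : s.card = n then (n.factorial : ℝ) • skew Q (ordering e s ∘ Fin.cast h.symm) else 0

/-- Sequences are grouped by their sets of values. Sequences with repetitions contribute nothing,
and the `n!` orderings of a set skew-symmetrize `Q`. -/
theorem sum_wedgeSeq (he : ∀ a, e a ∈ Y.gr U (1, 0)) {n : ℕ} (Q : (Fin n → Fin p) → Y.form U) :
    ∑ w, wedgeSeq e w * Q w = ∑ s, wedge e s * wedgeCoeff e Q s := by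
  rw [← Finset.sum_fiberwise Finset.univ (fun w : Fin n → Fin p => Finset.univ.image w)]
  refine Finset.sum_congr rfl fun s _ => ?_
  unfold wedgeCoeff
  split
  · next h =>
    subst h
    have h1 := sum_filter_image_eq (fun w => wedgeSeq e w * Q w) (ordering_injective (e := e) s)
    rw [image_ordering] at h1
    rw [h1]
    simp only [isSkew_wedgeSeq he _ _ _, wedgeSeq_ordering, smul_mul_assoc]
    unfold skew
    rw [smul_smul, mul_inv_cancel₀ (by exact_mod_cast s.card.factorial_ne_zero), one_smul,
      Finset.mul_sum]
    simp only [mul_smul_comm]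
    rfl
  · next h =>
    rw [mul_zero]
    refine Finset.sum_eq_zero fun w hw => ?_
    rw [(isSkew_wedgeSeq he n).eq_zero, zero_mul]
    intro hinj
    apply h
    rw [← (Finset.mem_filter.1 hw).2, Finset.card_image_of_injective _ hinj]
    simp

theorem skew_mem {n : ℕ} {ι A : Type*} [AddCommGroup A] [Module ℝ A] (S : Submodule ℝ A)
    {T : (Fin n → ι) → A} (h : ∀ w, T w ∈ S) (w : Fin n → ι) : skew T w ∈ S :=
  S.smul_mem _ (Submodule.sum_mem _ fun _ _ => S.smul_of_tower_mem _ (h _))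

theorem wedgeCoeff_mem {n : ℕ} {Q : (Fin n → Fin p) → Y.form U} (hQ : ∀ w, Q w ∈ oddPoly ψ)
    (s : Finset (Fin p)) : wedgeCoeff e Q s ∈ oddPoly ψ := by
  unfold wedgeCoeff
  split
  · exact Submodule.smul_mem _ _ (skew_mem _ hQ _)
  · exact Submodule.zero_mem _

theorem skew_eq_zero_of_wedgeCoeff {n : ℕ} {Q : (Fin n → Fin p) → Y.form U}
    (h : ∀ s : Finset (Fin p), s.card = n → wedgeCoeff e Q s = 0) : skew Q = 0 := by
  funext w
  by_cases hw : Function.Injective w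
  · have hc : (Finset.univ.image w).card = n := by
      rw [Finset.card_image_of_injective _ hw]; simp
    have h1 := h _ hc
    unfold wedgeCoeff at h1
    rw [dif_pos hc] at h1
    have h2 := (smul_eq_zero.1 h1).resolve_left (by exact_mod_cast n.factorial_ne_zero)
    have h3 : Finset.univ.image w =
        Finset.univ.image (ordering e (Finset.univ.image w) ∘ Fin.cast hc.symm) := by
      conv_lhs => rw [← image_ordering (e := e) (Finset.univ.image w)]
      ext a
      simp only [Finset.mem_image, Finset.mem_univ, true_and, Function.comp_apply]
      exact ⟨fun ⟨i, hi⟩ => ⟨Fin.cast hc i, hi⟩, fun ⟨i, hi⟩ => ⟨_, hi⟩⟩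
    obtain ⟨σ, hσ⟩ := exists_perm_of_image_eq
      ((ordering_injective (e := e) _).comp (Fin.cast_injective hc.symm)) h3
    rw [← hσ, isSkew_skew, h2]
    simp
  · exact (isSkew_skew Q).eq_zero hw

theorem wedgeCoeff_eq_zero {n : ℕ} {Q : (Fin n → Fin p) → Y.form U} (h : skew Q = 0)
    (s : Finset (Fin p)) : wedgeCoeff e Q s = 0 := by
  unfold wedgeCoeff
  rw [h]
  simp

theorem wedgeCoeff_of_ne {n : ℕ} (Q : (Fin n → Fin p) → Y.form U) {s : Finset (Fin p)}
    (h : s.card ≠ n) : wedgeCoeff e Q s = 0 := dif_neg h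

/-- Wedges with different numbers of factors are independent, and each sum sees only the skew part
of its coefficients. -/
theorem IsCoframe.sum_wedgeSeq_eq_zero_iff (h : Y.IsCoframe U e ψ) {n₁ n₂ n₃ : ℕ} (h12 : n₁ ≠ n₂)
    (h13 : n₁ ≠ n₃) (h23 : n₂ ≠ n₃) {Q₁ : (Fin n₁ → Fin p) → Y.form U}
    {Q₂ : (Fin n₂ → Fin p) → Y.form U} {Q₃ : (Fin n₃ → Fin p) → Y.form U}
    (hQ₁ : ∀ w, Q₁ w ∈ oddPoly ψ) (hQ₂ : ∀ w, Q₂ w ∈ oddPoly ψ) (hQ₃ : ∀ w, Q₃ w ∈ oddPoly ψ) :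
    ∑ w, wedgeSeq e w * Q₁ w + ∑ w, wedgeSeq e w * Q₂ w + ∑ w, wedgeSeq e w * Q₃ w = 0 ↔
      skew Q₁ = 0 ∧ skew Q₂ = 0 ∧ skew Q₃ = 0 := by
  rw [sum_wedgeSeq h.1, sum_wedgeSeq h.1, sum_wedgeSeq h.1]
  constructor
  · intro h0
    simp only [← Finset.sum_add_distrib, ← mul_add] at h0
    have h1 := h.eq_zero_of_sum_wedge _ (fun s => Submodule.add_mem _ (Submodule.add_mem _
      (wedgeCoeff_mem hQ₁ s) (wedgeCoeff_mem hQ₂ s)) (wedgeCoeff_mem hQ₃ s)) h0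
    refine ⟨skew_eq_zero_of_wedgeCoeff (e := e) fun s hs => ?_,
      skew_eq_zero_of_wedgeCoeff (e := e) fun s hs => ?_,
      skew_eq_zero_of_wedgeCoeff (e := e) fun s hs => ?_⟩
    · have := h1 s
      rwa [wedgeCoeff_of_ne Q₂ (hs ▸ h12), wedgeCoeff_of_ne Q₃ (hs ▸ h13), add_zero,
        add_zero] at this
    · have := h1 s
      rwa [wedgeCoeff_of_ne Q₁ (hs ▸ h12.symm), wedgeCoeff_of_ne Q₃ (hs ▸ h23), zero_add,
        add_zero] at this
    · have := h1 s
      rwa [wedgeCoeff_of_ne Q₁ (hs ▸ h13.symm), wedgeCoeff_of_ne Q₂ (hs ▸ h23.symm), zero_add,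
        zero_add] at this
  · rintro ⟨h1, h2, h3⟩
    simp [wedgeCoeff_eq_zero h1, wedgeCoeff_eq_zero h2, wedgeCoeff_eq_zero h3]

theorem wedgeSeq_mul (e : Fin p → Y.form U) {n : ℕ} (w : Fin n → Fin p) (b : Fin p) :
    wedgeSeq e w * e b = wedgeSeq e (Fin.snoc w b : Fin (n + 1) → Fin p) := by
  unfold wedgeSeq
  rw [List.ofFn_succ']
  simp

/-- A repetition is unavoidable. Multiplication by the full wedge thus removes every term with an
even coframe factor, while it is injective on polynomials in the odd members. -/
theorem wedge_univ_mul (he : ∀ a, e a ∈ Y.gr U (1, 0)) (b : Fin p) :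
    wedge e Finset.univ * e b = 0 := by
  rw [← wedgeSeq_ordering, wedgeSeq_mul]
  refine (isSkew_wedgeSeq he _).eq_zero fun hinj => ?_
  have := Fintype.card_le_of_injective _ hinj
  simp at this

theorem IsCoframe.eq_zero_of_wedge_univ_mul (h : Y.IsCoframe U e ψ) {x : Y.form U}
    (hx : x ∈ oddPoly ψ) (h0 : wedge e Finset.univ * x = 0) : x = 0 := by
  have := h.eq_zero_of_sum_wedge (fun s => if s = Finset.univ then x else 0) (fun s => by
    split
    · exact hx
    · exact Submodule.zero_mem _) (by simpa using h0) Finset.univ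
  simpa using this

/-! ### Quadratic polynomials in the odd coframe members -/

/-- The signs from form degree and from parity cancel. -/
theorem odd_one_forms_comm (hψ : ∀ α, ψ α ∈ Y.gr U (1, 1)) (α β : Fin q) :
    ψ α * ψ β = ψ β * ψ α := by
  have := Y.supercomm U _ _ _ _ (hψ α) (hψ β)
  simpa [ZMod.val_one] using this

theorem prod_ofFn_pow_add {A : Type*} [Ring A] {n : ℕ} (x : Fin n → A)
    (hx : ∀ i j, Commute (x i) (x j)) (m m' : Fin n → ℕ) :
    (List.ofFn fun i => x i ^ (m i + m' i)).prod =
      (List.ofFn fun i => x i ^ m i).prod * (List.ofFn fun i => x i ^ m' i).prod := by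
  induction n with
  | zero => simp
  | succ n ih =>
    simp only [List.ofFn_succ, List.prod_cons]
    rw [ih (fun i => x i.succ) (fun i j => hx _ _) (fun i => m i.succ) fun i => m' i.succ]
    have hc : Commute (x 0 ^ m' 0) (List.ofFn fun i : Fin n => x i.succ ^ m i.succ).prod := by
      refine Commute.list_prod_right _ _ fun y hy => ?_
      obtain ⟨i, rfl⟩ := (List.mem_ofFn' _ _).1 hy
      exact (hx _ _).pow_pow _ _
    rw [pow_add, mul_assoc, ← mul_assoc (x 0 ^ m' 0), hc.eq]
    simp only [mul_assoc]

theorem monomial_single (ψ : Fin q → Y.form U) (α : Fin q) : monomial ψ (Pi.single α 1) = ψ α := by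
  unfold monomial
  induction q with
  | zero => exact α.elim0
  | succ n ih =>
    rw [List.ofFn_succ, List.prod_cons]
    induction α using Fin.cases with
    | zero =>
      simp only [Pi.single_eq_same, pow_one]
      have : (List.ofFn fun i : Fin n => ψ i.succ ^ (Pi.single (0 : Fin (n + 1)) 1 :
          Fin (n + 1) → ℕ) i.succ).prod = 1 := by
        refine List.prod_eq_one fun y hy => ?_
        obtain ⟨i, rfl⟩ := (List.mem_ofFn' _ _).1 hy
        simp
      rw [this, mul_one]
    | succ β =>
      have := ih (fun i => ψ i.succ) β
      simp only [Pi.single_apply, Fin.succ_inj] at this ⊢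
      rw [this]
      simp [(Fin.succ_ne_zero β).symm]

theorem monomial_pair (hψ : ∀ α, ψ α ∈ Y.gr U (1, 1)) (α β : Fin q) :
    monomial ψ (Pi.single α 1 + Pi.single β 1) = ψ α * ψ β := by
  have := prod_ofFn_pow_add ψ (odd_one_forms_comm hψ) (Pi.single α 1) (Pi.single β 1)
  rw [← monomial_single ψ α, ← monomial_single ψ β]
  exact this

theorem wedge_empty (e : Fin p → Y.form U) : wedge e ∅ = 1 := by
  simp [wedge]

theorem monomial_zero (ψ : Fin q → Y.form U) : monomial ψ 0 = 1 := by
  simp [monomial]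

theorem mem_oddPoly_of_functions {f : Y.form U} (hf : f ∈ Y.functions U) : f ∈ oddPoly ψ :=
  Submodule.subset_span ⟨0, f, hf, by rw [monomial_zero, one_mul]⟩

theorem single_mul_mem_oddPoly (α : Fin q) {f : Y.form U} (hf : f ∈ Y.functions U) :
    ψ α * f ∈ oddPoly ψ :=
  Submodule.subset_span ⟨Pi.single α 1, f, hf, by rw [monomial_single]⟩

theorem pair_mul_mem_oddPoly (hψ : ∀ α, ψ α ∈ Y.gr U (1, 1)) (α β : Fin q) {f : Y.form U}
    (hf : f ∈ Y.functions U) : ψ α * ψ β * f ∈ oddPoly ψ :=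
  Submodule.subset_span ⟨Pi.single α 1 + Pi.single β 1, f, hf, by rw [monomial_pair hψ]⟩

theorem single_add_single_eq {α β α' β' : Fin q}
    (h : (Pi.single α' 1 + Pi.single β' 1 : Fin q → ℕ) = Pi.single α 1 + Pi.single β 1) :
    (α' = α ∧ β' = β) ∨ (α' = β ∧ β' = α) := by
  have h1 := congrFun h α'
  simp only [Pi.add_apply, Pi.single_apply, if_true] at h1
  by_cases ha : α' = α
  · subst ha
    left
    refine ⟨rfl, ?_⟩
    have h2 := congrFun (add_left_cancel h) β'
    by_contra hne
    simp [hne] at h2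
  · by_cases hb : α' = β
    · subst hb
      right
      refine ⟨rfl, ?_⟩
      rw [add_comm (Pi.single α 1)] at h
      have h2 := congrFun (add_left_cancel h) β'
      by_contra hne
      simp [hne] at h2
    · simp [ha, hb] at h1

theorem IsCoframe.eq_zero_of_quadratic (h : Y.IsCoframe U e ψ) {c : Fin q → Fin q → Y.form U}
    (hc : ∀ α β, c α β ∈ Y.functions U) (hsymm : ∀ α β, c α β = c β α)
    (h0 : ∑ α, ∑ β, ψ α * ψ β * c α β = 0) (α β : Fin q) : c α β = 0 := by
  let C : (Finset (Fin p) × (Fin q → ℕ)) →₀ Y.form U :=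
    ∑ x : Fin q × Fin q, Finsupp.single (∅, Pi.single x.1 1 + Pi.single x.2 1) (c x.1 x.2)
  have hC : C = 0 := by
    refine h.eq_zero (fun i => ?_) ?_
    · simp only [C, Finsupp.coe_finsetSum, Finset.sum_apply]
      refine Submodule.sum_mem _ fun x _ => ?_
      rw [Finsupp.single_apply]
      split
      · exact hc _ _
      · exact Submodule.zero_mem _
    · rw [← h0, ← Finsupp.sum_finsetSum_index (fun _ => mul_zero _) fun _ _ _ => mul_add _ _ _,
        Fintype.sum_prod_type]
      refine Finset.sum_congr rfl fun α _ => Finset.sum_congr rfl fun β _ => ?_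
      rw [Finsupp.sum_single_index (mul_zero _)]
      have : frameMonomial e ψ (∅, Pi.single α 1 + Pi.single β 1) =
          wedge e ∅ * monomial ψ (Pi.single α 1 + Pi.single β 1) := rfl
      rw [this, wedge_empty, one_mul, monomial_pair h.2.1]
  have h1 : C (∅, Pi.single α 1 + Pi.single β 1) = 0 := by rw [hC]; rfl
  simp only [C, Finsupp.coe_finsetSum, Finset.sum_apply, Finsupp.single_apply, Prod.mk.injEq,
    true_and] at h1
  rw [← Finset.sum_filter] at h1
  -- Off the diagonal a quadratic monomial arises from two ordered pairs, and symmetry makes their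
  -- coefficients equal.
  have h2 : (Finset.univ.filter fun x : Fin q × Fin q =>
      (Pi.single x.1 1 + Pi.single x.2 1 : Fin q → ℕ) = Pi.single α 1 + Pi.single β 1) =
      {(α, β), (β, α)} := by
    ext ⟨a, b⟩
    simp only [Finset.mem_filter, Finset.mem_univ, true_and, Finset.mem_insert,
      Finset.mem_singleton, Prod.mk.injEq]
    refine ⟨single_add_single_eq, ?_⟩
    rintro (⟨rfl, rfl⟩ | ⟨rfl, rfl⟩)
    · rfl
    · rw [add_comm]
  rw [h2] at h1
  by_cases hab : α = β
  · subst hab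
    simpa using h1
  · rw [Finset.sum_pair (by simp [hab]), hsymm β α, ← two_smul ℝ] at h1
    exact (smul_eq_zero.1 h1).resolve_left two_ne_zero

/-! ### One-forms -/

/-- A superfunction may be of mixed parity, but each term has a definite form degree, by which
expansions can be truncated. -/
theorem frameMonomial_mul_mem (he : ∀ a, e a ∈ Y.gr U (1, 0)) (hψ : ∀ α, ψ α ∈ Y.gr U (1, 1))
    (i : Finset (Fin p) × (Fin q → ℕ)) {f : Y.form U} (hf : f ∈ Y.functions U) :
    ∃ s : ZMod 2, frameMonomial e ψ i * f ∈ Y.gr U (i.1.card + ∑ α, i.2 α, s) ⊔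
      Y.gr U (i.1.card + ∑ α, i.2 α, s + 1) := by
  have h1 : wedge e i.1 ∈ Y.gr U (∑ a, if a ∈ i.1 then (1, 0) else (0, 0)) := by
    refine prod_ofFn_mem _ _ fun a => ?_
    split
    · exact he a
    · exact Y.one_mem U
  have h2 : monomial ψ i.2 ∈ Y.gr U (∑ α, i.2 α • ((1, 1) : ℕ × ZMod 2)) :=
    prod_ofFn_mem _ _ fun α => pow_mem_gr (hψ α) _
  have h3 := Y.mul_mem U _ _ _ _ h1 h2
  have hfm : frameMonomial e ψ i = wedge e i.1 * monomial ψ i.2 := rfl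
  set d : ℕ × ZMod 2 := (∑ a, if a ∈ i.1 then ((1, 0) : ℕ × ZMod 2) else (0, 0)) +
    ∑ α, i.2 α • ((1, 1) : ℕ × ZMod 2) with hd
  have hd1 : d.1 = i.1.card + ∑ α, i.2 α := by
    rw [hd, Prod.fst_add, Prod.fst_sum, Prod.fst_sum]
    congr 1
    · have : ∀ a, (if a ∈ i.1 then ((1, 0) : ℕ × ZMod 2) else (0, 0)).1 = if a ∈ i.1 then 1 else 0 :=
        fun a => by split <;> rfl
      simp [this]
    · simp
  have hd' : d = (i.1.card + ∑ α, i.2 α, d.2) := Prod.ext hd1 rfl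
  refine ⟨d.2, ?_⟩
  rw [hd'] at h3
  obtain ⟨a, ha, b, hb, rfl⟩ := Submodule.mem_sup.1 hf
  rw [hfm, mul_add]
  refine Submodule.add_mem_sup ?_ ?_
  · simpa using Y.mul_mem U _ _ _ _ h3 ha
  · simpa using Y.mul_mem U _ _ _ _ h3 hb

/-- The projection to forms of a given form degree. -/
theorem exists_degree_proj (Y : SuperSpace.{u, v}) (U : Opens Y.body) (n : ℕ) :
    ∃ π : Y.form U →ₗ[ℝ] Y.form U, (∀ s x, x ∈ Y.gr U (n, s) → π x = x) ∧
      ∀ m s x, m ≠ n → x ∈ Y.gr U (m, s) → π x = 0 := by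
  classical
  let _ := (Y.internal U).chooseDecomposition
  let pr : ℕ × ZMod 2 → Y.form U →ₗ[ℝ] Y.form U := fun i =>
    (Y.gr U i).subtype ∘ₗ DirectSum.component ℝ _ _ i ∘ₗ
      (DirectSum.decomposeLinearEquiv (Y.gr U)).toLinearMap
  have hpr : ∀ i j x, x ∈ Y.gr U j → pr i x = if j = i then x else 0 := fun i j x hx => by
    have : pr i x = (DirectSum.decompose (Y.gr U) x i : Y.form U) := rfl
    rw [this]
    split
    · next h => subst h; exact DirectSum.decompose_of_mem_same _ hx
    · next h => exact DirectSum.decompose_of_mem_ne _ hx h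
  refine ⟨pr (n, 0) + pr (n, 1), fun s x hx => ?_, fun m s x hm hx => ?_⟩
  · rw [LinearMap.add_apply, hpr _ _ _ hx, hpr _ _ _ hx]
    have : s = 0 ∨ s = 1 := (by decide : ∀ s : ZMod 2, s = 0 ∨ s = 1) s
    rcases this with rfl | rfl <;> simp
  · rw [LinearMap.add_apply, hpr _ _ _ hx, hpr _ _ _ hx]
    simp [hm]

theorem index_of_degree_one {i : Finset (Fin p) × (Fin q → ℕ)} (h : i.1.card + ∑ α, i.2 α = 1) :
    (∃ a, i = ({a}, 0)) ∨ ∃ α, i = (∅, Pi.single α 1) := by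
  obtain ⟨s, m⟩ := i
  simp only at h
  rcases Nat.eq_zero_or_pos s.card with hs | hs
  · right
    have hm : ∑ α, m α = 1 := by omega
    obtain ⟨α, -, hα⟩ := Finset.exists_ne_zero_of_sum_ne_zero (by rw [hm]; exact one_ne_zero)
    refine ⟨α, Prod.ext (Finset.card_eq_zero.1 hs) (funext fun β => ?_)⟩
    have h1 := Finset.add_sum_erase Finset.univ m (Finset.mem_univ α)
    have h2 : ∑ x ∈ Finset.univ.erase α, m x = 0 := by omega
    by_cases hb : β = α
    · subst hb; simp; omega
    · simp only [Pi.single_apply, hb, if_false]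
      exact Finset.sum_eq_zero_iff.1 h2 β (Finset.mem_erase.2 ⟨hb, Finset.mem_univ _⟩)
  · left
    have hs1 : s.card = 1 := by omega
    obtain ⟨a, rfl⟩ := Finset.card_eq_one.1 hs1
    refine ⟨a, Prod.ext rfl (funext fun β => ?_)⟩
    have : ∑ α, m α = 0 := by omega
    exact Finset.sum_eq_zero_iff.1 this β (Finset.mem_univ _)

theorem wedge_singleton (e : Fin p → Y.form U) (a : Fin p) : wedge e {a} = e a := by
  obtain ⟨o, -, ho2, ho3⟩ := exists_ordering e {a}
  rw [← ho3]
  have h1 : ∀ i, o i = a := fun i => by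
    have : o i ∈ Finset.univ.image o := Finset.mem_image_of_mem _ (Finset.mem_univ i)
    rw [ho2] at this
    exact Finset.mem_singleton.1 this
  unfold wedgeSeq
  simp [h1]

/-- The projection to form degree one leaves only the monomials that consist of a single coframe
member. -/
theorem IsCoframe.one_form_eq (h : Y.IsCoframe U e ψ) {η : Y.form U} {s : ZMod 2}
    (hη : η ∈ Y.gr U (1, s)) :
    η = ∑ a, e a * coframeCoeff h η ({a}, 0) +
      ∑ α, ψ α * coframeCoeff h η (∅, Pi.single α 1) := by
  classical
  obtain ⟨c, ⟨hc, hηc⟩, -⟩ := h.expand η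
  simp only [h.coeff_eq hc hηc]
  obtain ⟨π, hπ1, hπ0⟩ := exists_degree_proj Y U 1
  let deg : Finset (Fin p) × (Fin q → ℕ) → ℕ := fun i => i.1.card + ∑ α, i.2 α
  have hterm : ∀ i, π (frameMonomial e ψ i * c i) =
      if deg i = 1 then frameMonomial e ψ i * c i else 0 := fun i => by
    obtain ⟨t, ht⟩ := frameMonomial_mul_mem h.1 h.2.1 i (hc i)
    obtain ⟨x, hx, y, hy, hxy⟩ := Submodule.mem_sup.1 ht
    change x ∈ Y.gr U (deg i, t) at hx
    change y ∈ Y.gr U (deg i, t + 1) at hy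
    rw [← hxy, map_add]
    split
    · next hd => rw [hd] at hx hy; rw [hπ1 _ _ hx, hπ1 _ _ hy]
    · next hd => rw [hπ0 _ _ _ hd hx, hπ0 _ _ _ hd hy, add_zero]
  let D : Finset (Finset (Fin p) × (Fin q → ℕ)) :=
    Finset.univ.image (fun a : Fin p => (({a} : Finset (Fin p)), (0 : Fin q → ℕ))) ∪
      Finset.univ.image (fun α : Fin q => ((∅ : Finset (Fin p)), (Pi.single α 1 : Fin q → ℕ)))
  have hD : ∀ i, i ∈ D ↔ deg i = 1 := fun i => by
    simp only [D, Finset.mem_union, Finset.mem_image, Finset.mem_univ, true_and]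
    constructor
    · rintro (⟨a, rfl⟩ | ⟨α, rfl⟩)
      · simp [deg]
      · simp [deg]
    · intro hi
      rcases index_of_degree_one hi with ⟨a, rfl⟩ | ⟨α, rfl⟩
      · exact Or.inl ⟨a, rfl⟩
      · exact Or.inr ⟨α, rfl⟩
  have h1 : η = ∑ i ∈ D, frameMonomial e ψ i * c i := by
    conv_lhs => rw [← hπ1 s η hη, hηc, Finsupp.sum, map_sum]
    rw [Finset.sum_congr rfl fun i _ => hterm i, ← Finset.sum_filter]
    refine Finset.sum_subset (fun i hi => (hD i).2 (Finset.mem_filter.1 hi).2) fun i hi hi' => ?_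
    have : c i = 0 := by
      by_contra hne
      exact hi' (Finset.mem_filter.2 ⟨Finsupp.mem_support_iff.2 hne, (hD i).1 hi⟩)
    rw [this, mul_zero]
  conv_lhs => rw [h1]
  rw [Finset.sum_union, Finset.sum_image, Finset.sum_image]
  · congr 1
    · refine Finset.sum_congr rfl fun a _ => ?_
      have : frameMonomial e ψ ({a}, 0) = wedge e {a} * monomial ψ 0 := rfl
      rw [this, wedge_singleton, monomial_zero, mul_one]
    · refine Finset.sum_congr rfl fun α _ => ?_
      have : frameMonomial e ψ (∅, Pi.single α 1) = wedge e ∅ * monomial ψ (Pi.single α 1) := rfl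
      rw [this, wedge_empty, monomial_single, one_mul]
  · intro α _ β _ hαβ
    have := congrFun (congrArg Prod.snd hαβ) α
    by_contra hne
    simp [hne] at this
  · intro a _ b _ hab
    exact Finset.singleton_injective (congrArg Prod.fst hab)
  · rw [Finset.disjoint_left]
    intro i hi hi'
    obtain ⟨a, -, rfl⟩ := Finset.mem_image.1 hi
    obtain ⟨α, -, hα⟩ := Finset.mem_image.1 hi'
    exact Finset.singleton_ne_empty a (congrArg Prod.fst hα).symm

end SuperSpace

end

noncomputable section

set_option linter.unusedSectionVars false

universe u v w u' v'

/-! ## Spinor indices -/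

theorem sum_chir {A : Type*} [AddCommMonoid A] (f : Fin 32 → A) :
    ∑ i, f i = ∑ α, f (chirP α) + ∑ β, f (chirN β) :=
  Fin.sum_univ_add (a := 16) (b := 16) f

theorem chir_cases (i : Fin 32) : (∃ α, i = chirP α) ∨ ∃ β, i = chirN β := by
  refine Fin.addCases (m := 16) (n := 16) (fun α => ?_) (fun β => ?_) i
  · exact Or.inl ⟨α, rfl⟩
  · exact Or.inr ⟨β, rfl⟩

theorem sum_tang_transv {A : Type*} [AddCommMonoid A] (f : Fin 11 → A) :
    ∑ i, f i = ∑ a, f (tang a) + ∑ i, f (transv i) :=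
  Fin.sum_univ_add (a := 6) (b := 5) f

theorem sum_comm_pairs {ι κ A : Type*} [Fintype ι] [Fintype κ] [AddCommMonoid A]
    (f : ι → ι → κ → κ → A) :
    ∑ a, ∑ b, ∑ c, ∑ d, f a b c d = ∑ c, ∑ d, ∑ a, ∑ b, f a b c d := by
  have := Finset.sum_comm (s := (Finset.univ : Finset (ι × ι))) (t := (Finset.univ : Finset (κ × κ)))
    (f := fun x y => f x.1 x.2 y.1 y.2)
  simpa only [Fintype.sum_prod_type] using this

theorem chirP_lt (α : Fin 16) : (chirP α).val < 16 := α.2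

theorem not_chirN_lt (β : Fin 16) : ¬ (chirN β).val < 16 := by
  simp [chirN]

theorem chirP_injective : Function.Injective chirP := Fin.castAdd_injective 16 16

theorem chirN_injective : Function.Injective chirN := Fin.natAdd_injective 16 16

/-! ### Linear relations among coframe members -/

namespace SuperSpace

variable {Y : SuperSpace.{u, v}} {U V : Opens Y.body} {p q : ℕ} {e : Fin p → Y.form U}
  {ψ : Fin q → Y.form U}

theorem IsCoframe.eq_zero_of_sum (h : Y.IsCoframe U e ψ) {κ : Type*} [Fintype κ]
    {j : κ → Finset (Fin p) × (Fin q → ℕ)} (hj : Function.Injective j) {f : κ → Y.form U}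
    (hf : ∀ x, f x ∈ Y.functions U) (h0 : ∑ x, frameMonomial e ψ (j x) * f x = 0) (x : κ) :
    f x = 0 := by
  classical
  let C : (Finset (Fin p) × (Fin q → ℕ)) →₀ Y.form U := ∑ x, Finsupp.single (j x) (f x)
  have hC : C = 0 := by
    refine h.eq_zero (fun i => ?_) ?_
    · simp only [C, Finsupp.coe_finsetSum, Finset.sum_apply]
      refine Submodule.sum_mem _ fun x _ => ?_
      rw [Finsupp.single_apply]
      split
      · exact hf _
      · exact Submodule.zero_mem _
    · rw [← h0, ← Finsupp.sum_finsetSum_index (fun _ => mul_zero _) fun _ _ _ => mul_add _ _ _]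
      exact Finset.sum_congr rfl fun x _ => Finsupp.sum_single_index (mul_zero _)
  have h1 : C (j x) = 0 := by rw [hC]; rfl
  simpa only [C, Finsupp.coe_finsetSum, Finset.sum_apply, Finsupp.single_apply, hj.eq_iff,
    Finset.sum_ite_eq', Finset.mem_univ, if_true] using h1

theorem IsCoframe.eq_zero_of_sum_even (h : Y.IsCoframe U e ψ) {f : Fin p → Y.form U}
    (hf : ∀ a, f a ∈ Y.functions U) (h0 : ∑ a, e a * f a = 0) (a : Fin p) : f a = 0 := by
  refine h.eq_zero_of_sum (j := fun a => ({a}, 0))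
    (fun a b hab => Finset.singleton_injective (congrArg Prod.fst hab)) hf ?_ a
  rw [← h0]
  refine Finset.sum_congr rfl fun a _ => ?_
  have : frameMonomial e ψ ({a}, 0) = wedge e {a} * monomial ψ 0 := rfl
  rw [this, wedge_singleton, monomial_zero, mul_one]

theorem IsCoframe.eq_zero_of_sum_odd (h : Y.IsCoframe U e ψ) {f : Fin q → Y.form U}
    (hf : ∀ a, f a ∈ Y.functions U) (h0 : ∑ a, ψ a * f a = 0) (α : Fin q) : f α = 0 := by
  refine h.eq_zero_of_sum (j := fun α => (∅, Pi.single α 1)) (fun α β hαβ => ?_) hf ?_ α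
  · have := congrFun (congrArg Prod.snd hαβ) α
    by_contra hne
    simp [hne] at this
  · rw [← h0]
    refine Finset.sum_congr rfl fun α _ => ?_
    have : frameMonomial e ψ (∅, Pi.single α 1) = wedge e ∅ * monomial ψ (Pi.single α 1) := rfl
    rw [this, wedge_empty, monomial_single, one_mul]

theorem IsCoframe.eq_zero_of_even_mul_odd (h : Y.IsCoframe U e ψ) {f : Fin q → Y.form U}
    (hf : ∀ a, f a ∈ Y.gr U (0, 0)) (h0 : ∑ a, f a * ψ a = 0) (α : Fin q) : f α = 0 := by
  refine h.eq_zero_of_sum_odd (fun a => even_mem_functions (hf a)) ?_ α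
  rw [← h0]
  exact Finset.sum_congr rfl fun a _ => (even_mul_comm (hf a) (h.2.1 a)).symm

theorem IsCoframe.eq_zero_of_odd_mul_odd (h : Y.IsCoframe U e ψ) {f : Fin q → Y.form U}
    (hf : ∀ a, f a ∈ Y.gr U (0, 1)) (h0 : ∑ a, f a * ψ a = 0) (α : Fin q) : f α = 0 := by
  refine h.eq_zero_of_sum_odd (fun a => odd_mem_functions (hf a)) ?_ α
  have h1 : ∀ a, ψ a * f a = -(f a * ψ a) := fun a => by
    have := Y.supercomm U _ _ _ _ (h.2.1 a) (hf a)
    simpa [ZMod.val_one] using this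
  simp only [h1, Finset.sum_neg_distrib, h0, neg_zero]

theorem IsCoframe.eq_zero_of_odd_mul_even (h : Y.IsCoframe U e ψ) {f : Fin p → Y.form U}
    (hf : ∀ a, f a ∈ Y.gr U (0, 1)) (h0 : ∑ a, f a * e a = 0) (α : Fin p) : f α = 0 := by
  refine h.eq_zero_of_sum_even (fun a => odd_mem_functions (hf a)) ?_ α
  have h1 : ∀ a, e a * f a = f a * e a := fun a => by
    have := Y.supercomm U _ _ _ _ (h.1 a) (hf a)
    simpa using this
  simp only [h1, h0]

theorem coe_sum_even {κ : Type*} (s : Finset κ) (f : κ → Y.even U) :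
    ((∑ x ∈ s, f x : Y.even U) : Y.form U) = ∑ x ∈ s, (f x : Y.form U) :=
  map_sum (Y.even U).val f s

end SuperSpace

/-! ### Constant gauge transformations and sheared bilinears -/

namespace MajoranaRep

open SuperSpace

variable (M : MajoranaRep)

theorem P_apply (i j : Fin 32) : M.P i j = if i = j ∧ i.val < 16 then 1 else 0 := by
  rw [M.P_eq_diagonal, Matrix.diagonal_apply]
  by_cases h : i = j <;> simp [h]

theorem apply_chirP_chirN {g : Matrix (Fin 32) (Fin 32) ℝ} (hg : g * M.P = M.P * g)
    (α β : Fin 16) : g (chirP α) (chirN β) = 0 := by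
  have := congrFun (congrFun hg (chirP α)) (chirN β)
  rw [M.P_eq_diagonal, Matrix.mul_diagonal, Matrix.diagonal_mul, if_neg (not_chirN_lt β),
    if_pos (chirP_lt α), mul_zero, one_mul] at this
  exact this.symm

theorem apply_chirN_chirP {g : Matrix (Fin 32) (Fin 32) ℝ} (hg : g * M.P = M.P * g)
    (α β : Fin 16) : g (chirN α) (chirP β) = 0 := by
  have := congrFun (congrFun hg (chirN α)) (chirP β)
  rw [M.P_eq_diagonal, Matrix.mul_diagonal, Matrix.diagonal_mul, if_pos (chirP_lt β),
    if_neg (not_chirN_lt α), mul_one, zero_mul] at this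
  exact this

/-- Provides the gauge transformations actually used: `±1` and `Γ_i Γ_j`, which act diagonally on
vectors. -/
theorem isTransversalSpin_const (X : SuperSpace.{u, v}) (U : Opens X.body)
    {g : Matrix (Fin 32) (Fin 32) ℝ} {r : Fin 11 → ℝ}
    (h1 : ∀ b, g * M.Γ b = r b • (M.Γ b * g)) (h2 : g.transpose * M.C * g = M.C)
    (h3 : ∀ a, r (tang a) = 1) :
    M.IsTransversalSpin X U (g.map (algebraMap ℝ (X.form U)))
      (Matrix.diagonal fun b => algebraMap ℝ (X.form U) (r b)) := by
  have hmem : ∀ x : ℝ, algebraMap ℝ (X.form U) x ∈ X.gr U (0, 0) := fun x =>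
    (X.even U).algebraMap_mem x
  refine ⟨⟨fun α β => hmem _, fun a b => ?_, fun b => ?_, ?_⟩, fun a b => ?_⟩
  · rw [Matrix.diagonal_apply]
    split
    · exact hmem _
    · exact Submodule.zero_mem _
  · rw [Finset.sum_eq_single b]
    · rw [Matrix.diagonal_apply_eq, ← Matrix.map_mul, ← Matrix.map_mul, h1]
      ext α β
      rw [Matrix.smul_apply, smul_eq_mul, Matrix.map_apply, Matrix.map_apply, Matrix.smul_apply,
        smul_eq_mul, map_mul]
    · intro a _ hab
      rw [Matrix.diagonal_apply_ne _ hab, zero_smul]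
    · simp
  · rw [← Matrix.transpose_map, ← Matrix.map_mul, ← Matrix.map_mul, h2]
  · constructor
    · rw [Matrix.diagonal_apply]
      by_cases h : tang a = b
      · rw [if_pos h, if_pos h, h3, map_one]
      · rw [if_neg h, if_neg h]
    · rw [Matrix.diagonal_apply]
      by_cases h : b = tang a
      · rw [if_pos h, if_pos h, h, h3, map_one]
      · rw [if_neg h, if_neg h]

theorem Γ_pair_mul_P (i j : Fin 5) : (M.Γ (transv i) * M.Γ (transv j)) * M.P =
    M.P * (M.Γ (transv i) * M.Γ (transv j)) := by
  rw [mul_assoc, M.transv_mul_P, ← mul_assoc, M.transv_mul_P, mul_assoc]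

theorem Γ_pair_mul_Γ {i j : Fin 5} (hij : i ≠ j) (b : Fin 11) :
    (M.Γ (transv i) * M.Γ (transv j)) * M.Γ b =
      (if b = transv i ∨ b = transv j then -1 else 1 : ℝ) •
        (M.Γ b * (M.Γ (transv i) * M.Γ (transv j))) := by
  have hne := transv_injective.ne hij
  by_cases hi : b = transv i
  · subst hi
    rw [if_pos (Or.inl rfl), mul_assoc, M.anticomm hne.symm, ← mul_assoc]
    simp [mul_assoc]
  · by_cases hj : b = transv j
    · subst hj
      rw [if_pos (Or.inr rfl), ← mul_assoc, M.anticomm hi]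
      simp [mul_assoc]
    · rw [if_neg (by tauto), one_smul, mul_assoc, M.anticomm (Ne.symm hj), mul_neg, ← mul_assoc,
        M.anticomm (Ne.symm hi), neg_mul, neg_neg, mul_assoc]

theorem Γ_pair_transpose_mul (i j : Fin 5) :
    (M.Γ (transv i) * M.Γ (transv j)).transpose * M.C * (M.Γ (transv i) * M.Γ (transv j)) =
      M.C := by
  have h1 : (M.Γ (transv j)).transpose * (M.Γ (transv i)).transpose * M.C =
      M.C * (M.Γ (transv j) * M.Γ (transv i)) := by
    rw [mul_assoc, M.adjoint, mul_neg, ← mul_assoc, M.adjoint, neg_mul, neg_neg, mul_assoc]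
  have h2 : M.Γ (transv j) * M.Γ (transv i) * (M.Γ (transv i) * M.Γ (transv j)) = 1 := by
    rw [mul_assoc, ← mul_assoc (M.Γ (transv i)), M.sq, eta_transv, one_smul, one_mul, M.sq,
      eta_transv, one_smul]
  rw [Matrix.transpose_mul, h1, mul_assoc, h2, mul_one]

/-- The entries of the shear are even and move past the spinors, so the computation takes place with
matrices over a commutative ring. -/
theorem pair_shear {Y : SuperSpace.{u, v}} {U : Opens Y.body} {s x : Fin 32 → Y.form U}
    {S : Matrix (Fin 32) (Fin 32) (Y.even U)} (hs : ∀ α, s α ∈ Y.gr U (1, 1))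
    (hx : ∀ α, x α = ∑ β, (S α β : Y.form U) * s β) (K : Matrix (Fin 32) (Fin 32) ℝ) :
    M.pair K x x = ∑ α, ∑ β, s α * s β *
      ((S.transpose * (M.form (Y.even U) * realMatrix (Y.even U) K) * S) α β : Y.even U) := by
  have h1 : ∀ α β γ δ, (S α γ : Y.form U) * s γ * ((S β δ : Y.form U) * s δ) =
      s γ * s δ * ((S α γ * S β δ : Y.even U) : Y.form U) := fun α β γ δ => by
    have e1 := even_mul_comm (S α γ).2 (hs γ)
    have e2 := even_mul_comm (S β δ).2 (hs δ)
    have e3 := even_mul_comm (S α γ).2 (hs δ)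
    rw [e1, e2, mul_assoc, ← mul_assoc (S α γ : Y.form U), e3]
    simp only [mul_assoc]
    rfl
  unfold pair
  simp only [hx, Finset.sum_mul_sum, h1]
  have h2 : ∀ γ δ, (((S.transpose * (M.form (Y.even U) * realMatrix (Y.even U) K) * S) γ δ :
      Y.even U) : Y.form U) =
      ∑ α, ∑ β, (M.C * K) α β • ((S α γ * S β δ : Y.even U) : Y.form U) := fun γ δ => by
    unfold form
    rw [← map_mul]
    simp only [Matrix.mul_apply, Matrix.transpose_apply, realMatrix_apply, Finset.sum_mul,
      coe_sum_even]
    rw [Finset.sum_comm]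
    refine Finset.sum_congr rfl fun α _ => Finset.sum_congr rfl fun β _ => ?_
    rw [← even_smul_eq, Algebra.smul_def]
    congr 1
    ring
  simp only [h2, Finset.mul_sum, mul_smul_comm, Finset.smul_sum]
  exact sum_comm_pairs _

theorem slash_coe {Y : SuperSpace.{u, v}} {U : Opens Y.body} (T : (Fin 3 → Fin 6) → Y.even U)
    (α β : Fin 32) : M.slash (fun v => (T v : Y.form U)) α β =
      (cliffSlash (M.gen (Y.even U)) T α β : Y.even U) := by
  unfold slash cliffSlash
  have h1 : ∀ v, skew (triple (M.gen (Y.even U))) v =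
      realMatrix (Y.even U) (M.gam (tang ∘ v)) := fun v => by
    have e1 : M.gam (tang ∘ v) = skew (triple fun a => M.Γ (tang a)) v := by
      have : triple (fun a => M.Γ (tang a)) = fun w =>
          (List.ofFn fun i => M.Γ ((tang ∘ w) i)).prod := by
        funext w
        rw [triple_eq_prod]
        rfl
      rw [this]
      rfl
    rw [e1, map_skew_triple]
    rfl
  simp only [h1, Matrix.smul_apply, Matrix.sum_apply, realMatrix_apply]
  rw [even_smul_eq, coe_sum_even]
  congr 1
  refine Finset.sum_congr rfl fun v _ => ?_
  rw [← even_smul_eq]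
  congr 1
  rw [smul_eq_mul, smul_mul_assoc, mul_comm (T v), ← Algebra.smul_def, smul_smul]
  rfl

theorem proj_apply {R : Type*} [CommRing R] [Algebra ℝ R] (i j : Fin 32) :
    M.proj R i j = if i = j ∧ i.val < 16 then 1 else 0 := by
  unfold proj
  rw [realMatrix_apply, M.P_apply]
  split <;> simp

theorem mul_proj_apply_chirP {R : Type*} [CommRing R] [Algebra ℝ R]
    (A : Matrix (Fin 32) (Fin 32) R) (i : Fin 32) (α : Fin 16) :
    (A * M.proj R) i (chirP α) = A i (chirP α) := by
  rw [Matrix.mul_apply, Finset.sum_eq_single (chirP α)]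
  · rw [M.proj_apply, if_pos ⟨rfl, chirP_lt α⟩, mul_one]
  · intro j _ hj
    rw [M.proj_apply, if_neg fun h => hj h.1, mul_zero]
  · simp

theorem mul_proj_apply_chirN {R : Type*} [CommRing R] [Algebra ℝ R]
    (A : Matrix (Fin 32) (Fin 32) R) (i : Fin 32) (β : Fin 16) :
    (A * M.proj R) i (chirN β) = 0 := by
  rw [Matrix.mul_apply]
  refine Finset.sum_eq_zero fun j _ => ?_
  rw [M.proj_apply, if_neg, mul_zero]
  rintro ⟨rfl, h⟩
  exact not_chirN_lt β h

theorem proj_mul_apply_chirP {R : Type*} [CommRing R] [Algebra ℝ R]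
    (A : Matrix (Fin 32) (Fin 32) R) (i : Fin 32) (α : Fin 16) :
    (M.proj R * A) (chirP α) i = A (chirP α) i := by
  rw [Matrix.mul_apply, Finset.sum_eq_single (chirP α)]
  · rw [M.proj_apply, if_pos ⟨rfl, chirP_lt α⟩, one_mul]
  · intro j _ hj
    rw [M.proj_apply, if_neg fun h => hj h.1.symm, zero_mul]
  · simp

theorem proj_mul_apply_chirN {R : Type*} [CommRing R] [Algebra ℝ R]
    (A : Matrix (Fin 32) (Fin 32) R) (i : Fin 32) (β : Fin 16) :
    (M.proj R * A) (chirN β) i = 0 := by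
  rw [Matrix.mul_apply]
  refine Finset.sum_eq_zero fun j _ => ?_
  rw [M.proj_apply, if_neg, zero_mul]
  rintro ⟨-, h⟩
  exact not_chirN_lt β h

/-- A matrix supported on the image of `P` vanishes if its entries there do. -/
theorem shearForm_eq_zero {R : Type*} [CommRing R] [Algebra ℝ R]
    (N K : Matrix (Fin 32) (Fin 32) R)
    (h : ∀ α β, M.shearForm N K (chirP α) (chirP β) = 0) : M.shearForm N K = 0 := by
  ext i j
  rcases chir_cases j with ⟨β, rfl⟩ | ⟨β, rfl⟩
  · rcases chir_cases i with ⟨α, rfl⟩ | ⟨α, rfl⟩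
    · exact h α β
    · have h1 : M.shearForm N K = (M.proj R).transpose *
          ((1 + N).transpose * (M.form R * K) * ((1 + N) * M.proj R)) := by
        unfold shearForm
        rw [Matrix.transpose_mul]
        simp only [mul_assoc]
      have h2 : (M.proj R).transpose = M.proj R := by
        ext i j
        rw [Matrix.transpose_apply, M.proj_apply, M.proj_apply]
        by_cases hij : i = j
        · rw [hij]
        · rw [if_neg fun h => hij h.1.symm, if_neg fun h => hij h.1]
      rw [h1, h2, M.proj_mul_apply_chirN]
      rfl
  · unfold shearForm
    rw [← mul_assoc, M.mul_proj_apply_chirN]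
    rfl

end MajoranaRep

end

noncomputable section

set_option linter.unusedSectionVars false

universe u v w u' v'

/-! ## The super-shear map -/

theorem eq_zero_of_eq_neg {A : Type*} [AddCommGroup A] [Module ℝ A] {x : A} (h : x = -x) :
    x = 0 := by
  have h1 : (2 : ℝ) • x = 0 := by
    rw [two_smul]
    nth_rw 2 [h]
    exact add_neg_cancel x
  exact (smul_eq_zero.1 h1).resolve_left two_ne_zero

namespace M5SuperImmersion

open SuperSpace

variable {M : MajoranaRep} {X : SuperManifold.{u', v'} 11 32} {S : SuperSpacetime.{u', v', w} M X}
  {Y : SuperManifold.{u, v} 6 16} (φ : M5SuperImmersion S Y) (k : S.K)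

/-- Pullback of forms on a patch. -/
def pb (k : S.K) : X.form (S.V k) →ₐ[ℝ] Y.form (φ.U k) := φ.pull (S.V k)

theorem pb_mem {i : ℕ × ZMod 2} {η : X.form (S.V k)} (h : η ∈ X.gr (S.V k) i) :
    φ.pb k η ∈ Y.gr (φ.U k) i := φ.pull_mem _ _ _ h

theorem pb_d (η : X.form (S.V k)) : φ.pb k (X.d _ η) = Y.d _ (φ.pb k η) := φ.pull_d _ _

/-- The even-even components of the super-shear map. -/
def shear00 (k : S.K) : Matrix (Fin 5) (Fin 6) (Y.form (φ.U k)) := φ.Sh00 k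

/-- The components of the super-shear map from odd to even. -/
def shear01 (k : S.K) : Matrix (Fin 5) (Fin 16) (Y.form (φ.U k)) := φ.Sh01 k

/-- The components of the super-shear map from even to odd. -/
def shear10 (k : S.K) : Matrix (Fin 16) (Fin 6) (Y.form (φ.U k)) := φ.Sh10 k

/-- The odd-odd components of the super-shear map. -/
def shear11 (k : S.K) : Matrix (Fin 16) (Fin 16) (Y.form (φ.U k)) := φ.Sh11 k

theorem shear01_mem (i : Fin 5) (α : Fin 16) : φ.shear01 k i α ∈ Y.gr (φ.U k) (0, 1) :=
  φ.Sh01_mem k i α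

theorem shear10_mem (β : Fin 16) (a : Fin 6) : φ.shear10 k β a ∈ Y.gr (φ.U k) (0, 1) :=
  φ.Sh10_mem k β a

theorem shear11_mem (β α : Fin 16) : φ.shear11 k β α ∈ Y.gr (φ.U k) (0, 0) :=
  φ.Sh11_mem k β α

theorem act_P_chirP (x : Fin 32 → X.form (S.V k)) (α : Fin 16) :
    MajoranaRep.act M.P x (chirP α) = x (chirP α) := by
  unfold MajoranaRep.act
  rw [Finset.sum_eq_single (chirP α)]
  · rw [M.P_apply, if_pos ⟨rfl, chirP_lt α⟩, one_smul]
  · intro β _ h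
    rw [M.P_apply, if_neg fun h' => h h'.1.symm, zero_smul]
  · simp

theorem act_P_chirN (x : Fin 32 → X.form (S.V k)) (β : Fin 16) :
    MajoranaRep.act M.P x (chirN β) = 0 := by
  unfold MajoranaRep.act
  refine Finset.sum_eq_zero fun j _ => ?_
  rw [M.P_apply, if_neg fun h' => not_chirN_lt β h'.2, zero_smul]

theorem act_compl (x : Fin 32 → X.form (S.V k)) (α : Fin 32) :
    MajoranaRep.act (1 - M.P) x α = x α - MajoranaRep.act M.P x α := by
  unfold MajoranaRep.act
  simp only [Matrix.sub_apply, sub_smul, Finset.sum_sub_distrib]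
  congr 1
  simp [Matrix.one_apply]

theorem ψ_chirP (α : Fin 16) : φ.ψ k (chirP α) = φ.pb k (S.Ψ k (chirP α)) := by
  unfold ψ
  rw [act_P_chirP]
  rfl

theorem ψ_chirN (β : Fin 16) : φ.ψ k (chirN β) = 0 := by
  unfold ψ
  rw [act_P_chirN]
  exact map_zero (φ.pb k)

theorem e_mem (a : Fin 6) : φ.e k a ∈ Y.gr (φ.U k) (1, 0) := (φ.isCoframe k).1 a

theorem ψ_mem (α : Fin 32) : φ.ψ k α ∈ Y.gr (φ.U k) (1, 1) := by
  rcases chir_cases α with ⟨α, rfl⟩ | ⟨β, rfl⟩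
  · exact (φ.isCoframe k).2.1 α
  · rw [ψ_chirN]; exact Submodule.zero_mem _

/-- The pullbacks of a constant gauge transformation of the coframe. -/
theorem pull_const_vector (r : Fin 11 → ℝ) (a : Fin 11) :
    φ.pb k ((Matrix.diagonal fun b => algebraMap ℝ (X.form (S.V k)) (r b)).mulVec (S.E k) a) =
      r a • φ.pb k (S.E k a) := by
  rw [Matrix.mulVec_diagonal, ← Algebra.smul_def, map_smul]

theorem pull_const_spinor (g : Matrix (Fin 32) (Fin 32) ℝ) (α : Fin 32) :
    φ.pb k ((g.map (algebraMap ℝ (X.form (S.V k)))).mulVec (S.Ψ k) α) =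
      ∑ β, g α β • φ.pb k (S.Ψ k β) := by
  simp only [Matrix.mulVec, dotProduct, Matrix.map_apply, ← Algebra.smul_def, map_sum, map_smul]

variable {k}

/-- The same shear map serves in every gauge. Because `g` commutes with `P`, it acts separately on
the two halves of the spinor, and comparison of different `g` constrains the shear. -/
theorem darboux_const {g : Matrix (Fin 32) (Fin 32) ℝ} {r : Fin 11 → ℝ}
    (h1 : ∀ b, g * M.Γ b = r b • (M.Γ b * g)) (h2 : g.transpose * M.C * g = M.C)
    (h3 : ∀ a, r (tang a) = 1) (hg : g * M.P = M.P * g) :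
    (∀ i : Fin 5, r (transv i) • φ.pb k (S.E k (transv i)) =
      ∑ a, φ.shear00 k i a * φ.e k a +
        ∑ α, φ.shear01 k i α * ∑ β, g (chirP α) (chirP β) • φ.ψ k (chirP β)) ∧
    ∀ γ : Fin 16, ∑ β, g (chirN γ) (chirN β) • φ.pb k (S.Ψ k (chirN β)) =
      ∑ a, φ.shear10 k γ a * φ.e k a +
        ∑ α, φ.shear11 k γ α * ∑ β, g (chirP α) (chirP β) • φ.ψ k (chirP β) := by
  have hT := M.isTransversalSpin_const X.toSuperSpace (S.V k) h1 h2 h3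
  have hP : ∀ α, ∑ β, g (chirP α) β • φ.pb k (S.Ψ k β) =
      ∑ β, g (chirP α) (chirP β) • φ.ψ k (chirP β) := fun α => by
    rw [sum_chir]
    simp only [M.apply_chirP_chirN hg, zero_smul, Finset.sum_const_zero, add_zero, ψ_chirP]
  have hN : ∀ γ, ∑ β, g (chirN γ) β • φ.pb k (S.Ψ k β) =
      ∑ β, g (chirN γ) (chirN β) • φ.pb k (S.Ψ k (chirN β)) := fun γ => by
    rw [sum_chir]
    simp only [M.apply_chirN_chirP hg, zero_smul, Finset.sum_const_zero, zero_add]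
  constructor
  · intro i
    have : φ.pb k (Matrix.mulVec _ _ _) = ∑ a, φ.shear00 k i a * φ.pb k (Matrix.mulVec _ _ _) +
      ∑ α, φ.shear01 k i α * φ.pb k (Matrix.mulVec _ _ _) := φ.darboux_even k _ _ hT i
    simp only [pull_const_vector, pull_const_spinor, h3, one_smul, hP] at this
    exact this
  · intro γ
    have : φ.pb k (Matrix.mulVec _ _ _) = ∑ a, φ.shear10 k γ a * φ.pb k (Matrix.mulVec _ _ _) +
      ∑ α, φ.shear11 k γ α * φ.pb k (Matrix.mulVec _ _ _) := φ.darboux_odd k _ _ hT γ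
    simp only [pull_const_vector, pull_const_spinor, h3, one_smul, hP, hN] at this
    exact this

theorem darboux_one :
    (∀ i : Fin 5, φ.pb k (S.E k (transv i)) =
      ∑ a, φ.shear00 k i a * φ.e k a + ∑ α, φ.shear01 k i α * φ.ψ k (chirP α)) ∧
    ∀ γ : Fin 16, φ.pb k (S.Ψ k (chirN γ)) =
      ∑ a, φ.shear10 k γ a * φ.e k a + ∑ α, φ.shear11 k γ α * φ.ψ k (chirP α) := by
  have := φ.darboux_const (k := k) (g := 1) (r := fun _ => 1) (by simp) (by simp) (by simp) (by simp)
  simpa [Matrix.one_apply, chirP_injective.eq_iff, chirN_injective.eq_iff]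
    using this

/-- The element `-1` covers the identity rotation; only the spinors change sign. -/
theorem darboux_neg_one :
    (∀ i : Fin 5, φ.pb k (S.E k (transv i)) =
      ∑ a, φ.shear00 k i a * φ.e k a - ∑ α, φ.shear01 k i α * φ.ψ k (chirP α)) ∧
    ∀ γ : Fin 16, -φ.pb k (S.Ψ k (chirN γ)) =
      ∑ a, φ.shear10 k γ a * φ.e k a - ∑ α, φ.shear11 k γ α * φ.ψ k (chirP α) := by
  have := φ.darboux_const (k := k) (g := -1) (r := fun _ => 1) (by simp) (by simp) (by simp)
    (by simp)
  simpa [Matrix.one_apply, chirP_injective.eq_iff, chirN_injective.eq_iff, sub_eq_add_neg] using this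

theorem shear01_eq_zero (i : Fin 5) (α : Fin 16) : φ.shear01 k i α = 0 := by
  refine (φ.isCoframe k).eq_zero_of_odd_mul_odd (φ.shear01_mem k i) ?_ α
  have h := (φ.darboux_one (k := k).1 i).symm.trans (φ.darboux_neg_one.1 i)
  rw [sub_eq_add_neg] at h
  exact eq_zero_of_eq_neg (add_left_cancel h)

theorem shear10_eq_zero (γ : Fin 16) (a : Fin 6) : φ.shear10 k γ a = 0 := by
  refine (φ.isCoframe k).eq_zero_of_odd_mul_even (φ.shear10_mem k γ) ?_ a
  have h1 := φ.darboux_one (k := k).2 γ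
  have h2 := φ.darboux_neg_one (k := k).2 γ
  rw [h1] at h2
  have h3 : (2 : ℝ) • ∑ a, φ.shear10 k γ a * φ.e k a = 0 := by
    rw [two_smul]
    have := sub_eq_zero.2 h2.symm
    rw [← this]
    abel
  exact (smul_eq_zero.1 h3).resolve_left two_ne_zero

-- All terms with `τ` in the bosonic and the rheonomy equations therefore vanish.
variable (k) in
theorem τ_eq_zero : φ.τ k = 0 := by
  funext a i
  unfold τ
  refine Fin.addCases (m := 16) (n := 16) (fun α => ?_) (fun β => ?_) i
  · rw [Fin.append_left]; rfl
  · rw [Fin.append_right]; exact φ.shear10_eq_zero β a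

theorem exists_transv_ne (i : Fin 5) : ∃ j : Fin 5, i ≠ j :=
  ⟨if i = 0 then 1 else 0, by split <;> simp_all⟩

/-- `Γ_i Γ_j` covers the half-turn in the transversal plane of `i` and `j`. -/
theorem darboux_pair {i j : Fin 5} (hij : i ≠ j) :
    (∀ l : Fin 5, (if transv l = transv i ∨ transv l = transv j then -1 else 1 : ℝ) •
        φ.pb k (S.E k (transv l)) = ∑ a, φ.shear00 k l a * φ.e k a +
        ∑ α, φ.shear01 k l α * ∑ β, (M.Γ (transv i) * M.Γ (transv j)) (chirP α) (chirP β) •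
          φ.ψ k (chirP β)) ∧
    ∀ γ : Fin 16, ∑ β, (M.Γ (transv i) * M.Γ (transv j)) (chirN γ) (chirN β) •
        φ.pb k (S.Ψ k (chirN β)) = ∑ a, φ.shear10 k γ a * φ.e k a +
        ∑ α, φ.shear11 k γ α * ∑ β, (M.Γ (transv i) * M.Γ (transv j)) (chirP α) (chirP β) •
          φ.ψ k (chirP β) :=
  φ.darboux_const (M.Γ_pair_mul_Γ hij) (M.Γ_pair_transpose_mul i j)
    (fun a => if_neg (by simp [tang_ne_transv])) (M.Γ_pair_mul_P i j)

theorem pull_transv_eq_zero (i : Fin 5) : φ.pb k (S.E k (transv i)) = 0 := by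
  obtain ⟨j, hij⟩ := exists_transv_ne i
  have h1 := φ.darboux_one (k := k).1 i
  have h2 := (φ.darboux_pair (k := k) hij).1 i
  simp only [φ.shear01_eq_zero, zero_mul, Finset.sum_const_zero, add_zero, true_or, if_true] at h1 h2
  rw [← h1, neg_smul, one_smul] at h2
  exact eq_zero_of_eq_neg h2.symm

/-- The odd-odd part of the super-shear map as a matrix of even superfunctions. -/
def shear (k : S.K) : Matrix (Fin 32) (Fin 32) (Y.even (φ.U k)) :=
  Matrix.of (Fin.addCases (m := 16) (n := 16) (fun _ _ => 0) fun β =>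
    Fin.addCases (m := 16) (n := 16) (fun α => ⟨φ.shear11 k β α, φ.shear11_mem k β α⟩) fun _ => 0)

theorem shear_chirP (α : Fin 16) (j : Fin 32) : φ.shear k (chirP α) j = 0 := by
  unfold shear chirP
  rw [Matrix.of_apply, Fin.addCases_left]

theorem shear_chirN_chirP (β α : Fin 16) :
    φ.shear k (chirN β) (chirP α) = ⟨φ.shear11 k β α, φ.shear11_mem k β α⟩ := by
  unfold shear chirP chirN
  rw [Matrix.of_apply, Fin.addCases_right, Fin.addCases_left]

theorem shear_chirN (i : Fin 32) (α : Fin 16) : φ.shear k i (chirN α) = 0 := by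
  rcases chir_cases i with ⟨β, rfl⟩ | ⟨β, rfl⟩
  · exact φ.shear_chirP β _
  · unfold shear chirN
    rw [Matrix.of_apply, Fin.addCases_right, Fin.addCases_right]

theorem compl_mul_shear_mul_proj :
    (1 - M.proj _) * φ.shear k * M.proj _ = φ.shear k := by
  have h1 : φ.shear k * M.proj _ = φ.shear k := by
    ext i j : 2
    rcases chir_cases j with ⟨β, rfl⟩ | ⟨β, rfl⟩
    · rw [M.mul_proj_apply_chirP]
    · rw [M.mul_proj_apply_chirN, φ.shear_chirN]
  have h2 : M.proj _ * φ.shear k = 0 := by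
    ext i j : 2
    rcases chir_cases i with ⟨β, rfl⟩ | ⟨β, rfl⟩
    · rw [M.proj_mul_apply_chirP, φ.shear_chirP]; rfl
    · rw [M.proj_mul_apply_chirN]; rfl
  rw [sub_mul, h2, sub_zero, one_mul, h1]

theorem pull_chirN (γ : Fin 16) : φ.pb k (S.Ψ k (chirN γ)) =
    ∑ α, φ.shear11 k γ α * φ.ψ k (chirP α) := by
  have := φ.darboux_one (k := k).2 γ
  simpa only [φ.shear10_eq_zero, zero_mul, Finset.sum_const_zero, zero_add] using this

/-- The rotated complementary spinor is expressed by the shear in two ways, before and after the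
rotation; the coefficients of `ψ` agree by uniqueness of expansions. -/
theorem pair_mul_shear {i j : Fin 5} (hij : i ≠ j) :
    M.tgen i * M.tgen j * φ.shear k = φ.shear k * (M.tgen i * M.tgen j) := by
  have hd := (φ.darboux_pair (k := k) hij).2
  have hgP := M.Γ_pair_mul_P i j
  have hG : M.tgen (R := Y.even (φ.U k)) i * M.tgen j =
      realMatrix (Y.even (φ.U k)) (M.Γ (transv i) * M.Γ (transv j)) := (map_mul _ _ _).symm
  rw [hG]
  set g := M.Γ (transv i) * M.Γ (transv j)
  ext I J : 2
  rw [Matrix.mul_apply, Matrix.mul_apply, sum_chir, sum_chir]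
  simp only [φ.shear_chirP, φ.shear_chirN, zero_mul, mul_zero, Finset.sum_const_zero, zero_add,
    add_zero, realMatrix_apply]
  rcases chir_cases J with ⟨β, rfl⟩ | ⟨β, rfl⟩
  swap
  · simp only [φ.shear_chirN, M.apply_chirP_chirN hgP, map_zero, mul_zero]
  rcases chir_cases I with ⟨γ, rfl⟩ | ⟨γ, rfl⟩
  · simp only [φ.shear_chirP, M.apply_chirP_chirN hgP, map_zero, zero_mul]
  simp only [φ.shear_chirN_chirP]
  have h0 := hd γ
  simp only [φ.shear10_eq_zero, zero_mul, Finset.sum_const_zero, zero_add, φ.pull_chirN,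
    Finset.mul_sum, Finset.smul_sum] at h0
  rw [Finset.sum_comm, Finset.sum_comm (f := fun α β => φ.shear11 k γ α * _)] at h0
  rw [← sub_eq_zero, ← Finset.sum_sub_distrib] at h0
  have h1 := (φ.isCoframe k).eq_zero_of_even_mul_odd (f := fun β =>
      ∑ δ, g (chirN γ) (chirN δ) • φ.shear11 k δ β - ∑ α, φ.shear11 k γ α * (algebraMap ℝ _ (g (chirP α) (chirP β))))
    (fun β => ?_) ?_ β
  · rw [coe_sum_even, coe_sum_even]
    refine Eq.trans ?_ (sub_eq_zero.1 h1)
    refine Finset.sum_congr rfl fun δ _ => ?_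
    rw [Algebra.smul_def]
    rfl
  · refine Submodule.sub_mem _ (Submodule.sum_mem _ fun δ _ => Submodule.smul_mem _ _ (φ.shear11_mem _ _ _))
      (Submodule.sum_mem _ fun δ _ => ?_)
    exact (Y.even _).mul_mem (φ.shear11_mem _ _ _) ((Y.even _).algebraMap_mem _)
  · rw [← h0]
    refine Finset.sum_congr rfl fun β _ => ?_
    rw [sub_mul, Finset.sum_mul, Finset.sum_mul]
    congr 1
    · exact Finset.sum_congr rfl fun δ _ => smul_mul_assoc _ _ _
    · refine Finset.sum_congr rfl fun δ _ => ?_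
      rw [mul_assoc, ← Algebra.smul_def]

theorem pull_Ψ (α : Fin 32) : φ.pb k (S.Ψ k α) =
    φ.ψ k α + ∑ β, (φ.shear k α β : Y.form (φ.U k)) * φ.ψ k β := by
  rw [sum_chir]
  simp only [ψ_chirN, mul_zero, Finset.sum_const_zero, add_zero]
  rcases chir_cases α with ⟨α, rfl⟩ | ⟨β, rfl⟩
  · simp only [φ.shear_chirP, φ.ψ_chirP, ZeroMemClass.coe_zero, zero_mul, Finset.sum_const_zero,
      add_zero]
  · simp only [ψ_chirN, zero_add, φ.pull_chirN, φ.shear_chirN_chirP]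

theorem sum_proj_mul (α : Fin 32) :
    ∑ β, (M.proj (Y.even (φ.U k)) α β : Y.form (φ.U k)) * φ.ψ k β = φ.ψ k α := by
  rcases chir_cases α with ⟨α, rfl⟩ | ⟨β, rfl⟩
  · rw [Finset.sum_eq_single (chirP α)]
    · rw [M.proj_apply, if_pos ⟨rfl, chirP_lt α⟩]; exact one_mul _
    · intro β _ h
      rw [M.proj_apply, if_neg fun h' => h h'.1.symm]; exact zero_mul _
    · simp
  · rw [ψ_chirN]
    refine Finset.sum_eq_zero fun j _ => ?_
    rw [M.proj_apply, if_neg fun h' => not_chirN_lt β h'.2]; exact zero_mul _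

theorem pull_Ψ_of_shear {N : Matrix (Fin 32) (Fin 32) (Y.even (φ.U k))}
    (hN : φ.shear k = N * M.proj _) (α : Fin 32) : φ.pb k (S.Ψ k α) =
      ∑ β, ((((1 + N) * M.proj (Y.even (φ.U k))) α β : Y.even (φ.U k)) : Y.form (φ.U k)) * φ.ψ k β := by
  rw [φ.pull_Ψ, hN, add_mul, one_mul, ← φ.sum_proj_mul α, ← Finset.sum_add_distrib]
  refine Finset.sum_congr rfl fun β _ => ?_
  rw [← add_mul]
  rfl

theorem pull_pair (K : Matrix (Fin 32) (Fin 32) ℝ) {N : Matrix (Fin 32) (Fin 32) (Y.even (φ.U k))}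
    (hN : φ.shear k = N * M.proj _) : φ.pb k (M.pair K (S.Ψ k) (S.Ψ k)) =
      ∑ α, ∑ β, φ.ψ k (chirP α) * φ.ψ k (chirP β) *
        (M.shearForm N (realMatrix _ K) (chirP α) (chirP β) : Y.even (φ.U k)) := by
  have h1 : φ.pb k (M.pair K (S.Ψ k) (S.Ψ k)) =
      M.pair K (fun α => φ.pb k (S.Ψ k α)) fun α => φ.pb k (S.Ψ k α) := by
    unfold MajoranaRep.pair
    simp only [map_sum, map_smul, map_mul]
  rw [h1, M.pair_shear (φ.ψ_mem k) (φ.pull_Ψ_of_shear hN), sum_chir]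
  simp only [sum_chir, ψ_chirN, zero_mul, mul_zero, Finset.sum_const_zero, add_zero]
  rfl

end M5SuperImmersion

end

noncomputable section

set_option linter.unusedSectionVars false

universe u v w u' v'

/-! ## The self-dual tensor of a super-shear map -/

namespace SuperSpace

variable {Y : SuperSpace.{u, v}} {U V : Opens Y.body}

theorem isSkew_coe {n : ℕ} {ι : Type*} {T : (Fin n → ι) → Y.even U} :
    IsSkew (fun v => (T v : Y.form U)) ↔ IsSkew T := by
  have h : ∀ (z : ℤˣ) (x : Y.even U), (((z : ℤ) • x : Y.even U) : Y.form U) =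
      (z : ℤ) • (x : Y.form U) := fun z x => map_zsmul (Y.even U).val _ _
  constructor
  · intro hT v σ
    apply Subtype.ext
    rw [h]
    exact hT v σ
  · intro hT v σ
    change ((T (v ∘ σ) : Y.even U) : Y.form U) = _
    rw [hT v σ, h]

theorem hodgeStar_coe (T : (Fin 3 → Fin 6) → Y.even U) :
    hodgeStar (fun v => (T v : Y.form U)) = fun v => ((hodgeStar T v : Y.even U) : Y.form U) :=
  funext fun v => (map_hodgeStar (Y.even U).val.toLinearMap T v).symm

variable {q : ℕ} {ψ : Fin q → Y.form U}

theorem quadratic_mem_oddPoly (hψ : ∀ α, ψ α ∈ Y.gr U (1, 1)) (c : Fin q → Fin q → Y.even U) :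
    ∑ α, ∑ β, ψ α * ψ β * (c α β : Y.form U) ∈ oddPoly ψ :=
  Submodule.sum_mem _ fun α _ => Submodule.sum_mem _ fun β _ =>
    pair_mul_mem_oddPoly hψ α β (even_mem_functions (c α β).2)

end SuperSpace

namespace MajoranaRep

open SuperSpace

variable (M : MajoranaRep)

theorem eq_zero_of_mul_proj {R : Type*} [CommRing R] [Algebra ℝ R]
    {A B : Matrix (Fin 32) (Fin 32) R} (h : ∀ i α, A i (chirP α) = (B * M.proj R) i (chirP α))
    (hA : ∀ i β, A i (chirN β) = 0) : A = B * M.proj R := by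
  ext i j
  rcases chir_cases j with ⟨α, rfl⟩ | ⟨β, rfl⟩
  · exact h i α
  · rw [hA, M.mul_proj_apply_chirN]

end MajoranaRep

namespace M5SuperImmersion

open SuperSpace

variable {M : MajoranaRep} {X : SuperManifold.{u', v'} 11 32} {S : SuperSpacetime.{u', v', w} M X}
  {Y : SuperManifold.{u, v} 6 16} (φ : M5SuperImmersion S Y) {k : S.K}

/-- Commutation with Spin(5) leaves a vector `y` besides the 3-form. Since `φ^* E^i = 0`, the
transversal torsion constraint equates a multiple of `e` with a quadratic form in `ψ` that is
proportional to `y`; hence `y = 0`. -/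
theorem exists_shear_eq : ∃ T : (Fin 3 → Fin 6) → Y.even (φ.U k), IsSkew T ∧ hodgeStar T = T ∧
    φ.shear k = cliffSlash (M.gen _) T * M.proj _ := by
  obtain ⟨y, T, hs, hT, hN⟩ := M.mem_chiralSpan (φ.compl_mul_shear_mul_proj (k := k))
    fun i j hij => φ.pair_mul_shear hij
  refine ⟨T, hs, hT, ?_⟩
  suffices hy : y = 0 by rw [hN, hy]; simp
  have hcf := φ.isCoframe k
  have h1 := congrArg (φ.pb k) (S.torsion k (transv 0))
  rw [map_add, φ.pb_d, φ.pull_transv_eq_zero, map_zero, zero_add, map_sum, sum_tang_transv] at h1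
  simp only [map_mul, φ.pull_transv_eq_zero, mul_zero, Finset.sum_const_zero, add_zero] at h1
  rw [φ.pull_pair _ hN, eta_transv, one_smul] at h1
  set A := M.shearForm (∑ a, y a • M.gen (Y.even (φ.U k)) a + cliffSlash (M.gen _) T)
    (realMatrix _ (M.Γ (transv 0))) with hA
  have hA' : A = (2 : ℝ) • (M.form _ * (M.tgen 0 * ∑ a, y a • (M.gen _ a * M.proj _))) :=
    M.shearForm_tgen y T 0
  -- Multiplication by all the `e` annihilates the connection terms and leaves the quadratic form.
  have hq := hcf.eq_zero_of_wedge_univ_mul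
    (quadratic_mem_oddPoly hcf.2.1 fun α β => A (chirP α) (chirP β)) (by
      rw [← h1, Finset.mul_sum]
      refine Finset.sum_eq_zero fun a _ => ?_
      have h2 : φ.pb k (S.conn k (transv 0) (tang a)) ∈ Y.gr (φ.U k) (1, 0) :=
        φ.pb_mem k (S.conn_mem k _ _)
      have h3 := Y.supercomm _ _ _ _ _ h2 (φ.e_mem k a)
      change _ * (_ * φ.e k a) = 0
      rw [h3, mul_smul_comm, ← mul_assoc, wedge_univ_mul (φ.e_mem k), zero_mul, smul_zero])
  have hsymm : A.transpose = A := by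
    rw [hA']
    simp only [Finset.mul_sum, mul_smul_comm, Matrix.transpose_smul, Matrix.transpose_sum,
      M.transpose_form_tgen_gen_proj]
  have hz := hcf.eq_zero_of_quadratic (fun α β => even_mem_functions (A (chirP α) (chirP β)).2)
    (fun α β => by
      conv_lhs => rw [← hsymm]
      rfl) hq
  have hA0 : A = 0 := M.shearForm_eq_zero _ _ fun α β => Subtype.ext (hz α β)
  rw [hA'] at hA0
  have h4 := (smul_eq_zero.1 hA0).resolve_left two_ne_zero
  have h5 := (M.isUnit_form.mul_right_eq_zero).1 h4
  exact M.eq_zero_of_sum_gen y (((M.isUnit_tgen 0).mul_right_eq_zero).1 h5)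

theorem pull_act_compl (α : Fin 32) : φ.pb k (MajoranaRep.act (1 - M.P) (S.Ψ k) α) =
    ∑ β, (φ.shear k α (chirP β) : Y.form (φ.U k)) * φ.ψ k (chirP β) := by
  rw [act_compl, map_sub, φ.pull_Ψ, sum_chir]
  simp only [ψ_chirN, mul_zero, Finset.sum_const_zero, add_zero]
  exact add_sub_cancel_left _ _

theorem shear_eq_iff (T : (Fin 3 → Fin 6) → Y.even (φ.U k)) :
    (∀ α : Fin 32, φ.pb k (MajoranaRep.act (1 - M.P) (S.Ψ k) α) =
      (M.slash fun v => (T v : Y.form (φ.U k))).mulVec (φ.ψ k) α + ∑ a, φ.τ k a α * φ.e k a) ↔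
    φ.shear k = cliffSlash (M.gen _) T * M.proj _ := by
  have h1 : ∀ α, (M.slash fun v => (T v : Y.form (φ.U k))).mulVec (φ.ψ k) α +
      ∑ a, φ.τ k a α * φ.e k a = ∑ β, ((cliffSlash (M.gen _) T * M.proj _ :
        Matrix (Fin 32) (Fin 32) (Y.even (φ.U k))) α (chirP β) : Y.form (φ.U k)) *
          φ.ψ k (chirP β) := fun α => by
    simp only [φ.τ_eq_zero k, Pi.zero_apply, zero_mul, Finset.sum_const_zero, add_zero,
      Matrix.mulVec, dotProduct, sum_chir, ψ_chirN, mul_zero, M.slash_coe, M.mul_proj_apply_chirP]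
  simp only [h1, φ.pull_act_compl]
  constructor
  · intro h
    refine M.eq_zero_of_mul_proj (fun i α => ?_) fun i β => φ.shear_chirN i β
    have h2 := sub_eq_zero.2 (h i)
    rw [← Finset.sum_sub_distrib] at h2
    simp only [← sub_mul] at h2
    have h3 := (φ.isCoframe k).eq_zero_of_even_mul_odd
      (fun α => Submodule.sub_mem _ (Subtype.prop _) (Subtype.prop _)) h2 α
    exact Subtype.ext (sub_eq_zero.1 h3)
  · intro h α
    rw [h]

variable {φ} in
theorem IsShearTensor.exists_eq {Ht : φ.Tensor3} (h : φ.IsShearTensor Ht) (k : S.K) :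
    ∃ T : (Fin 3 → Fin 6) → Y.even (φ.U k), IsSkew T ∧ hodgeStar T = T ∧
      φ.shear k = cliffSlash (M.gen _) T * M.proj _ ∧
      Ht k = fun v => (T v : Y.form (φ.U k)) := by
  obtain ⟨h1, h2, h3, h4⟩ := h k
  let T : (Fin 3 → Fin 6) → Y.even (φ.U k) := fun v => ⟨Ht k v, h1 v⟩
  refine ⟨T, isSkew_coe.1 h2, funext fun v => Subtype.ext ?_, (φ.shear_eq_iff T).1 h4, rfl⟩
  exact (congrFun (hodgeStar_coe T) v).symm.trans (congrFun h3 v)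

theorem existsUnique_shearTensor : ∃! Ht : φ.Tensor3, φ.IsShearTensor Ht := by
  choose T hs hT hN using fun k => φ.exists_shear_eq (k := k)
  refine ⟨fun k v => T k v, fun k => ⟨fun v => (T k v).2, isSkew_coe.2 (hs k), ?_,
    (φ.shear_eq_iff (T k)).2 (hN k)⟩, ?_⟩
  · exact (hodgeStar_coe (T k)).trans (by rw [hT k])
  · intro Ht h
    funext k v
    obtain ⟨T', hs', hT', hN', hH⟩ := h.exists_eq k
    rw [hH]
    have h1 : cliffSlash (M.gen (Y.even (φ.U k))) (T' - T k) * M.proj _ = 0 := by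
      have h2 : cliffSlash (M.gen _) (T' - T k) = cliffSlash (M.gen (Y.even (φ.U k))) T' -
          cliffSlash (M.gen _) (T k) := by
        rw [eq_sub_iff_add_eq, ← cliffSlash_add, sub_add_cancel]
      rw [h2, sub_mul, ← hN', ← hN k, sub_self]
    have h2 : IsSkew (T' - T k) := fun v σ => by
      rw [Pi.sub_apply, Pi.sub_apply, hs' v σ, hs k v σ, smul_sub]
    have h3 : hodgeStar (T' - T k) = T' - T k := by
      rw [eq_sub_iff_add_eq, ← hT k, ← hodgeStar_add, hT k, sub_add_cancel, hT']
    have := congrFun (M.eq_zero_of_cliffSlash h2 h3 h1) v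
    exact congrArg Subtype.val (sub_eq_zero.1 this)

end M5SuperImmersion

end

noncomputable section

set_option linter.unusedSectionVars false

universe u v w u' v'

/-! ## Expansion of the Bianchi identity -/

namespace SuperSpace

variable {Y : SuperSpace.{u, v}} {U V : Opens Y.body} {p : ℕ} {e : Fin p → Y.form U}

theorem wedgeSeq_cons (e : Fin p → Y.form U) {n : ℕ} (a : Fin p) (w : Fin n → Fin p) :
    wedgeSeq e (Fin.cons a w : Fin (n + 1) → Fin p) = e a * wedgeSeq e w := by
  simp [wedgeSeq, List.ofFn_succ]

theorem wedgeSeq_two (e : Fin p → Y.form U) (w : Fin 2 → Fin p) :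
    wedgeSeq e w = e (w 0) * e (w 1) := by
  simp [wedgeSeq, List.ofFn_succ]

theorem wedgeSeq_three (e : Fin p → Y.form U) (w : Fin 3 → Fin p) :
    wedgeSeq e w = e (w 0) * e (w 1) * e (w 2) := by
  simp [wedgeSeq, List.ofFn_succ, mul_assoc]

theorem wedgeSeq_four (e : Fin p → Y.form U) (w : Fin 4 → Fin p) :
    wedgeSeq e w = e (w 0) * e (w 1) * e (w 2) * e (w 3) := by
  simp [wedgeSeq, List.ofFn_succ, mul_assoc]

theorem wedgeSeq_mem (he : ∀ a, e a ∈ Y.gr U (1, 0)) {n : ℕ} (w : Fin n → Fin p) :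
    wedgeSeq e w ∈ Y.gr U (n, 0) := by
  have := prod_ofFn_mem (fun i => e (w i)) (fun _ => (1, 0)) fun i => he (w i)
  simpa [wedgeSeq] using this

theorem two_form_comm {x y : Y.form U} {i : ℕ × ZMod 2} (hx : x ∈ Y.gr U (2, 0))
    (hy : y ∈ Y.gr U i) : x * y = y * x := by
  have := Y.supercomm U _ _ _ _ hx hy
  rw [this]
  simp [pow_mul]

/-- The terms of `d(eᵃ eᵇ eᶜ)` when `deᵃ` is replaced by `xᵃ`. -/
def tripleTerms (e x : Fin p → Y.form U) (v : Fin 3 → Fin p) : Y.form U :=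
  x (v 0) * (e (v 1) * e (v 2)) - x (v 1) * (e (v 0) * e (v 2)) + x (v 2) * (e (v 0) * e (v 1))

theorem d_wedgeSeq_three (he : ∀ a, e a ∈ Y.gr U (1, 0)) (v : Fin 3 → Fin p) :
    Y.d U (wedgeSeq e v) = tripleTerms e (fun a => Y.d U (e a)) v := by
  have hd : ∀ a, Y.d U (e a) ∈ Y.gr U (2, 0) := fun a => Y.d_mem U 1 0 _ (he a)
  have h1 : ∀ a b, Y.d U (e a * e b) = Y.d U (e a) * e b - e a * Y.d U (e b) := fun a b => by
    rw [Y.d_mul U _ _ _ (he a)]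
    simp [sub_eq_add_neg]
  rw [wedgeSeq_three, mul_assoc, Y.d_mul U _ _ _ (he (v 0)), h1, tripleTerms,
    ← two_form_comm (hd (v 2)) (he (v 1)), mul_sub, ← mul_assoc (e (v 0)) (Y.d U (e (v 1))),
    ← two_form_comm (hd (v 1)) (he (v 0)), ← mul_assoc (e (v 0)) (Y.d U (e (v 2))),
    ← two_form_comm (hd (v 2)) (he (v 0))]
  simp only [mul_assoc, pow_one, neg_smul, one_smul, neg_sub]
  abel

theorem sum_mul_tripleTerms {h : (Fin 3 → Fin p) → Y.form U} (hs : IsSkew h)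
    (x : Fin p → Y.form U) :
    ∑ v, h v * tripleTerms e x v = (3 : ℝ) • ∑ v, h v * (x (v 0) * (e (v 1) * e (v 2))) := by
  have e1 : ∑ v, h v * (x (v 1) * (e (v 0) * e (v 2))) =
      -∑ v, h v * (x (v 0) * (e (v 1) * e (v 2))) := by
    rw [sum_fin_three_arrow, sum_fin_three_arrow, Finset.sum_comm, ← Finset.sum_neg_distrib]
    refine Finset.sum_congr rfl fun a _ => ?_
    rw [← Finset.sum_neg_distrib]
    refine Finset.sum_congr rfl fun b _ => ?_
    rw [← Finset.sum_neg_distrib]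
    refine Finset.sum_congr rfl fun c _ => ?_
    rw [hs.swap01, neg_mul]
    rfl
  have e2 : ∑ v, h v * (x (v 2) * (e (v 0) * e (v 1))) =
      ∑ v, h v * (x (v 0) * (e (v 1) * e (v 2))) := by
    rw [sum_fin_three_arrow, sum_fin_three_arrow, Finset.sum_congr rfl fun a _ => Finset.sum_comm,
      Finset.sum_comm]
    refine Finset.sum_congr rfl fun a _ => Finset.sum_congr rfl fun b _ =>
      Finset.sum_congr rfl fun c _ => ?_
    rw [hs.rotate]
    rfl
  simp only [tripleTerms, mul_add, mul_sub, Finset.sum_add_distrib, Finset.sum_sub_distrib, e1, e2]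
  rw [show (3 : ℝ) = 1 + 1 + 1 by norm_num, add_smul, add_smul, one_smul]
  abel

theorem tripleTerms_sub (x y : Fin p → Y.form U) (v : Fin 3 → Fin p) :
    tripleTerms e (fun a => x a - y a) v = tripleTerms e x v - tripleTerms e y v := by
  simp only [tripleTerms, sub_mul]
  abel

/-- Moving `e b` into the slot that it replaces compensates the alternating signs. -/
theorem tripleTerms_connection (he : ∀ a, e a ∈ Y.gr U (1, 0)) (θ : Fin p → Fin p → Y.form U)
    (v : Fin 3 → Fin p) : tripleTerms e (fun a => ∑ b, θ a b * e b) v =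
      ∑ i, ∑ b, θ (v i) b * wedgeSeq e (Function.update v i b) := by
  have hc : ∀ a b, e a * e b = -(e b * e a) := even_one_forms_anticomm he
  rw [Fin.sum_univ_three]
  simp only [tripleTerms, wedgeSeq_three, Finset.sum_mul, Function.update_self, sub_eq_add_neg,
    ← Finset.sum_neg_distrib]
  congr 1
  · congr 1
    · refine Finset.sum_congr rfl fun b _ => ?_
      rw [Function.update_of_ne (by decide), Function.update_of_ne (by decide)]
      simp only [mul_assoc]
    · refine Finset.sum_congr rfl fun b _ => ?_
      rw [Function.update_of_ne (by decide), Function.update_of_ne (by decide), hc (v 0) b]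
      simp only [mul_assoc, neg_mul, mul_neg]
  · refine Finset.sum_congr rfl fun b _ => ?_
    rw [Function.update_of_ne (by decide), Function.update_of_ne (by decide), mul_assoc (e (v 0)),
      hc (v 1) b, mul_neg, ← mul_assoc (e (v 0)), hc (v 0) b]
    simp only [mul_assoc, neg_mul, neg_neg]

/-- Exchanging the `i`-th entry with the extra index is an involution of the pairs. -/
theorem sum_update_comm {ι A : Type*} [Fintype ι] [DecidableEq ι] [AddCommMonoid A] {n : ℕ}
    (i : Fin n) (F : (Fin n → ι) → ι → A) :
    ∑ v, ∑ b, F v b = ∑ w, ∑ c, F (Function.update w i c) (w i) := by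
  let σ : (Fin n → ι) × ι → (Fin n → ι) × ι := fun x => (Function.update x.1 i x.2, x.1 i)
  have hσ : Function.Involutive σ := fun x => by simp [σ]
  have := Equiv.sum_comp hσ.toPerm fun x : (Fin n → ι) × ι => F x.1 x.2
  rw [Fintype.sum_prod_type, Fintype.sum_prod_type] at this
  exact this.symm

/-- In the Leibniz rule `de` is replaced by the torsion minus the connection term. The connection
terms complete `dh` to the covariant derivative, and by skewness the three torsion terms coincide.
-/
theorem d_three_form (he : ∀ a, e a ∈ Y.gr U (1, 0)) {θ : Fin p → Fin p → Y.form U}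
    (hθ : ∀ a b, θ a b ∈ Y.gr U (1, 0)) {T : Fin p → Y.form U}
    (hT : ∀ a, Y.d U (e a) + ∑ b, θ a b * e b = T a) {h : (Fin 3 → Fin p) → Y.form U}
    (hh : ∀ v, h v ∈ Y.gr U (0, 0)) (hs : IsSkew h) :
    Y.d U (∑ v, h v * wedgeSeq e v) =
      ∑ v, (Y.d U (h v) - ∑ i, ∑ b, θ b (v i) * h (Function.update v i b)) * wedgeSeq e v +
        (3 : ℝ) • ∑ v, h v * (T (v 0) * (e (v 1) * e (v 2))) := by
  have h1 : ∀ v, Y.d U (h v * wedgeSeq e v) = Y.d U (h v) * wedgeSeq e v +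
      (h v * tripleTerms e T v - h v * ∑ i, ∑ b, θ (v i) b * wedgeSeq e (Function.update v i b)) :=
    fun v => by
      have h2 : (fun a => Y.d U (e a)) = fun a => T a - ∑ b, θ a b * e b :=
        funext fun a => eq_sub_of_add_eq (hT a)
      rw [Y.d_mul U _ _ _ (hh v), d_wedgeSeq_three he, h2, tripleTerms_sub,
        tripleTerms_connection he, mul_sub, pow_zero, one_smul]
  have h3 : ∑ v, h v * ∑ i, ∑ b, θ (v i) b * wedgeSeq e (Function.update v i b) =
      ∑ v, (∑ i, ∑ b, θ b (v i) * h (Function.update v i b)) * wedgeSeq e v := by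
    simp only [Finset.mul_sum, Finset.sum_mul]
    rw [Finset.sum_comm, Finset.sum_comm (s := (Finset.univ : Finset (Fin 3 → Fin p)))]
    refine Finset.sum_congr rfl fun i _ => ?_
    rw [sum_update_comm i]
    refine Finset.sum_congr rfl fun v _ => Finset.sum_congr rfl fun b _ => ?_
    rw [Function.update_self, Function.update_idem, Function.update_eq_self, ← mul_assoc,
      even_mul_comm (hh _) (hθ b (v i))]
  rw [map_sum]
  simp only [h1, sub_mul, Finset.sum_add_distrib, Finset.sum_sub_distrib, h3,
    sum_mul_tripleTerms hs]
  abel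

theorem sum_cons {ι A : Type*} [Fintype ι] [AddCommMonoid A] {n : ℕ}
    (f : (Fin (n + 1) → ι) → A) :
    ∑ v, f v = ∑ a, ∑ w : Fin n → ι, f (Fin.cons a w) := by
  rw [← Equiv.sum_comp (Fin.consEquiv fun _ => ι) f, Fintype.sum_prod_type]
  rfl

/-- A 1-form passes three even 1-forms with a minus sign. The `e` part is moved back to the front,
which restores its sign; the `ψ` part stays behind. -/
theorem IsCoframe.one_form_mul_wedgeSeq {q : ℕ} {ψ : Fin q → Y.form U} (h : Y.IsCoframe U e ψ)
    {η : Y.form U} (hη : η ∈ Y.gr U (1, 0)) (v : Fin 3 → Fin p) :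
    η * wedgeSeq e v =
      ∑ a, wedgeSeq e (Fin.cons a v : Fin 4 → Fin p) * coframeCoeff h η ({a}, 0) -
      wedgeSeq e v * ∑ α, ψ α * coframeCoeff h η (∅, Pi.single α 1) := by
  have hw := wedgeSeq_mem h.1 v
  have h1 : η * wedgeSeq e v = -(wedgeSeq e v * η) := by
    rw [Y.supercomm U _ _ _ _ hη hw]
    norm_num
  have h2 : ∀ a, wedgeSeq e v * e a = -(e a * wedgeSeq e v) := fun a => by
    rw [Y.supercomm U _ _ _ _ hw (h.1 a)]
    norm_num
  rw [h1]
  conv_lhs => rw [h.one_form_eq hη]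
  rw [mul_add, Finset.mul_sum]
  simp only [wedgeSeq_cons, ← mul_assoc, h2, neg_mul, Finset.sum_neg_distrib]
  abel

end SuperSpace

theorem sum_tang_comp {A : Type*} [AddCommMonoid A] {n : ℕ} (f : (Fin n → Fin 11) → A)
    (hf : ∀ v i j, v i = transv j → f v = 0) :
    ∑ v, f v = ∑ w : Fin n → Fin 6, f (tang ∘ w) := by
  symm
  refine Finset.sum_of_injOn (fun w => tang ∘ w) ?_ (fun _ _ => Finset.mem_coe.2 (Finset.mem_univ _))
    (fun v _ hv => ?_) fun _ _ => rfl
  · intro w _ w' _ h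
    exact funext fun i => tang_injective (congrFun h i)
  · by_contra hne
    apply hv
    have : ∀ i, ∃ a, tang a = v i := fun i => by
      by_contra! hi
      refine Fin.addCases (m := 6) (n := 5) (motive := fun j => v i = j → False) (fun a ha => ?_)
        (fun j hj => ?_) (v i) rfl
      · exact hi a ha.symm
      · exact hne (hf v i j hj)
    choose w hw using this
    exact ⟨w, by simp, funext hw⟩

/-! ### Components of the Bianchi identity in the worldvolume coframe -/

namespace M5SuperImmersion

open SuperSpace

variable {M : MajoranaRep} {X : SuperManifold.{u', v'} 11 32} {S : SuperSpacetime.{u', v', w} M X}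
  {Y : SuperManifold.{u, v} 6 16} (φ : M5SuperImmersion S Y) (k : S.K)

theorem pair_mem (K : Matrix (Fin 32) (Fin 32) ℝ) :
    φ.pb k (M.pair K (S.Ψ k) (S.Ψ k)) ∈ Y.gr (φ.U k) (2, 0) := by
  refine φ.pb_mem k (Submodule.sum_mem _ fun α _ => Submodule.sum_mem _ fun β _ =>
    Submodule.smul_mem _ _ ?_)
  exact X.mul_mem _ _ _ _ _ ((S.coframe k).2.1 α) ((S.coframe k).2.1 β)

theorem conn_mem (a b : Fin 6) : φ.conn k a b ∈ Y.gr (φ.U k) (1, 0) :=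
  φ.pb_mem k (S.conn_mem k _ _)

/-- The torsion `(Ψ̄ Γᵃ Ψ)` on the worldvolume. -/
def torsion (a : Fin 6) : Y.form (φ.U k) :=
  φ.pb k (M.pair (eta a • M.Γ (tang a)) (S.Ψ k) (S.Ψ k))

/-- The transversal vectors pull back to zero, so only the tangential block of the connection
contributes. -/
theorem d_e_add (a : Fin 6) :
    Y.d _ (φ.e k a) + ∑ b, φ.conn k a b * φ.e k b = φ.torsion k a := by
  have h1 := congrArg (φ.pb k) (S.torsion k (tang a))
  rw [map_add, φ.pb_d, map_sum, sum_tang_transv] at h1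
  simp only [map_mul, φ.pull_transv_eq_zero, mul_zero, Finset.sum_const_zero, add_zero] at h1
  exact h1

theorem covD_mem (H : φ.Flux3) (v : Fin 3 → Fin 6) : φ.covD H k v ∈ Y.gr (φ.U k) (1, 0) := by
  refine Submodule.sub_mem _ ?_ (Submodule.sum_mem _ fun i _ => Submodule.sum_mem _ fun b _ => ?_)
  · exact Y.d_mem _ 0 0 _ (H.comp_mem k v)
  · simpa using Y.mul_mem _ _ _ _ _ (φ.conn_mem k b (v i)) (H.comp_mem k _)

/-- The component of degree four in the bosonic coframe of the Bianchi identity. -/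
def bianchi4 (H : φ.Flux3) (G : Flux4 S) (w : Fin 4 → Fin 6) : Y.form (φ.U k) :=
  (6⁻¹ : ℝ) • φ.nablaEven H k (w 0) ![w 1, w 2, w 3] - (24⁻¹ : ℝ) • φ.pb k (G.comp k (tang ∘ w))

/-- The component of degree three in the bosonic coframe of the Bianchi identity. -/
def bianchi3 (H : φ.Flux3) (v : Fin 3 → Fin 6) : Y.form (φ.U k) :=
  -((6⁻¹ : ℝ) • ∑ α, φ.ψ k (chirP α) * φ.nablaOdd H k α v)

/-- The component of degree two in the bosonic coframe of the Bianchi identity. -/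
def bianchi2 (H : φ.Flux3) (w : Fin 2 → Fin 6) : Y.form (φ.U k) :=
  (2⁻¹ : ℝ) • (∑ c, φ.torsion k c * H.comp k ![c, w 0, w 1] -
    φ.pb k (M.pair (M.gam ![tang (w 0), tang (w 1)]) (S.Ψ k) (S.Ψ k)))

theorem d_flux (H : φ.Flux3) : Y.res (le_top : φ.U k ≤ ⊤) (Y.d ⊤ H.form) =
    ∑ w : Fin 4 → Fin 6, wedgeSeq (φ.e k) w * ((6⁻¹ : ℝ) • φ.nablaEven H k (w 0) ![w 1, w 2, w 3]) +
    ∑ v, wedgeSeq (φ.e k) v * φ.bianchi3 k H v +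
    ∑ w : Fin 2 → Fin 6, wedgeSeq (φ.e k) w *
      ((2⁻¹ : ℝ) • ∑ c, φ.torsion k c * H.comp k ![c, w 0, w 1]) := by
  have h1 : ∑ v : Fin 3 → Fin 6, H.comp k v * (φ.e k (v 0) * φ.e k (v 1) * φ.e k (v 2)) =
      ∑ v, H.comp k v * wedgeSeq (φ.e k) v := by
    simp only [wedgeSeq_three]
  rw [Y.res_d, H.form_eq, map_smul, h1, d_three_form (φ.e_mem k) (φ.conn_mem k) (φ.d_e_add k)
    (H.comp_mem k) (H.comp_skew k), smul_add, smul_smul,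
    show (6⁻¹ * 3 : ℝ) = 2⁻¹ by norm_num]
  have h2 : ∀ v, (Y.d _ (H.comp k v) - ∑ i, ∑ b, φ.conn k b (v i) *
      H.comp k (Function.update v i b)) * wedgeSeq (φ.e k) v = _ := fun v =>
    (φ.isCoframe k).one_form_mul_wedgeSeq (φ.covD_mem k H v) v
  simp only [h2, Finset.sum_sub_distrib, smul_sub]
  have hc3 : ∀ (a : Fin 6) (v : Fin 3 → Fin 6), ![(Fin.cons a v : Fin 4 → Fin 6) 1,
      (Fin.cons a v : Fin 4 → Fin 6) 2, (Fin.cons a v : Fin 4 → Fin 6) 3] = v := fun a v => by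
    funext i; fin_cases i <;> rfl
  have hc2 : ∀ (a : Fin 6) (w : Fin 2 → Fin 6), (Fin.cons a w : Fin 3 → Fin 6) = ![a, w 0, w 1] :=
    fun a w => by funext i; fin_cases i <;> rfl
  congr 1
  · rw [sub_eq_add_neg]
    congr 1
    · rw [sum_cons (n := 3), Finset.sum_comm, Finset.smul_sum]
      refine Finset.sum_congr rfl fun v _ => ?_
      rw [Finset.smul_sum]
      refine Finset.sum_congr rfl fun a _ => ?_
      rw [hc3, mul_smul_comm]
      rfl
    · rw [Finset.smul_sum, ← Finset.sum_neg_distrib]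
      refine Finset.sum_congr rfl fun v _ => ?_
      unfold bianchi3
      rw [mul_neg, mul_smul_comm]
      rfl
  · rw [sum_cons, Finset.sum_comm, Finset.smul_sum]
    refine Finset.sum_congr rfl fun w _ => ?_
    rw [mul_smul_comm, Finset.mul_sum]
    congr 1
    refine Finset.sum_congr rfl fun c _ => ?_
    have hT : φ.torsion k c ∈ _ := φ.pair_mem k _
    rw [hc2, wedgeSeq_two]
    change H.comp k ![c, w 0, w 1] * (φ.torsion k c * (φ.e k (w 0) * φ.e k (w 1))) = _
    have hw := Y.mul_mem _ _ _ _ _ (φ.e_mem k (w 0)) (φ.e_mem k (w 1))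
    rw [two_form_comm hT hw, even_mul_comm (H.comp_mem k _) (Y.mul_mem _ _ _ _ _ hw hT), mul_assoc]

theorem U_le_comap_top : φ.U k ≤ Opens.comap φ.base ⊤ := fun _ _ => trivial

theorem pull_flux (G : Flux4 S) : Y.res (φ.U_le_comap_top k) (φ.pull ⊤ G.form) =
    ∑ w, wedgeSeq (φ.e k) w * ((24⁻¹ : ℝ) • φ.pb k (G.comp k (tang ∘ w))) +
    ∑ w : Fin 2 → Fin 6, wedgeSeq (φ.e k) w * ((2⁻¹ : ℝ) •
      φ.pb k (M.pair (M.gam ![tang (w 0), tang (w 1)]) (S.Ψ k) (S.Ψ k))) := by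
  have h1 : Y.res (φ.U_le_comap_top k) (φ.pull ⊤ G.form) =
      φ.pb k (X.res (le_top : S.V k ≤ ⊤) G.form) :=
    (φ.pull_res (le_top : S.V k ≤ ⊤) G.form).symm
  rw [h1, G.form_eq]
  simp only [map_add, map_smul, map_sum, map_mul]
  congr 1
  · rw [sum_tang_comp _ fun v i j hij => ?_, Finset.smul_sum]
    · refine Finset.sum_congr rfl fun w _ => ?_
      have hw := wedgeSeq_mem (φ.e_mem k) w
      have hG : φ.pb k (G.comp k (tang ∘ w)) ∈ Y.gr (φ.U k) (0, 0) := φ.pb_mem k (G.comp_mem k _)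
      rw [mul_smul_comm, ← even_mul_comm hG hw, wedgeSeq_four]
      rfl
    · have hz : φ.pb k (S.E k (v i)) = 0 := by rw [hij, φ.pull_transv_eq_zero]
      fin_cases i <;> simp only [Fin.zero_eta, Fin.mk_one, Fin.reduceFinMk] at hz <;> simp [hz]
  · rw [sum_tang_transv]
    simp only [sum_tang_transv, φ.pull_transv_eq_zero, mul_zero, zero_mul, Finset.sum_const_zero,
      add_zero]
    rw [sum_cons, Finset.smul_sum]
    refine Finset.sum_congr rfl fun a _ => ?_
    rw [sum_cons, Finset.smul_sum]
    refine Finset.sum_congr rfl fun b _ => ?_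
    rw [Fintype.sum_unique]
    have hw := Y.mul_mem _ _ _ _ _ (φ.e_mem k a) (φ.e_mem k b)
    rw [wedgeSeq_two, mul_smul_comm, ← two_form_comm (φ.pair_mem k _) (by exact hw)]
    rfl

theorem bianchi_expansion (H : φ.Flux3) (G : Flux4 S) :
    Y.res (le_top : φ.U k ≤ ⊤) (Y.d ⊤ H.form) -
      Y.res (φ.U_le_comap_top k) (φ.pull ⊤ G.form) =
      ∑ w, wedgeSeq (φ.e k) w * φ.bianchi4 k H G w + ∑ v, wedgeSeq (φ.e k) v * φ.bianchi3 k H v +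
        ∑ w, wedgeSeq (φ.e k) w * φ.bianchi2 k H w := by
  rw [φ.d_flux, φ.pull_flux]
  simp only [bianchi4, bianchi2, smul_sub, mul_sub, Finset.sum_sub_distrib]
  abel

end M5SuperImmersion

end

noncomputable section

set_option linter.unusedSectionVars false

universe u v w u' v'

/-! ## Algebraic form of the quadratic component -/

section MapSquare

variable {A B : Type*} [Ring A] [Ring B] [Algebra ℝ A] [Algebra ℝ B] (f : A →ₐ[ℝ] B)
  (T : (Fin 3 → Fin 6) → A)

theorem map_square (a b : Fin 6) : f (square T a b) = square (fun v => f (T v)) a b := by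
  simp [square]

theorem map_denominator : f (1 - (2 / 3 : ℝ) • (square T * square T).trace) =
    1 - (2 / 3 : ℝ) •
      (square (fun v => f (T v)) * square fun v => f (T v)).trace := by
  rw [map_sub, map_one, map_smul]
  simp only [Matrix.trace, Matrix.diag, Matrix.mul_apply, map_sum, map_mul, map_square]

theorem map_one_add_square (a b : Fin 6) (r : ℝ) :
    f ((1 + r • square T) a b) = (1 + r • square fun v => f (T v)) a b := by
  rw [Matrix.add_apply, Matrix.add_apply, map_add, Matrix.smul_apply, Matrix.smul_apply, map_smul,
    map_square, Matrix.one_apply, Matrix.one_apply]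
  split <;> simp

end MapSquare

theorem perm_fin_two (σ : Equiv.Perm (Fin 2)) : σ = 1 ∨ σ = Equiv.swap 0 1 := by
  revert σ; decide

theorem isSkew_of_swap {ι A : Type*} [AddCommGroup A] {T : (Fin 2 → ι) → A}
    (h : ∀ a b, T ![b, a] = -T ![a, b]) : IsSkew T := fun v σ => by
  rcases perm_fin_two σ with rfl | rfl
  · simp
  · have h1 : v ∘ (Equiv.swap (0 : Fin 2) 1) = ![v 1, v 0] := by
      funext i; fin_cases i <;> simp
    have h2 : v = ![v 0, v 1] := by funext i; fin_cases i <;> rfl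
    rw [h1, h]
    conv_rhs => rw [h2]
    simp

section FluxCoefficient

variable {R : Type*} [CommRing R] [Algebra ℝ R]

/-- The coefficient of `γ_d` in the quadratic component of the Bianchi identity. -/
def fluxCoeff (T H : (Fin 3 → Fin 6) → R) (a b d : Fin 6) : R :=
  ∑ c, (eta c • H ![c, a, b]) * (1 - (2 : ℝ) • square T) c d - (-4 : ℝ) • eta d • T ![a, b, d]

/-- Lowering the index `d` and using the symmetry of the square turns the contraction on the right
of the matrix into one on its left. -/
theorem eta_smul_fluxCoeff {T : (Fin 3 → Fin 6) → R} (hs : IsSkew T) (H : (Fin 3 → Fin 6) → R)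
    (a b d : Fin 6) : eta d • fluxCoeff T H a b d =
      contractFirst (1 - (2 : ℝ) • square T) H d a b - (-4 : ℝ) • T ![d, a, b] := by
  have hm : ∀ c, eta d • eta c • (1 - (2 : ℝ) • square T) c d =
      (1 - (2 : ℝ) • square T) d c := fun c => by
    have h1 : eta d • (1 - (2 : ℝ) • square T) c d = eta c • (1 - (2 : ℝ) • square T) d c := by
      simp only [Matrix.sub_apply, Matrix.smul_apply, smul_sub]
      rw [smul_comm (eta d), square_comm T hs, smul_comm (eta c) (2 : ℝ)]
      congr 1
      rw [Matrix.one_apply, Matrix.one_apply]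
      by_cases h : c = d
      · subst h; rfl
      · rw [if_neg h, if_neg (Ne.symm h), smul_zero, smul_zero]
    rw [smul_comm, h1, smul_smul, eta_mul_self, one_smul]
  unfold fluxCoeff contractFirst
  rw [smul_sub, Finset.smul_sum, smul_comm (eta d) (-4 : ℝ), smul_smul (eta d), eta_mul_self,
    one_smul, hs.rotate]
  congr 1
  refine Finset.sum_congr rfl fun c _ => ?_
  rw [← hm c, smul_mul_assoc, smul_mul_assoc, smul_mul_assoc, mul_comm (H _)]

theorem fluxCoeff_eq_zero_iff {T : (Fin 3 → Fin 6) → R} (hs : IsSkew T)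
    (H : (Fin 3 → Fin 6) → R) : (∀ a b d, fluxCoeff T H a b d = 0) ↔
      ∀ a b c, contractFirst (1 - (2 : ℝ) • square T) H a b c = (-4 : ℝ) • T ![a, b, c] := by
  have h1 : ∀ a b d, fluxCoeff T H a b d = 0 ↔
      contractFirst (1 - (2 : ℝ) • square T) H d a b = (-4 : ℝ) • T ![d, a, b] := fun a b d => by
    rw [← sub_eq_zero (b := (-4 : ℝ) • _), ← eta_smul_fluxCoeff hs]
    exact (smul_eq_zero_iff_right (eta_ne_zero d)).symm
  simp only [h1]
  exact ⟨fun h a b c => h b c a, fun h a b d => h d a b⟩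

theorem map_fluxCoeff {R' : Type*} [CommRing R'] [Algebra ℝ R'] (f : R →ₐ[ℝ] R')
    (T H : (Fin 3 → Fin 6) → R) (a b d : Fin 6) :
    f (fluxCoeff T H a b d) = fluxCoeff (fun v => f (T v)) (fun v => f (H v)) a b d := by
  unfold fluxCoeff
  simp only [map_sub, map_sum, map_mul, map_smul, sub_eq_add_neg (1 : Matrix _ _ _), ← neg_smul,
    map_one_add_square]

end FluxCoefficient

namespace MajoranaRep

open SuperSpace

variable (M : MajoranaRep) {R : Type*} [CommRing R] [Algebra ℝ R]

/-- The bilinear form of a vector on the image of `P`. -/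
def vectorForm (y : Fin 6 → R) : Matrix (Fin 32) (Fin 32) R :=
  M.form R * ∑ d, y d • (M.gen R d * M.proj R)

theorem vectorForm_apply (y : Fin 6 → R) (i j : Fin 32) :
    M.vectorForm y i j = ∑ d, y d * algebraMap ℝ R ((M.C * (M.Γ (tang d) * M.P)) i j) := by
  unfold vectorForm
  rw [Finset.mul_sum, Matrix.sum_apply]
  refine Finset.sum_congr rfl fun d _ => ?_
  rw [mul_smul_comm, Matrix.smul_apply, smul_eq_mul]
  unfold form gen proj
  rw [← map_mul, ← map_mul]
  rfl

theorem map_vectorForm {R' : Type*} [CommRing R'] [Algebra ℝ R'] (f : R →ₐ[ℝ] R') (y : Fin 6 → R)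
    (i j : Fin 32) : f (M.vectorForm y i j) = M.vectorForm (fun d => f (y d)) i j := by
  simp [vectorForm_apply]

theorem transpose_vectorForm (y : Fin 6 → R) : (M.vectorForm y).transpose = M.vectorForm y := by
  unfold vectorForm
  simp only [Finset.mul_sum, mul_smul_comm, Matrix.transpose_smul, Matrix.transpose_sum,
    M.transpose_form_gen_proj]

theorem vectorForm_eq_zero {y : Fin 6 → R}
    (h : ∀ α β, M.vectorForm y (chirP α) (chirP β) = 0) : y = 0 := by
  have hN : ∀ i β, M.vectorForm y i (chirN β) = 0 := fun i β => by
    have : M.vectorForm y = M.form R * (∑ d, y d • M.gen R d) * M.proj R := by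
      unfold vectorForm
      rw [mul_assoc, Finset.sum_mul]
      simp only [smul_mul_assoc]
    rw [this, M.mul_proj_apply_chirN]
  have h0 : M.vectorForm y = 0 := by
    ext i j
    rcases chir_cases j with ⟨β, rfl⟩ | ⟨β, rfl⟩
    · rcases chir_cases i with ⟨α, rfl⟩ | ⟨α, rfl⟩
      · exact h α β
      -- The rows outside the image of `P` vanish by symmetry, since the columns do.
      · rw [← M.transpose_vectorForm, Matrix.transpose_apply, hN]; rfl
    · exact hN i β
  exact M.eq_zero_of_sum_gen y ((M.isUnit_form.mul_right_eq_zero).1 h0)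

/-- The coefficient matrix is symmetric, so its entries can be read off, and they determine the
vector because the pairing is nondegenerate and the `γ_d P` are independent. -/
theorem quadratic_eq_zero_iff {Y : SuperSpace.{u, v}} {V : Opens Y.body} {p : ℕ}
    {e : Fin p → Y.form V} {ψ : Fin 16 → Y.form V} (h : Y.IsCoframe V e ψ)
    (y : Fin 6 → Y.even V) :
    ∑ α, ∑ β, ψ α * ψ β * (M.vectorForm y (chirP α) (chirP β) : Y.even V) = 0 ↔
      ∀ d, y d = 0 := by
  constructor
  · intro h0
    have h1 := h.eq_zero_of_quadratic
      (fun α β => even_mem_functions (M.vectorForm y (chirP α) (chirP β)).2) (fun α β => by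
        conv_lhs => rw [← M.transpose_vectorForm]
        rfl) h0
    exact congrFun (M.vectorForm_eq_zero fun α β => Subtype.ext (h1 α β))
  · intro hy
    have : y = 0 := funext hy
    subst this
    simp [vectorForm]

theorem gam_pair {a b : Fin 11} (h : a ≠ b) : M.gam ![a, b] = M.Γ a * M.Γ b := by
  have hu : (Finset.univ : Finset (Equiv.Perm (Fin 2))) = {1, Equiv.swap 0 1} := by decide
  unfold gam skew
  rw [hu, Finset.sum_pair (by decide)]
  simp only [Equiv.Perm.sign_one, Equiv.Perm.sign_swap (show (0 : Fin 2) ≠ 1 by decide),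
    List.ofFn_succ, List.ofFn_zero, List.prod_cons, List.prod_nil, Function.comp_apply]
  simp only [Equiv.Perm.coe_one, id, Fin.succ_zero_eq_one, Equiv.swap_apply_left,
    Equiv.swap_apply_right, Matrix.cons_val_zero, Matrix.cons_val_one, mul_one]
  rw [M.anticomm h.symm]
  simp only [Units.val_one, one_smul, Units.val_neg, neg_smul, neg_neg]
  rw [← two_smul ℝ, smul_smul]
  simp

theorem gam_pair_swap (a b : Fin 11) : M.gam ![b, a] = -M.gam ![a, b] := by
  have h := isSkew_skew (fun w : Fin 2 → Fin 11 => (List.ofFn fun i => M.Γ (w i)).prod) ![a, b]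
    (Equiv.swap 0 1)
  have h1 : ![a, b] ∘ (Equiv.swap (0 : Fin 2) 1) = ![b, a] := by
    funext i; fin_cases i <;> simp
  rw [h1] at h
  simpa [gam] using h

theorem shearForm_smul (N K : Matrix (Fin 32) (Fin 32) R) (r : ℝ) :
    M.shearForm N (r • K) = r • M.shearForm N K := by
  simp [shearForm]

end MajoranaRep

/-! ### Restriction, gluing and units -/

namespace SuperSpace

variable {Y : SuperSpace.{u, v}} {U V : Opens Y.body} {q : ℕ} {ψ : Fin q → Y.form U}

theorem res_mem_oddPoly (h : V ≤ U) {x : Y.form U} (hx : x ∈ oddPoly ψ) :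
    Y.res h x ∈ oddPoly fun α => Y.res h (ψ α) := by
  induction hx using Submodule.span_induction with
  | mem x hx =>
    obtain ⟨m, f, hf, rfl⟩ := hx
    refine Submodule.subset_span ⟨m, Y.res h f, res_mem_functions h hf, ?_⟩
    rw [map_mul, monomial, map_list_prod, List.map_ofFn]
    congr 2
    exact congrArg List.ofFn (funext fun α => map_pow _ _ _)
  | zero => rw [map_zero]; exact Submodule.zero_mem _
  | add x y _ _ hx hy => rw [map_add]; exact Submodule.add_mem _ hx hy
  | smul r x _ hx => rw [map_smul]; exact Submodule.smul_mem _ _ hx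

theorem res_wedgeSeq (h : V ≤ U) {p n : ℕ} (e : Fin p → Y.form U) (w : Fin n → Fin p) :
    Y.res h (wedgeSeq e w) = wedgeSeq (fun a => Y.res h (e a)) w := by
  rw [wedgeSeq, map_list_prod, List.map_ofFn]
  rfl

theorem eq_of_res_eq {W : Opens Y.body} {𝒰 : Set (Opens Y.body)} (hW : W = sSup 𝒰)
    (hle : ∀ U ∈ 𝒰, U ≤ W) {η η' : Y.form W}
    (h : ∀ (U) (hU : U ∈ 𝒰), Y.res (hle U hU) η = Y.res (hle U hU) η') : η = η' := by
  subst hW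
  exact Y.separated 𝒰 η η' h

/-- The inverse of an even superfunction is even. -/
theorem isUnit_even {f : Y.even U} (hf : IsUnit (f : Y.form U)) : IsUnit f := by
  classical
  let _ := (Y.internal U).chooseDecomposition
  obtain ⟨x, hx⟩ := hf.exists_right_inv
  let pr : Y.form U →+ Y.form U :=
    { toFun := fun y => (DirectSum.decompose (Y.gr U) y (0, 0) : Y.form U)
      map_zero' := by simp
      map_add' := fun y z => by simp }
  have hpr : ∀ j y, y ∈ Y.gr U j → pr y = if j = (0, 0) then y else 0 := fun j y hy => by
    change (DirectSum.decompose (Y.gr U) y (0, 0) : Y.form U) = _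
    split
    · next h => subst h; exact DirectSum.decompose_of_mem_same _ hy
    · next h => exact DirectSum.decompose_of_mem_ne _ hy h
  -- `f` has degree zero, so multiplication by it commutes with the projection to even
  -- superfunctions; the projection of an inverse is then again an inverse.
  have hmul : ∀ y, pr ((f : Y.form U) * y) = f * pr y := fun y => by
    have hy : y ∈ ⨆ i, Y.gr U i := by
      rw [(Y.internal U).submodule_iSup_eq_top]; trivial
    refine Submodule.iSup_induction _ (motive := fun y => pr ((f : Y.form U) * y) = f * pr y) hy
      (fun j y hy => ?_) (by simp) fun y z hy hz => ?_
    · have h1 : (f : Y.form U) * y ∈ Y.gr U j := by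
        have := Y.mul_mem U _ _ _ _ f.2 hy
        rwa [show ((0, 0) : ℕ × ZMod 2) + j = j from zero_add j] at this
      rw [hpr _ _ hy, hpr _ _ h1]
      split <;> simp
    · rw [mul_add, map_add, map_add, hy, hz, mul_add]
  have h1 : (f : Y.form U) * pr x = 1 := by
    rw [← hmul, hx, hpr _ _ (Y.one_mem U), if_pos rfl]
  exact IsUnit.of_mul_eq_one ⟨pr x, Subtype.prop _⟩ (Subtype.ext h1)

end SuperSpace

end

noncomputable section

set_option linter.unusedSectionVars false

universe u v w u' v'

/-! ## The Bianchi identity on a patch -/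

namespace M5SuperImmersion

open SuperSpace

variable {M : MajoranaRep} {X : SuperManifold.{u', v'} 11 32} {S : SuperSpacetime.{u', v', w} M X}
  {Y : SuperManifold.{u, v} 6 16} (φ : M5SuperImmersion S Y) {k : S.K}

theorem torsion_eq {T : (Fin 3 → Fin 6) → Y.even (φ.U k)} (hs : IsSkew T) (hT : hodgeStar T = T)
    (hN : φ.shear k = cliffSlash (M.gen _) T * M.proj _) (c : Fin 6) : φ.torsion k c =
      ∑ α, ∑ β, φ.ψ k (chirP α) * φ.ψ k (chirP β) * (M.vectorForm
        (fun d => eta c • (1 - (2 : ℝ) • square T) c d) (chirP α) (chirP β) : Y.even (φ.U k)) := by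
  unfold torsion
  rw [φ.pull_pair _ hN, map_smul, M.shearForm_smul]
  have h1 : realMatrix (Y.even (φ.U k)) (M.Γ (tang c)) = M.gen _ c := rfl
  have h2 : eta c • (M.form (Y.even (φ.U k)) *
      ∑ d, (1 - (2 : ℝ) • square T) c d • (M.gen _ d * M.proj _)) =
        M.vectorForm fun d => eta c • (1 - (2 : ℝ) • square T) c d := by
    unfold MajoranaRep.vectorForm
    rw [← mul_smul_comm, Finset.smul_sum]
    simp only [smul_assoc]
  rw [h1, M.shearForm_gen hs hT, h2]

theorem pull_gam_pair {T : (Fin 3 → Fin 6) → Y.even (φ.U k)} (hs : IsSkew T)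
    (hT : hodgeStar T = T) (hN : φ.shear k = cliffSlash (M.gen _) T * M.proj _) (a b : Fin 6) :
    φ.pb k (M.pair (M.gam ![tang a, tang b]) (S.Ψ k) (S.Ψ k)) =
      ∑ α, ∑ β, φ.ψ k (chirP α) * φ.ψ k (chirP β) * (M.vectorForm
        (fun d => (-4 : ℝ) • eta d • T ![a, b, d]) (chirP α) (chirP β) : Y.even (φ.U k)) := by
  rw [φ.pull_pair _ hN]
  by_cases hab : a = b
  · subst hab
    have h1 : M.gam ![tang a, tang a] = 0 := (isSkew_skew _).eq_zero fun h => by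
      have := @h 0 1 rfl
      simp at this
    have h2 : ∀ d, T ![a, a, d] = 0 := fun d => hs.eq_zero fun h => by
      have := @h 0 1 rfl
      simp at this
    simp [h1, h2, MajoranaRep.vectorForm, MajoranaRep.shearForm]
  · have h1 : realMatrix (Y.even (φ.U k)) (M.gam ![tang a, tang b]) = M.gen _ a * M.gen _ b := by
      rw [M.gam_pair (tang_injective.ne hab), map_mul]
      rfl
    rw [h1, M.shearForm_pair hs hT hab]
    rfl

/-- The components of the flux as even superfunctions. -/
def fluxEven (H : φ.Flux3) (k : S.K) (v : Fin 3 → Fin 6) : Y.even (φ.U k) :=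
  ⟨H.comp k v, H.comp_mem k v⟩

/-- The torsion contributes `1 - 2T²` contracted with `H`, and the bilinear in `G₄` contributes `-4
T`; both are bilinear forms of vectors. -/
theorem bianchi2_eq {T : (Fin 3 → Fin 6) → Y.even (φ.U k)} (hs : IsSkew T) (hT : hodgeStar T = T)
    (hN : φ.shear k = cliffSlash (M.gen _) T * M.proj _) (H : φ.Flux3) (w : Fin 2 → Fin 6) :
    φ.bianchi2 k H w = (2⁻¹ : ℝ) •
      ∑ α, ∑ β, φ.ψ k (chirP α) * φ.ψ k (chirP β) * (M.vectorForm
        (fluxCoeff T (φ.fluxEven H k) (w 0) (w 1)) (chirP α) (chirP β) : Y.even (φ.U k)) := by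
  have h1 : ∀ c, φ.torsion k c * H.comp k ![c, w 0, w 1] =
      ∑ α, ∑ β, φ.ψ k (chirP α) * φ.ψ k (chirP β) * (M.vectorForm
        (fun d => eta c • (1 - (2 : ℝ) • square T) c d) (chirP α) (chirP β) *
          φ.fluxEven H k ![c, w 0, w 1] : Y.even (φ.U k)) := fun c => by
    rw [φ.torsion_eq hs hT hN, Finset.sum_mul]
    refine Finset.sum_congr rfl fun α _ => ?_
    rw [Finset.sum_mul]
    exact Finset.sum_congr rfl fun β _ => mul_assoc _ _ _
  unfold bianchi2
  congr 1
  rw [φ.pull_gam_pair hs hT hN]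
  simp only [h1]
  rw [Finset.sum_comm, ← Finset.sum_sub_distrib]
  refine Finset.sum_congr rfl fun α _ => ?_
  rw [Finset.sum_comm, ← Finset.sum_sub_distrib]
  refine Finset.sum_congr rfl fun β _ => ?_
  rw [← Finset.mul_sum, ← mul_sub, ← coe_sum_even]
  congr 1
  rw [← AddSubgroupClass.coe_sub]
  congr 1
  simp only [M.vectorForm_apply, fluxCoeff, sub_mul, Finset.sum_sub_distrib, Finset.sum_mul]
  congr 1
  rw [Finset.sum_comm]
  refine Finset.sum_congr rfl fun d _ => Finset.sum_congr rfl fun c _ => ?_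
  rw [smul_mul_assoc, smul_mul_assoc, smul_mul_assoc, smul_mul_assoc]
  congr 1
  ring

variable {V : Opens Y.body}

theorem res_bianchi2_eq_zero_iff {T : (Fin 3 → Fin 6) → Y.even (φ.U k)} (hs : IsSkew T)
    (hT : hodgeStar T = T) (hN : φ.shear k = cliffSlash (M.gen _) T * M.proj _) (H : φ.Flux3)
    (hV : V ≤ φ.U k) : (∀ w, Y.res hV (φ.bianchi2 k H w) = 0) ↔
      ∀ a b d, fluxCoeff (fun v => evenRes hV (T v)) (fun v => evenRes hV (φ.fluxEven H k v))
        a b d = 0 := by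
  have h1 : ∀ w, Y.res hV (φ.bianchi2 k H w) = 0 ↔ ∀ d, fluxCoeff (fun v => evenRes hV (T v))
      (fun v => evenRes hV (φ.fluxEven H k v)) (w 0) (w 1) d = 0 := fun w => by
    rw [← M.quadratic_eq_zero_iff ((φ.isCoframe k).res hV), φ.bianchi2_eq hs hT hN, map_smul,
      smul_eq_zero_iff_right (by norm_num)]
    simp only [map_sum, map_mul]
    have h2 : ∀ α β, Y.res hV (M.vectorForm (fluxCoeff T (φ.fluxEven H k) (w 0) (w 1)) α β :
        Y.even (φ.U k)) = (M.vectorForm (fun d => fluxCoeff (fun v => evenRes hV (T v))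
          (fun v => evenRes hV (φ.fluxEven H k v)) (w 0) (w 1) d) α β : Y.even V) := fun α β => by
      have := M.map_vectorForm (evenRes hV) (fluxCoeff T (φ.fluxEven H k) (w 0) (w 1)) α β
      simp only [map_fluxCoeff] at this
      exact congrArg Subtype.val this
    simp only [h2]
  simp only [h1]
  exact ⟨fun h a b d => h ![a, b] d, fun h w d => h (w 0) (w 1) d⟩

/-- Everything lives in the commutative ring of even superfunctions on the smaller open set, where
`flux_iff` applies; invertibility there is the same as invertibility among all forms. -/
theorem nonCritical_fluxFormula_iff {W : Opens Y.body} {Ht : φ.Tensor3}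
    {T : (Fin 3 → Fin 6) → Y.even (φ.U k)} (hs : IsSkew T) (hT : hodgeStar T = T)
    (hHt : Ht k = fun v => (T v : Y.form (φ.U k))) (H : φ.Flux3) :
    (φ.NonCritical Ht k W ∧ φ.FluxFormula H Ht k W) ↔ ∀ a b d,
      fluxCoeff (fun v => evenRes (inf_le_right : W ⊓ φ.U k ≤ φ.U k) (T v))
        (fun v => evenRes (inf_le_right : W ⊓ φ.U k ≤ φ.U k) (φ.fluxEven H k v)) a b d = 0 := by
  set hV : W ⊓ φ.U k ≤ φ.U k := inf_le_right
  set T' : (Fin 3 → Fin 6) → Y.even (W ⊓ φ.U k) := fun v => evenRes hV (T v) with hT'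
  set H' : (Fin 3 → Fin 6) → Y.even (W ⊓ φ.U k) := fun v => evenRes hV (φ.fluxEven H k v) with hH'
  have hs' : IsSkew T' := fun v σ => by
    simp only [hT']
    rw [hs v σ, map_zsmul]
  have hst : hodgeStar T' = T' := funext fun v =>
    (map_hodgeStar (evenRes hV).toLinearMap T v).symm.trans (by rw [hT]; rfl)
  rw [fluxCoeff_eq_zero_iff hs', flux_iff hs' hst]
  have hres : (fun v => Y.res hV (Ht k v)) = fun v => (T' v : Y.form (W ⊓ φ.U k)) := by
    rw [hHt]; rfl
  set D : Y.even (W ⊓ φ.U k) := 1 - (2 / 3 : ℝ) • (square T' * square T').trace with hD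
  have h1 : Y.res hV (φ.denominator Ht k) = (D : Y.form (W ⊓ φ.U k)) := by
    unfold denominator
    rw [map_denominator, hres]
    exact (map_denominator (Y.even _).val T').symm
  have h2 : ∀ a b c, Y.res hV (∑ a', (1 + (2 : ℝ) • square (Ht k)) a a' * Ht k ![a', b, c]) =
      (contractFirst (1 + (2 : ℝ) • square T') T' a b c : Y.even (W ⊓ φ.U k)) := fun a b c => by
    unfold contractFirst
    rw [map_sum, coe_sum_even]
    refine Finset.sum_congr rfl fun a' _ => ?_
    rw [map_mul, map_one_add_square, hres, congrFun hres]
    exact congrArg (· * _) (map_one_add_square (Y.even _).val T' a a' 2).symm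
  have h3 : ∀ a b c, Y.res hV (H.comp k ![a, b, c]) = (H' ![a, b, c] : Y.form (W ⊓ φ.U k)) :=
    fun a b c => rfl
  unfold NonCritical FluxFormula
  rw [h1]
  simp only [h2, h3]
  have hu : IsUnit (D : Y.form (W ⊓ φ.U k)) ↔ IsUnit D :=
    ⟨isUnit_even, fun h => h.map (Y.even _).val⟩
  rw [hu]
  refine and_congr_right fun hDu => forall_congr' fun a => forall_congr' fun b =>
    forall_congr' fun c => ?_
  have hDu' := hu.2 hDu
  rw [← mul_smul_comm]
  constructor
  · intro h
    apply Subtype.ext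
    change (D : Y.form (W ⊓ φ.U k)) * (H' ![a, b, c] : Y.form (W ⊓ φ.U k)) = _
    rw [h, ← mul_assoc, Ring.mul_inverse_cancel _ hDu', one_mul]
    rfl
  · intro h
    have h4 := congrArg (Subtype.val : Y.even (W ⊓ φ.U k) → _) h
    change (D : Y.form (W ⊓ φ.U k)) * (H' ![a, b, c] : Y.form (W ⊓ φ.U k)) = _ at h4
    have h5 := congrArg (Ring.inverse (D : Y.form (W ⊓ φ.U k)) * ·) h4
    simp only [← mul_assoc, Ring.inverse_mul_cancel _ hDu', one_mul] at h5
    exact h5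

theorem skew_res {n : ℕ} {ι : Type*} (hV : V ≤ φ.U k) (T : (Fin n → ι) → Y.form (φ.U k))
    (v : Fin n → ι) : skew (fun w => Y.res hV (T w)) v = Y.res hV (skew T v) :=
  (map_skew (Y.res hV).toLinearMap T v).symm

theorem bosonicBianchi_iff (H : φ.Flux3) (G : Flux4 S) (W : Opens Y.body) :
    φ.BosonicBianchi H G k W ↔
      skew (fun w => Y.res (inf_le_right : W ⊓ φ.U k ≤ φ.U k) (φ.bianchi4 k H G w)) = 0 := by
  have hpair : ∀ K a b, M.pair K (φ.τ k a) (φ.τ k b) = 0 := fun K a b => by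
    simp [φ.τ_eq_zero k, MajoranaRep.pair]
  have h1 : φ.bianchi4 k H G = (fun a : Fin 4 → Fin 6 => (6⁻¹ : ℝ) •
      φ.nablaEven H k (a 0) ![a 1, a 2, a 3]) - fun a => (24⁻¹ : ℝ) • φ.pb k (G.comp k (tang ∘ a)) :=
    rfl
  unfold BosonicBianchi
  rw [funext_iff]
  refine forall_congr' fun v => ?_
  simp only [hpair, mul_zero, Finset.sum_const_zero, smul_zero, add_zero]
  rw [skew_res, h1, skew_sub, Pi.sub_apply, map_sub]
  exact sub_eq_zero.symm

/-- The coframe expansion controls only the skew part of this component, whereas one side of the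
rheonomy equation is not skew-symmetrized; skewness closes the gap. -/
theorem isSkew_bianchi3 (H : φ.Flux3) : IsSkew (φ.bianchi3 k H) := by
  have hD : IsSkew (φ.covD H k) := fun v σ => by
    unfold covD
    rw [smul_sub, H.comp_skew k v σ, map_zsmul]
    congr 1
    rw [Finset.smul_sum]
    refine Fintype.sum_equiv σ _ _ fun i => ?_
    rw [Finset.smul_sum]
    refine Finset.sum_congr rfl fun b _ => ?_
    have : Function.update (v ∘ σ) i b = Function.update v (σ i) b ∘ σ :=
      (Function.update_comp_eq_of_injective v σ.injective i b).symm
    rw [this, H.comp_skew k _ σ, mul_smul_comm]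
    rfl
  intro v σ
  unfold bianchi3 nablaOdd
  rw [hD v σ]
  rcases Int.units_eq_one_or (Equiv.Perm.sign σ) with h | h
  · rw [h]; simp
  · rw [h]; simp [(φ.isCoframe k).coeff_neg]

theorem rheonomy_iff (H : φ.Flux3) (Ht : φ.Tensor3) (W : Opens Y.body) :
    φ.Rheonomy H Ht k W ↔
      skew (fun w => Y.res (inf_le_right : W ⊓ φ.U k ≤ φ.U k) (φ.bianchi3 k H w)) = 0 := by
  have hpair : ∀ K a x, M.pair K (φ.τ k a) x = 0 := fun K a x => by
    simp [φ.τ_eq_zero k, MajoranaRep.pair]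
  unfold Rheonomy
  rw [funext_iff]
  refine forall_congr' fun v => ?_
  rw [skew_res, (φ.isSkew_bianchi3 H).skew_eq]
  simp only [hpair, mul_zero, Finset.sum_const_zero]
  have h0 : skew (fun _ : Fin 3 → Fin 6 => (0 : Y.form (φ.U k))) v = 0 := by simp [skew]
  rw [h0, add_zero, map_zero, bianchi3, map_neg, Pi.zero_apply, neg_eq_zero]

theorem isSkew_bianchi2 (H : φ.Flux3) : IsSkew (φ.bianchi2 k H) := by
  refine isSkew_of_swap fun a b => ?_
  have h1 : ∀ x : Fin 32 → X.form (S.V k), M.pair (-M.gam ![tang a, tang b]) x x =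
      -M.pair (M.gam ![tang a, tang b]) x x := fun x => by
    simp [MajoranaRep.pair]
  simp only [bianchi2, Matrix.cons_val_zero, Matrix.cons_val_one, M.gam_pair_swap (tang a) (tang b),
    h1, map_neg, (H.comp_skew k).swap12 _ a b, mul_neg, Finset.sum_neg_distrib]
  rw [← smul_neg]
  congr 1
  abel

/-- The coefficients of the wedges of four, three and two even coframe members vanish separately,
and give in turn the bosonic equation, the rheonomy equation and the algebraic equation for the
flux. -/
theorem bianchi_patch_iff {Ht : φ.Tensor3} (h : φ.IsShearTensor Ht) (H : φ.Flux3) (G : Flux4 S)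
    (W : Opens Y.body) (k : S.K) : φ.Bianchi H G (W ⊓ φ.U k) ↔
      φ.BosonicBianchi H G k W ∧ φ.Rheonomy H Ht k W ∧
        (φ.NonCritical Ht k W ∧ φ.FluxFormula H Ht k W) := by
  obtain ⟨T, hs, hT, hN, hHt⟩ := h.exists_eq k
  set hV : W ⊓ φ.U k ≤ φ.U k := inf_le_right
  have h1 : φ.Bianchi H G (W ⊓ φ.U k) ↔ Y.res hV (Y.res (le_top : φ.U k ≤ ⊤) (Y.d ⊤ H.form) -
      Y.res (φ.U_le_comap_top k) (φ.pull ⊤ G.form)) = 0 := by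
    rw [map_sub, sub_eq_zero, Y.res_res, Y.res_res]
    rfl
  have h2 : ∀ w, Y.res hV (φ.bianchi2 k H w) ∈
      oddPoly fun α : Fin 16 => Y.res hV (φ.ψ k (chirP α)) := fun w => by
    refine res_mem_oddPoly hV (ψ := fun α => φ.ψ k (chirP α)) ?_
    rw [φ.bianchi2_eq hs hT hN]
    exact Submodule.smul_mem _ _ (quadratic_mem_oddPoly (φ.isCoframe k).2.1 fun α β =>
      M.vectorForm (fluxCoeff T (φ.fluxEven H k) (w 0) (w 1)) (chirP α) (chirP β))
  have h3 : ∀ w, Y.res hV (φ.bianchi3 k H w) ∈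
      oddPoly fun α : Fin 16 => Y.res hV (φ.ψ k (chirP α)) := fun w => by
    refine res_mem_oddPoly hV (ψ := fun α => φ.ψ k (chirP α)) ?_
    exact Submodule.neg_mem _ (Submodule.smul_mem _ _ (Submodule.sum_mem _ fun α _ =>
      single_mul_mem_oddPoly α ((φ.isCoframe k).coeff_mem _ _)))
  have h4 : ∀ w, Y.res hV (φ.bianchi4 k H G w) ∈
      oddPoly fun α : Fin 16 => Y.res hV (φ.ψ k (chirP α)) := fun w => by
    refine res_mem_oddPoly hV (ψ := fun α => φ.ψ k (chirP α)) ?_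
    exact mem_oddPoly_of_functions (Submodule.sub_mem _
      (Submodule.smul_mem _ _ ((φ.isCoframe k).coeff_mem _ _))
      (Submodule.smul_mem _ _ (even_mem_functions (φ.pb_mem k (G.comp_mem k _)))))
  rw [h1, φ.bianchi_expansion]
  simp only [map_add, map_sum, map_mul, res_wedgeSeq]
  rw [((φ.isCoframe k).res hV).sum_wedgeSeq_eq_zero_iff (by norm_num) (by norm_num) (by norm_num)
    h4 h3 h2, ← φ.bosonicBianchi_iff, ← φ.rheonomy_iff H Ht,
    φ.nonCritical_fluxFormula_iff hs hT hHt, ← φ.res_bianchi2_eq_zero_iff hs hT hN H hV]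
  have h5 : skew (fun w => Y.res hV (φ.bianchi2 k H w)) = 0 ↔
      ∀ w, Y.res hV (φ.bianchi2 k H w) = 0 := by
    rw [funext_iff]
    refine forall_congr' fun w => ?_
    rw [skew_res, (φ.isSkew_bianchi2 H).skew_eq]
    rfl
  rw [h5]

/-- The patches cover the worldvolume because their images cover the target, and forms are
determined locally. -/
theorem bianchi_iff (H : φ.Flux3) (G : Flux4 S) (W : Opens Y.body) :
    φ.Bianchi H G W ↔ ∀ k, φ.Bianchi H G (W ⊓ φ.U k) := by
  constructor
  · intro h k
    have := congrArg (Y.res (inf_le_left : W ⊓ φ.U k ≤ W)) h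
    rw [Y.res_res, Y.res_res] at this
    exact this
  · intro h
    have hW : W = sSup (Set.range fun k => W ⊓ φ.U k) := by
      refine le_antisymm (fun x hx => ?_) (sSup_le ?_)
      · have h1 : φ.base x ∈ ⨆ k, S.V k := by rw [S.cover]; trivial
        obtain ⟨k, hk⟩ := Opens.mem_iSup.1 h1
        exact Opens.mem_sSup.2 ⟨W ⊓ φ.U k, ⟨k, rfl⟩, hx, hk⟩
      · rintro _ ⟨k, rfl⟩
        exact inf_le_left
    refine eq_of_res_eq hW (by rintro _ ⟨k, rfl⟩; exact inf_le_left) ?_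
    rintro _ ⟨k, rfl⟩
    rw [Y.res_res, Y.res_res]
    exact h k

end M5SuperImmersion

end

theorem proposition3 {M : MajoranaRep} {X : SuperManifold 11 32} {S : SuperSpacetime M X}
    {Y : SuperManifold 6 16} (φ : M5SuperImmersion S Y) (G : Flux4 S) :
    (∃! Ht : φ.Tensor3, φ.IsShearTensor Ht) ∧
    ∀ Ht : φ.Tensor3, φ.IsShearTensor Ht → ∀ (H : φ.Flux3) (W : TopologicalSpace.Opens Y.body),
      φ.Bianchi H G W ↔
        ∀ k, φ.BosonicBianchi H G k W ∧ φ.Rheonomy H Ht k W ∧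
          (φ.NonCritical Ht k W ∧ φ.FluxFormula H Ht k W) := by
  refine ⟨φ.existsUnique_shearTensor, fun Ht hHt H W => ?_⟩
  rw [φ.bianchi_iff]
  exact forall_congr' fun k => φ.bianchi_patch_iff hHt H G W k
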